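/- Let $s(v,w)=v_1w_1+v_2w_2-v_3w_3-v_4w_4$ on $\mathbf R^{2,2}=\mathbf R^4$, let $O(2,2)$ be the group of automorphisms preserving $s$, and let $\mathrm{End}_+(\mathbf R^{2,2})$ be the space of $s$-self-adjoint endomorphisms, on which $O(2,2)$ acts by $T\mapsto LTL^{-1}$. Write $J_n(\lambda)$ for the real Jordan block, and $K_m(a,b)$ for the $2m\times 2m$ block with diagonal blocks $\begin{pmatrix}a&b\\-b&a\end{pmatrix}$, $b\neq0$, and $2\times2$ identity blocks above the diagonal. The following ten types are defined by the existence of a basis $v_1,\dots,v_4$ with the listed nonzero scalar products $s_{ij}=s_{ji}=s(v_i,v_j)$ with respect to which the endomorphism has the listed matrix ($\varepsilon,\omega\in\{\pm1\}$; all other letters real): - I: $s_{14}=s_{23}=\varepsilon$; $J_4(\lambda)$. - II: $s_{13}=1=-s_{24}$; $K_2(a,b)$. - IIIa: $s_{11}=1$, $s_{24}=s_{33}=-1$; $J_1(\lambda)\oplus J_3(\mu)$. - IIIb: $s_{13}=s_{22}=1$, $s_{44}=-1$; $J_3(\lambda)\oplus J_1(\mu)$. - IV: $s_{11}=1$, $s_{23}=\varepsilon$,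 $s_{44}=-1$; $J_1(\lambda)\oplus J_2(\mu)\oplus J_1(\nu)$. - V: $s_{11}=s_{22}=1$, $s_{33}=s_{44}=-1$; $J_1(\lambda)\oplus K_1(a,b)\oplus J_1(\nu)$. - VI: $s_{12}=\varepsilon$, $s_{33}=1$, $s_{44}=-1$; $J_2(\lambda)\oplus K_1(a,b)$. - VII: $s_{12}=\varepsilon$, $s_{34}=\omega$; $J_2(\lambda)\oplus J_2(\mu)$. - VIII: $s_{11}=s_{33}=1$, $s_{22}=s_{44}=-1$; $K_1(a,b)\oplus K_1(c,d)$. - IX: $s_{11}=s_{22}=1$, $s_{33}=s_{44}=-1$; $\mathrm{diag}(\lambda,\mu,\nu,\sigma)$. A parameter value $p$ of a type consists of its signs and its real parameters; let $m$ be the number of real parameters ($1,2,2,2,3,4,3,2,4,4$ respectively). Replace the basis by a pseudo-orthonormal one of signature $(2,2)$: if $v_i,v_j$ ($i<j$) satisfy $s_{ij}=\epsilon=\pm1$ and are orthogonal to themselves and to the other basis vectors, replace them by $(v_i+\epsilon v_j)/\sqrt2$ and $(v_i-\epsilon v_j)/\sqrt2$; keep every unit basis vector. Order the new vectors as follows,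 where $x_{ij},y_{ij}$ are the two vectors obtained from $v_i,v_j$: I $(x_{14},x_{23},y_{14},y_{23})$; II $(x_{13},x_{24},y_{13},y_{24})$; IIIa $(v_1,x_{24},v_3,y_{24})$; IIIb $(x_{13},v_2,y_{13},v_4)$; IV $(v_1,x_{23},y_{23},v_4)$; VI $(x_{12},v_3,v_4,y_{12})$; VII $(x_{12},x_{34},y_{12},y_{34})$; VIII $(v_1,v_3,v_2,v_4)$; V and IX $(v_1,v_2,v_3,v_4)$. The resulting matrix is the normal form $\underline M(p)$. Let $T(p)\in\mathrm{End}_+(\mathbf R^{2,2})$ be the endomorphism with matrix $\underline M(p)$ in the standard basis, and $K(p)\le O(2,2)$ the subgroup of elements commuting with $T(p)$. Then: 1. The action of $O(2,2)$ on $\mathrm{End}_+(\mathbf R^{2,2})$ is not transitive, and every orbit lies in exactly one of the ten types. 2. Each type is the union of the orbits of the $T(p)$, $p$ running over its parameter values. Within a type the orbits of $T(p)$ and $T(q)$ are equal if $p$ and $q$ describe the same data, and disjoint otherwise. Here "the same data" means $p=q$ for types I, IIIa, IIIb, IV; equality up to the signs of $b$ for types II, V, VI; equality up to the exchange $(\lambda,\varepsilon)\leftrightarrow(\mu,\omega)$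 for type VII; up to the signs of $b$ and $d$ and the exchange $(a,b)\leftrightarrow(c,d)$ for type VIII; and up to the exchanges $\lambda\leftrightarrow\mu$ and $\nu\leftrightarrow\sigma$ for type IX. Thus each type is the disjoint union of orbits that are in bijection with the parameter values modulo this relabelling. 3. An endomorphism in $\mathrm{End}_+(\mathbf R^{2,2})$ lies in the orbit of $T(p)$ if and only if it has the matrix $\underline M(p)$ with respect to some pseudo-orthonormal basis of signature $(2,2)$; equivalently, if and only if it has the matrix $C^{-1}\underline M(p)C$ with respect to some Witt basis $E_1,\dots,E_4$ (the only nonzero scalar products being $s(E_1,E_3)=s(E_2,E_4)=1$), where the columns of $C$ are $(e_1+e_3)/\sqrt2,\ (e_2+e_4)/\sqrt2,\ (e_1-e_3)/\sqrt2,\ (e_2-e_4)/\sqrt2$. 4. $O(2,2)$ is a $6$-dimensional embedded submanifold of the space of matrices, and, for every $p$, $K(p)$ is an embedded submanifold of some dimension $\dim K(p)\le6$. The quotient $O(2,2)/K(p)$ has a smooth manifold structure of dimension $6-\dim K(p)$ for which the projection from $O(2,2)$ is a submersion, the orbit of $T(p)$ is an embedded submanifold of $\mathrm{End}_+(\mathbf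 R^{2,2})$ of that dimension, and $LK(p)\mapsto LT(p)L^{-1}$ is a diffeomorphism from $O(2,2)/K(p)$ onto the orbit. 5. For every $p$ the number of degrees of freedom at $p$, that is, the rank at $(1,p)$ of the map $(L,q)\mapsto LT(q)L^{-1}$ of $L\in O(2,2)$ and of the $m$ real parameters (signs fixed), is $(6-\dim K(p))+m$. 6. Within each type, $K(p)$ is the same subgroup for all $p$ without coincidences between eigenvalues (no common complex eigenvalue of two different blocks), and for each choice of the signs these $p$ form an open dense subset of the space $\mathbf R^m$ of real parameters. -/

import Mathlib

open Set Matrix Manifold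
open scoped ContDiff

/-! Matrices carry the entrywise supremum norm (all norms on them are equivalent). -/

attribute [local instance] Matrix.normedAddCommGroup Matrix.normedSpace

noncomputable section

namespace Neutral

/-- Real `4 × 4` matrices, identified with the endomorphisms of `ℝ⁴` through the standard basis. -/
abbrev Mat4 : Type := Matrix (Fin 4) (Fin 4) ℝ

/-- The scalar product of `ℝ^{2,2}`. -/
def s22 (v w : Fin 4 → ℝ) : ℝ := v 0 * w 0 + v 1 * w 1 - v 2 * w 2 - v 3 * w 3

/-- `O(2,2)`: the automorphisms of `ℝ⁴` that preserve the scalar product. -/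
def O22 : Subgroup (GL (Fin 4) ℝ) where
  carrier := {L | ∀ v w, s22 ((L : Mat4) *ᵥ v) ((L : Mat4) *ᵥ w) = s22 v w}
  mul_mem' := by
    intro L M hL hM v w
    simp only [Set.mem_ofPred_eq, Units.val_mul, ← Matrix.mulVec_mulVec] at *
    rw [hL, hM]
  one_mem' := by
    intro v w
    simp
  inv_mem' := by
    intro L hL v w
    have h := hL (((L⁻¹ : GL (Fin 4) ℝ) : Mat4) *ᵥ v) (((L⁻¹ : GL (Fin 4) ℝ) : Mat4) *ᵥ w)
    rw [Matrix.mulVec_mulVec, Matrix.mulVec_mulVec, Units.mul_inv, Matrix.one_mulVec,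
      Matrix.one_mulVec] at h
    exact h.symm

/-- The matrix of an element of `O(2,2)` with respect to the standard basis. -/
def O22.mat (L : O22) : Mat4 := ((L : GL (Fin 4) ℝ) : Mat4)

/-- `End₊(ℝ^{2,2})`: the endomorphisms that are self-adjoint for the scalar product. -/
def EndPlus : Submodule ℝ Mat4 where
  carrier := {S | ∀ v w, s22 (S *ᵥ v) w = s22 v (S *ᵥ w)}
  add_mem' := by
    intro S T hS hT v w
    have h1 := hS v w
    have h2 := hT v w
    simp only [s22, Matrix.add_mulVec, Pi.add_apply] at *
    linarith
  zero_mem' := by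
    intro v w
    simp [s22]
  smul_mem' := by
    intro c S hS v w
    have h1 := hS v w
    simp only [s22, Matrix.smul_mulVec, Pi.smul_apply, smul_eq_mul] at *
    linear_combination c * h1

theorem conj_mem (L : O22) (S : EndPlus) :
    O22.mat L * (S : Mat4) * O22.mat L⁻¹ ∈ EndPlus := by
  intro v w
  have h1 : ∀ u, O22.mat L *ᵥ (O22.mat L⁻¹ *ᵥ u) = u := by
    intro u
    simp only [O22.mat, Subgroup.coe_inv, Matrix.mulVec_mulVec, Units.mul_inv,
      Matrix.one_mulVec]
  have hL : ∀ x y, s22 (O22.mat L *ᵥ x) (O22.mat L *ᵥ y) = s22 x y := L.2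
  have hS := S.2 (O22.mat L⁻¹ *ᵥ v) (O22.mat L⁻¹ *ᵥ w)
  rw [← hL, ← hL (O22.mat L⁻¹ *ᵥ v), h1, h1] at hS
  simpa only [← Matrix.mulVec_mulVec] using hS

/-- The conjugation action of `O(2,2)` on `End₊(ℝ^{2,2})`: `L • S = L S L⁻¹`. -/
instance : MulAction O22 EndPlus where
  smul L S := ⟨O22.mat L * (S : Mat4) * O22.mat L⁻¹, conj_mem L S⟩
  one_smul S := by
    apply Subtype.ext
    change O22.mat 1 * (S : Mat4) * O22.mat 1⁻¹ = S
    simp [O22.mat]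
  mul_smul L M S := by
    apply Subtype.ext
    change O22.mat (L * M) * (S : Mat4) * O22.mat (L * M)⁻¹
      = O22.mat L * (O22.mat M * (S : Mat4) * O22.mat M⁻¹) * O22.mat L⁻¹
    simp [O22.mat, mul_assoc]

/-- The subgroup of `O(2,2)` of all elements that commute with `S`. -/
def commutant (S : EndPlus) : Subgroup O22 where
  carrier := {L | O22.mat L * (S : Mat4) = (S : Mat4) * O22.mat L}
  mul_mem' := by
    intro L M hL hM
    have h : O22.mat (L * M) = O22.mat L * O22.mat M := rfl
    simp only [Set.mem_ofPred_eq] at *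
    rw [h, mul_assoc, hM, ← mul_assoc, hL, mul_assoc]
  one_mem' := by
    simp [O22.mat]
  inv_mem' := by
    intro L hL
    have h1 : O22.mat L⁻¹ * O22.mat L = 1 := by simp [O22.mat]
    have h2 : O22.mat L * O22.mat L⁻¹ = 1 := by simp [O22.mat]
    simp only [Set.mem_ofPred_eq] at *
    calc O22.mat L⁻¹ * (S : Mat4)
        = O22.mat L⁻¹ * ((S : Mat4) * O22.mat L) * O22.mat L⁻¹ := by
          rw [mul_assoc, mul_assoc, h2, mul_one]
      _ = (S : Mat4) * O22.mat L⁻¹ := by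
          rw [← hL, ← mul_assoc, h1, one_mul]

/-! ### The ten types and their normal forms -/

/-- The names of the ten types. -/
inductive EType : Type
  | I | II | IIIa | IIIb | IV | V | VI | VII | VIII | IX

/-- The number of signs `±1` that occur in the normal form of a type. -/
abbrev EType.numSigns : EType → ℕ
  | .I => 1 | .II => 0 | .IIIa => 0 | .IIIb => 0 | .IV => 1
  | .V => 0 | .VI => 1 | .VII => 2 | .VIII => 0 | .IX => 0

/-- The number of free real parameters of the normal form of a type. -/
abbrev EType.numParams : EType → ℕ
  | .I => 1 | .II => 2 | .IIIa => 2 | .IIIb => 2 | .IV => 3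
  | .V => 4 | .VI => 3 | .VII => 2 | .VIII => 4 | .IX => 4

/-- A sign `±1` as a real number. -/
abbrev sg (e : ℤˣ) : ℝ := ((e : ℤ) : ℝ)

/-- The real parameters are, in this order: I `(λ)`; II `(a, b)`; IIIa, IIIb `(λ, μ)`;
IV `(λ, μ, ν)`; V `(λ, a, b, ν)`; VI `(λ, a, b)`; VII `(λ, μ)`; VIII `(a, b, c, d)`;
IX `(λ, μ, ν, σ)`.  The eigenvalues `a ± ib` and `c ± id` have to be non-real. -/
def Admissible : (τ : EType) → (Fin τ.numParams → ℝ) → Prop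
  | .II, (x : Fin 2 → ℝ) => x 1 ≠ 0
  | .V, (x : Fin 4 → ℝ) => x 2 ≠ 0
  | .VI, (x : Fin 3 → ℝ) => x 2 ≠ 0
  | .VIII, (x : Fin 4 → ℝ) => x 1 ≠ 0 ∧ x 3 ≠ 0
  | _, _ => True

/-- The scalar products of the vectors of a basis adapted to the orthogonal decomposition of
a given type. -/
def adaptedGram : (τ : EType) → (Fin τ.numSigns → ℤˣ) → Mat4
  | .I, (e : Fin 1 → ℤˣ) =>
      !![0, 0, 0, sg (e 0); 0, 0, sg (e 0), 0; 0, sg (e 0), 0, 0; sg (e 0), 0, 0, 0]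
  | .II, _ => !![0, 0, 1, 0; 0, 0, 0, -1; 1, 0, 0, 0; 0, -1, 0, 0]
  | .IIIa, _ => !![1, 0, 0, 0; 0, 0, 0, -1; 0, 0, -1, 0; 0, -1, 0, 0]
  | .IIIb, _ => !![0, 0, 1, 0; 0, 1, 0, 0; 1, 0, 0, 0; 0, 0, 0, -1]
  | .IV, (e : Fin 1 → ℤˣ) =>
      !![1, 0, 0, 0; 0, 0, sg (e 0), 0; 0, sg (e 0), 0, 0; 0, 0, 0, -1]
  | .V, _ => !![1, 0, 0, 0; 0, 1, 0, 0; 0, 0, -1, 0; 0, 0, 0, -1]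
  | .VI, (e : Fin 1 → ℤˣ) =>
      !![0, sg (e 0), 0, 0; sg (e 0), 0, 0, 0; 0, 0, 1, 0; 0, 0, 0, -1]
  | .VII, (e : Fin 2 → ℤˣ) =>
      !![0, sg (e 0), 0, 0; sg (e 0), 0, 0, 0; 0, 0, 0, sg (e 1); 0, 0, sg (e 1), 0]
  | .VIII, _ => !![1, 0, 0, 0; 0, -1, 0, 0; 0, 0, 1, 0; 0, 0, 0, -1]
  | .IX, _ => !![1, 0, 0, 0; 0, 1, 0, 0; 0, 0, -1, 0; 0, 0, 0, -1]

/-- The realized Jordan canonical form of a type: real Jordan blocks `J_n(λ)`, and blocks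
`K_m(a, b)` built from `!![a, b; -b, a]` for a pair `a ± ib` of complex conjugate eigenvalues. -/
def jordan : (τ : EType) → (Fin τ.numParams → ℝ) → Mat4
  | .I, (x : Fin 1 → ℝ) => !![x 0, 1, 0, 0; 0, x 0, 1, 0; 0, 0, x 0, 1; 0, 0, 0, x 0]
  | .II, (x : Fin 2 → ℝ) =>
      !![x 0, x 1, 1, 0; -x 1, x 0, 0, 1; 0, 0, x 0, x 1; 0, 0, -x 1, x 0]
  | .IIIa, (x : Fin 2 → ℝ) => !![x 0, 0, 0, 0; 0, x 1, 1, 0; 0, 0, x 1, 1; 0, 0, 0, x 1]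
  | .IIIb, (x : Fin 2 → ℝ) => !![x 0, 1, 0, 0; 0, x 0, 1, 0; 0, 0, x 0, 0; 0, 0, 0, x 1]
  | .IV, (x : Fin 3 → ℝ) => !![x 0, 0, 0, 0; 0, x 1, 1, 0; 0, 0, x 1, 0; 0, 0, 0, x 2]
  | .V, (x : Fin 4 → ℝ) => !![x 0, 0, 0, 0; 0, x 1, x 2, 0; 0, -x 2, x 1, 0; 0, 0, 0, x 3]
  | .VI, (x : Fin 3 → ℝ) => !![x 0, 1, 0, 0; 0, x 0, 0, 0; 0, 0, x 1, x 2; 0, 0, -x 2, x 1]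
  | .VII, (x : Fin 2 → ℝ) => !![x 0, 1, 0, 0; 0, x 0, 0, 0; 0, 0, x 1, 1; 0, 0, 0, x 1]
  | .VIII, (x : Fin 4 → ℝ) =>
      !![x 0, x 1, 0, 0; -x 1, x 0, 0, 0; 0, 0, x 2, x 3; 0, 0, -x 3, x 2]
  | .IX, (x : Fin 4 → ℝ) => !![x 0, 0, 0, 0; 0, x 1, 0, 0; 0, 0, x 2, 0; 0, 0, 0, x 3]

/-- The normal form `M` of a type with respect to a pseudo-orthonormal basis. -/
def normalForm : (τ : EType) → (Fin τ.numSigns → ℤˣ) → (Fin τ.numParams → ℝ) → Mat4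
  | .I, (e : Fin 1 → ℤˣ), (x : Fin 1 → ℝ) =>
      !![x 0, 1 / 2, 0, 1 / 2;
         1 / 2, x 0 + sg (e 0) / 2, -1 / 2, -sg (e 0) / 2;
         0, 1 / 2, x 0, 1 / 2;
         -1 / 2, sg (e 0) / 2, 1 / 2, x 0 - sg (e 0) / 2]
  | .II, _, (x : Fin 2 → ℝ) =>
      !![x 0 + 1 / 2, 0, -1 / 2, x 1;
         0, x 0 - 1 / 2, -x 1, 1 / 2;
         1 / 2, x 1, x 0 - 1 / 2, 0;
         -x 1, -1 / 2, 0, x 0 + 1 / 2]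
  | .IIIa, _, (x : Fin 2 → ℝ) =>
      !![x 0, 0, 0, 0;
         0, x 1, 1 / √2, 0;
         0, -1 / √2, x 1, 1 / √2;
         0, 0, 1 / √2, x 1]
  | .IIIb, _, (x : Fin 2 → ℝ) =>
      !![x 0, 1 / √2, 0, 0;
         1 / √2, x 0, -1 / √2, 0;
         0, 1 / √2, x 0, 0;
         0, 0, 0, x 1]
  | .IV, (e : Fin 1 → ℤˣ), (x : Fin 3 → ℝ) =>
      !![x 0, 0, 0, 0;
         0, x 1 + sg (e 0) / 2, -sg (e 0) / 2, 0;
         0, sg (e 0) / 2, x 1 - sg (e 0) / 2, 0;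
         0, 0, 0, x 2]
  | .V, _, (x : Fin 4 → ℝ) =>
      !![x 0, 0, 0, 0;
         0, x 1, x 2, 0;
         0, -x 2, x 1, 0;
         0, 0, 0, x 3]
  | .VI, (e : Fin 1 → ℤˣ), (x : Fin 3 → ℝ) =>
      !![x 0 + sg (e 0) / 2, 0, 0, -sg (e 0) / 2;
         0, x 1, x 2, 0;
         0, -x 2, x 1, 0;
         sg (e 0) / 2, 0, 0, x 0 - sg (e 0) / 2]
  | .VII, (e : Fin 2 → ℤˣ), (x : Fin 2 → ℝ) =>
      !![x 0 + sg (e 0) / 2, 0, -sg (e 0) / 2, 0;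
         0, x 1 + sg (e 1) / 2, 0, -sg (e 1) / 2;
         sg (e 0) / 2, 0, x 0 - sg (e 0) / 2, 0;
         0, sg (e 1) / 2, 0, x 1 - sg (e 1) / 2]
  | .VIII, _, (x : Fin 4 → ℝ) =>
      !![x 0, 0, x 1, 0;
         0, x 2, 0, x 3;
         -x 1, 0, x 0, 0;
         0, -x 3, 0, x 2]
  | .IX, _, (x : Fin 4 → ℝ) =>
      !![x 0, 0, 0, 0;
         0, x 1, 0, 0;
         0, 0, x 2, 0;
         0, 0, 0, x 3]

theorem normalForm_mem (τ : EType) (e : Fin τ.numSigns → ℤˣ) (x : Fin τ.numParams → ℝ) :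
    normalForm τ e x ∈ EndPlus := by
  intro v w
  cases τ <;>
    simp only [normalForm, s22, Matrix.mulVec, dotProduct, Fin.sum_univ_four, Matrix.of_apply,
      Matrix.cons_val', Matrix.cons_val_zero, Matrix.cons_val_one, Matrix.cons_val] <;>
    ring

/-- The standard Witt basis, as the columns of a matrix: `E₁ = (e₁ + e₃)/√2`,
`E₂ = (e₂ + e₄)/√2`, `E₃ = (e₁ - e₃)/√2`, `E₄ = (e₂ - e₄)/√2`.  This matrix is its own inverse. -/
def stdWitt : Mat4 :=
  !![1 / √2, 0, 1 / √2, 0; 0, 1 / √2, 0, 1 / √2; 1 / √2, 0, -1 / √2, 0; 0, 1 / √2, 0, -1 / √2]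

/-- The normal form of a type with respect to a Witt basis. -/
def wittForm : (τ : EType) → (Fin τ.numSigns → ℤˣ) → (Fin τ.numParams → ℝ) → Mat4
  | .I, (e : Fin 1 → ℤˣ), (x : Fin 1 → ℝ) =>
      !![x 0, 1, 0, 0; 0, x 0, 0, sg (e 0); 0, 0, x 0, 0; 0, 0, 1, x 0]
  | .II, _, (x : Fin 2 → ℝ) =>
      !![x 0, x 1, 1, 0; -x 1, x 0, 0, -1; 0, 0, x 0, -x 1; 0, 0, x 1, x 0]
  | .VII, (e : Fin 2 → ℤˣ), (x : Fin 2 → ℝ) =>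
      !![x 0, 0, sg (e 0), 0; 0, x 1, 0, sg (e 1); 0, 0, x 0, 0; 0, 0, 0, x 1]
  | τ, e, x => stdWitt * normalForm τ e x * stdWitt

/-- `S` has matrix `M` with respect to some basis whose scalar products are the entries
of `G`. -/
def HasMatrixInBasis (S : EndPlus) (G M : Mat4) : Prop :=
  ∃ v : Module.Basis (Fin 4) ℝ (Fin 4 → ℝ),
    (∀ i j, s22 (v i) (v j) = G i j) ∧ LinearMap.toMatrix v v (Matrix.toLin' (S : Mat4)) = M

/-- The scalar products of a pseudo-orthonormal basis of signature `(2,2)`. -/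
def psiGram : Mat4 := !![1, 0, 0, 0; 0, 1, 0, 0; 0, 0, -1, 0; 0, 0, 0, -1]

/-- The scalar products of a Witt basis. -/
def wittGram : Mat4 := !![0, 0, 1, 0; 0, 0, 0, 1; 1, 0, 0, 0; 0, 1, 0, 0]

/-- The self-adjoint endomorphisms of a given type: those that have the Jordan form of the type
with respect to a basis adapted to the orthogonal decomposition of the type. -/
def ofType (τ : EType) : Set EndPlus :=
  {S | ∃ (e : Fin τ.numSigns → ℤˣ) (x : Fin τ.numParams → ℝ),
    Admissible τ x ∧ HasMatrixInBasis S (adaptedGram τ e) (jordan τ x)}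

/-- The parameter values of the normal form of a type. -/
structure Param (τ : EType) : Type where
  sign : Fin τ.numSigns → ℤˣ
  val : Fin τ.numParams → ℝ
  adm : Admissible τ val

/-- The endomorphism `T(p)` whose matrix with respect to the standard basis is the normal form
with parameter value `p`. -/
def Param.T {τ : EType} (p : Param τ) : EndPlus :=
  ⟨normalForm τ p.sign p.val, normalForm_mem τ p.sign p.val⟩

/-- Two parameter values of a type describe the same data up to the choice of one member of each
pair `a ± ib` (that is, the sign of `b`) and the order of summands of the same kind. -/
def SameData : (τ : EType) → Param τ → Param τ → Prop
  | .II, ⟨_, (x : Fin 2 → ℝ), _⟩, ⟨_, (y : Fin 2 → ℝ), _⟩ => x 0 = y 0 ∧ |x 1| = |y 1|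
  | .V, ⟨_, (x : Fin 4 → ℝ), _⟩, ⟨_, (y : Fin 4 → ℝ), _⟩ =>
      x 0 = y 0 ∧ x 1 = y 1 ∧ |x 2| = |y 2| ∧ x 3 = y 3
  | .VI, ⟨(e : Fin 1 → ℤˣ), (x : Fin 3 → ℝ), _⟩, ⟨(f : Fin 1 → ℤˣ), (y : Fin 3 → ℝ), _⟩ =>
      e 0 = f 0 ∧ x 0 = y 0 ∧ x 1 = y 1 ∧ |x 2| = |y 2|
  | .VII, ⟨(e : Fin 2 → ℤˣ), (x : Fin 2 → ℝ), _⟩, ⟨(f : Fin 2 → ℤˣ), (y : Fin 2 → ℝ), _⟩ =>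
      ((e 0 = f 0 ∧ x 0 = y 0) ∧ (e 1 = f 1 ∧ x 1 = y 1)) ∨
      ((e 0 = f 1 ∧ x 0 = y 1) ∧ (e 1 = f 0 ∧ x 1 = y 0))
  | .VIII, ⟨_, (x : Fin 4 → ℝ), _⟩, ⟨_, (y : Fin 4 → ℝ), _⟩ =>
      ((x 0 = y 0 ∧ |x 1| = |y 1|) ∧ (x 2 = y 2 ∧ |x 3| = |y 3|)) ∨
      ((x 0 = y 2 ∧ |x 1| = |y 3|) ∧ (x 2 = y 0 ∧ |x 3| = |y 1|))
  | .IX, ⟨_, (x : Fin 4 → ℝ), _⟩, ⟨_, (y : Fin 4 → ℝ), _⟩ =>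
      ((x 0 = y 0 ∧ x 1 = y 1) ∨ (x 0 = y 1 ∧ x 1 = y 0)) ∧
      ((x 2 = y 2 ∧ x 3 = y 3) ∨ (x 2 = y 3 ∧ x 3 = y 2))
  | _, p, q => p = q

/-- There is no coincidence between the eigenvalues of different summands. -/
def NoCoincidence : (τ : EType) → (Fin τ.numParams → ℝ) → Prop
  | .I, _ => True
  | .II, _ => True
  | .IIIa, (x : Fin 2 → ℝ) => x 0 ≠ x 1
  | .IIIb, (x : Fin 2 → ℝ) => x 0 ≠ x 1
  | .IV, (x : Fin 3 → ℝ) => x 0 ≠ x 1 ∧ x 1 ≠ x 2 ∧ x 0 ≠ x 2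
  | .V, (x : Fin 4 → ℝ) => x 0 ≠ x 3
  | .VI, _ => True
  | .VII, (x : Fin 2 → ℝ) => x 0 ≠ x 1
  | .VIII, (x : Fin 4 → ℝ) => ¬ (x 0 = x 2 ∧ |x 1| = |x 3|)
  | .IX, (x : Fin 4 → ℝ) => Function.Injective x

/-! ### Smooth structures and degrees of freedom -/

/-- The model space `ℝ^d`. -/
abbrev Euc (d : ℕ) : Type := EuclideanSpace ℝ (Fin d)

/-- With the given charts, `N` is a smooth `d`-dimensional manifold, and `ι` embeds it as a smooth
submanifold of the normed space `E`. -/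
def IsSubmanifold {N E : Type} [TopologicalSpace N] [NormedAddCommGroup E] [NormedSpace ℝ E]
    (d : ℕ) [ChartedSpace (Euc d) N] (ι : N → E) : Prop :=
  IsManifold (𝓡 d) ∞ N ∧ IsSmoothEmbedding (𝓡 d) 𝓘(ℝ, E) ∞ ι

/-- The velocities at time `0` of the curves `L(t) M(y(t)) L(t)⁻¹` with `L(0) = 1` and
`y(0) = x`, where `L(t)` in `O(2,2)` and the real parameters `y(t)` of the normal form vary
differentiably: the image of the differential at `(1, x)` of `(L, y) ↦ L M(y) L⁻¹`. -/
def variations {τ : EType} (p : Param τ) : Set Mat4 :=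
  {V | ∃ (L : ℝ → O22) (y : ℝ → Fin τ.numParams → ℝ), L 0 = 1 ∧ y 0 = p.val ∧
    DifferentiableAt ℝ (fun t => O22.mat (L t)) 0 ∧ DifferentiableAt ℝ y 0 ∧
    HasDerivAt (fun t => O22.mat (L t) * normalForm τ p.sign (y t) * O22.mat (L t)⁻¹) V 0}

/-- The number of degrees of freedom of a type at a parameter value `p`: the rank, at `T(p)`, of
its parametrization by the group and by the real parameters of the normal form. -/
def degreesOfFreedom {τ : EType} (p : Param τ) : ℕ :=
  Module.finrank ℝ (Submodule.span ℝ (variations p))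

end Neutral

end

noncomputable section

namespace Neutral

/-! ### Matrix form of the scalar product, adjoints and changes of basis -/

/-! The algebraic half rests on one translation. An element of the orbit of `T` is an endomorphism
with the matrix of `T` in some pseudo-orthonormal basis (`mem_orbit_iff_hasMat`). Everything about
orbits then becomes a statement about pairs consisting of a Gram matrix and a matrix, transported by
explicit base changes (`hasMat_iff_of_change`).

Existence of a normal form: write the minimal polynomial as `q ^ (m + 1) * r` with `q` irreducible
and prime to `r`. The operator `(q ^ m * r * r)(S)` is self-adjoint and nonzero, so its quadratic
form is nonzero at some vector. Applying `r(S)` to that vector gives a cyclic vector whose pairing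
with its top power is nonzero. Normalizing it yields one block (`exists_isBlock`). The span of a
block is nondegenerate and invariant, so its orthogonal complement is too, and induction on the
dimension gives an orthogonal decomposition (`exists_isDecomposition`). The signature (2,2) leaves
only the ten types (`not_three_orthogonal`, `exists_hasType`).

Uniqueness: on the kernel of `(S - t) ^ (k + 1)` the number of blocks of size `k + 1`, eigenvalue
`t` and sign `ε` is the positive index of the form `ε B((S - t) ^ k x, x)`. By an inertia argument
it depends on `S` only (`IsDecomposition.realCount_le`). Complex pairs are read off the
characteristic polynomial (`hasComplexPair_iff`). Types II and VIII, which have no real blocks,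
differ in whether a quadratic polynomial annihilates `S` (`not_hasMat_II_VIII`).

Smooth structures: all charts come from the inverse function theorem applied to products of Cayley
transforms with a linear transversal (`exists_slice`, `exists_manifold_of_slices`). The delicate
point is that an orbit is embedded, so a transversal at `T` must meet it only in `T` nearby. This
follows from the constancy along the orbit of the rank of `A ↦ A T - S A`
(`eventually_eq_zero_of_add_mem_orbit`). The same charts make the orbit map a linear projection,
hence a submersion.

Degrees of freedom: the velocities form the sum of the tangent space of the orbit, of dimension `6 -
dim ker (ad T)`, and the span of the parameter directions. A trace pairing shows that the sum is
direct (`disjoint_tangent`). For generic parameters every commuting isometry is diagonal and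
constant on blocks, and such a matrix commutes with every normal form of the type
(`commutant_le_of_noCoincidence`). -/

/-- Evaluate products and entries of explicit `4 × 4` matrices. -/
theorem s22_eq_dotProduct (v w : Fin 4 → ℝ) : s22 v w = v ⬝ᵥ (psiGram *ᵥ w) := by
  simp [s22, psiGram, Matrix.mulVec, dotProduct, Fin.sum_univ_four]
  ring

theorem psiGram_mul_self : psiGram * psiGram = 1 := by
  ext i j
  fin_cases i <;> fin_cases j <;> simp [psiGram, Matrix.mul_apply, Fin.sum_univ_four]

theorem psiGram_transpose : psiGramᵀ = psiGram := by
  ext i j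
  fin_cases i <;> fin_cases j <;> simp [psiGram]

theorem isUnit_det_psiGram : IsUnit psiGram.det := by
  have h := congrArg Matrix.det psiGram_mul_self
  rw [Matrix.det_mul, Matrix.det_one] at h
  exact .of_mul_eq_one _ h

theorem s22_mulVec (A C : Mat4) (v w : Fin 4 → ℝ) :
    s22 (A *ᵥ v) (C *ᵥ w) = v ⬝ᵥ ((Aᵀ * psiGram * C) *ᵥ w) := by
  rw [s22_eq_dotProduct, Matrix.dotProduct_mulVec, Matrix.dotProduct_mulVec,
    Matrix.vecMul_mulVec, ← Matrix.dotProduct_mulVec, ← Matrix.dotProduct_mulVec,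
    Matrix.mulVec_mulVec]

theorem eq_of_forall_dotProduct {A C : Mat4} (h : ∀ v w, v ⬝ᵥ (A *ᵥ w) = v ⬝ᵥ (C *ᵥ w)) :
    A = C := by
  ext i j
  simpa [single_one_dotProduct] using h (Pi.single i 1) (Pi.single j 1)

/-- The adjoint of an endomorphism with respect to the scalar product of `ℝ^{2,2}`. -/
def adj (A : Mat4) : Mat4 := psiGram * Aᵀ * psiGram

theorem adj_mul (A C : Mat4) : adj (A * C) = adj C * adj A := by
  simp only [adj, Matrix.transpose_mul]
  have h := psiGram_mul_self
  calc psiGram * (Cᵀ * Aᵀ) * psiGram = psiGram * Cᵀ * 1 * Aᵀ * psiGram := by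
        simp only [mul_one, mul_assoc]
    _ = _ := by rw [← h]; simp only [mul_assoc]

@[simp] theorem adj_one : adj 1 = 1 := by simp [adj, psiGram_mul_self]

@[simp] theorem adj_add (A C : Mat4) : adj (A + C) = adj A + adj C := by
  simp [adj, mul_add, add_mul]

@[simp] theorem adj_sub (A C : Mat4) : adj (A - C) = adj A - adj C := by
  simp [adj, mul_sub, sub_mul]

@[simp] theorem adj_smul (c : ℝ) (A : Mat4) : adj (c • A) = c • adj A := by simp [adj]

@[simp] theorem adj_adj (A : Mat4) : adj (adj A) = A := by
  simp only [adj, Matrix.transpose_mul, psiGram_transpose, Matrix.transpose_transpose]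
  calc psiGram * (psiGram * (A * psiGram)) * psiGram
      = (psiGram * psiGram) * A * (psiGram * psiGram) := by simp only [mul_assoc]
    _ = A := by rw [psiGram_mul_self, one_mul, mul_one]

theorem adj_mul_self_eq_one_iff (A : Mat4) : adj A * A = 1 ↔ Aᵀ * psiGram * A = psiGram := by
  have h := psiGram_mul_self
  constructor
  · intro hA
    calc Aᵀ * psiGram * A = psiGram * psiGram * Aᵀ * psiGram * A := by rw [h, one_mul]
      _ = psiGram * (adj A * A) := by simp only [adj, mul_assoc]
      _ = psiGram := by rw [hA, mul_one]
  · intro hA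
    calc adj A * A = psiGram * (Aᵀ * psiGram * A) := by simp only [adj, mul_assoc]
      _ = 1 := by rw [hA, h]

theorem mem_O22_iff_transpose (L : GL (Fin 4) ℝ) :
    L ∈ O22 ↔ (L : Mat4)ᵀ * psiGram * (L : Mat4) = psiGram := by
  constructor
  · intro hL
    refine eq_of_forall_dotProduct fun v w => ?_
    rw [← s22_mulVec, ← s22_eq_dotProduct]
    exact hL v w
  · intro hL v w
    rw [s22_mulVec, hL, ← s22_eq_dotProduct]

theorem O22.adj_mul_mat (L : O22) : adj (O22.mat L) * O22.mat L = 1 :=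
  (adj_mul_self_eq_one_iff _).2 ((mem_O22_iff_transpose _).1 L.2)

theorem O22.mat_mul (L M : O22) : O22.mat (L * M) = O22.mat L * O22.mat M := rfl

@[simp] theorem O22.mat_one : O22.mat 1 = 1 := rfl

theorem O22.mat_mul_inv (L : O22) : O22.mat L * O22.mat L⁻¹ = 1 := by
  rw [← O22.mat_mul, mul_inv_cancel, O22.mat_one]

theorem O22.mat_inv_mul (L : O22) : O22.mat L⁻¹ * O22.mat L = 1 := by
  rw [← O22.mat_mul, inv_mul_cancel, O22.mat_one]

theorem O22.mat_inv (L : O22) : O22.mat L⁻¹ = adj (O22.mat L) := by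
  calc O22.mat L⁻¹ = adj (O22.mat L) * O22.mat L * O22.mat L⁻¹ := by
        rw [O22.adj_mul_mat, one_mul]
    _ = adj (O22.mat L) := by rw [mul_assoc, O22.mat_mul_inv, mul_one]

theorem O22.mat_injective : Function.Injective O22.mat := fun _ _ h =>
  Subtype.ext (Units.ext h)

/-- A matrix that satisfies `A* A = 1`, as an element of `O(2,2)`. -/
def O22.ofMat (A : Mat4) (h : adj A * A = 1) : O22 :=
  ⟨⟨A, adj A, mul_eq_one_comm.1 h, h⟩,
    (mem_O22_iff_transpose _).2 ((adj_mul_self_eq_one_iff _).1 h)⟩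

@[simp] theorem O22.mat_ofMat (A : Mat4) (h : adj A * A = 1) : O22.mat (O22.ofMat A h) = A := rfl

theorem mem_EndPlus_iff (S : Mat4) : S ∈ EndPlus ↔ adj S = S := by
  have h := psiGram_mul_self
  have key : S ∈ EndPlus ↔ Sᵀ * psiGram = psiGram * S := by
    constructor
    · intro hS
      refine eq_of_forall_dotProduct fun v w => ?_
      have h1 := s22_mulVec S 1 v w
      have h2 := s22_mulVec 1 S v w
      simp only [Matrix.one_mulVec, Matrix.transpose_one, one_mul, mul_one] at h1 h2
      rw [← h1, ← h2]
      exact hS v w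
    · intro hS v w
      have h1 := s22_mulVec S 1 v w
      have h2 := s22_mulVec 1 S v w
      simp only [Matrix.one_mulVec, Matrix.transpose_one, one_mul, mul_one] at h1 h2
      rw [h1, h2, hS]
  rw [key]
  constructor
  · intro hS
    rw [adj, mul_assoc, hS, ← mul_assoc, h, one_mul]
  · intro hS
    calc Sᵀ * psiGram = psiGram * adj S := by
          rw [adj, mul_assoc, ← mul_assoc, h, one_mul]
      _ = psiGram * S := by rw [hS]

theorem EndPlus.adj_eq (S : EndPlus) : adj (S : Mat4) = S := (mem_EndPlus_iff _).1 S.2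

theorem coe_smul_EndPlus (L : O22) (S : EndPlus) :
    ((L • S : EndPlus) : Mat4) = O22.mat L * (S : Mat4) * O22.mat L⁻¹ := rfl

/-- `S` has matrix `M` with respect to the columns of some matrix `P` whose scalar products are
the entries of `G`. -/
def HasMat (S G M : Mat4) : Prop := ∃ P : Mat4, Pᵀ * psiGram * P = G ∧ S * P = P * M

theorem isUnit_det_of_gram {P G : Mat4} (hG : IsUnit G.det) (h : Pᵀ * psiGram * P = G) :
    IsUnit P.det := by
  rw [← h, Matrix.det_mul] at hG
  exact isUnit_of_mul_isUnit_right hG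

/-- The basis vectors are the columns of `P`. Nondegeneracy of `G` already forces `P` to be
invertible, so the matrix version needs no separate condition that the columns form a basis. -/
theorem hasMatrixInBasis_iff (S : EndPlus) {G : Mat4} (M : Mat4) (hG : IsUnit G.det) :
    HasMatrixInBasis S G M ↔ HasMat S G M := by
  have hcol : ∀ (P : Mat4) (j : Fin 4), (fun i => P i j) = P *ᵥ Pi.single j 1 := by
    intro P j
    ext i
    simp
  constructor
  · rintro ⟨v, hv, hM⟩
    refine ⟨Matrix.of fun i j => v j i, ?_, ?_⟩
    · ext i j
      have h := s22_mulVec (Matrix.of fun i j => v j i) (Matrix.of fun i j => v j i)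
        (Pi.single i 1) (Pi.single j 1)
      rw [← hcol, ← hcol] at h
      simp only [Matrix.of_apply, single_one_dotProduct, Matrix.mulVec_single_one] at h
      exact Eq.trans h.symm (hv i j)
    · ext i j
      have h := congrFun (Matrix.toLin_self v v M j) i
      rw [← hM, Matrix.toLin_toMatrix, hM] at h
      simp only [Matrix.toLin'_apply, Finset.sum_apply, Pi.smul_apply, smul_eq_mul] at h
      simp only [Matrix.mul_apply, Matrix.of_apply]
      rw [Matrix.mulVec, dotProduct] at h
      rw [h]
      exact Finset.sum_congr rfl fun _ _ => mul_comm _ _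
  · rintro ⟨P, hP, hM⟩
    have hu := isUnit_det_of_gram hG hP
    have hind : LinearIndependent ℝ P.col := Matrix.linearIndependent_cols_iff_isUnit.2
      ((Matrix.isUnit_iff_isUnit_det _).2 hu)
    have hb : ∀ j, basisOfLinearIndependentOfCardEqFinrank hind (by simp) j = fun i => P i j := by
      intro j
      rw [coe_basisOfLinearIndependentOfCardEqFinrank]
      rfl
    refine ⟨basisOfLinearIndependentOfCardEqFinrank hind (by simp), ?_, ?_⟩
    · intro i j
      rw [hb, hb, hcol, hcol, s22_mulVec, hP]
      simp
    · rw [← LinearEquiv.eq_symm_apply, LinearMap.toMatrix_symm]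
      refine Module.Basis.ext (basisOfLinearIndependentOfCardEqFinrank hind (by simp)) fun j => ?_
      rw [Matrix.toLin_self]
      ext i
      have h := congrFun (congrFun hM i) j
      simp only [Matrix.mul_apply] at h
      simp only [hb, Matrix.toLin'_apply, Finset.sum_apply, Pi.smul_apply, smul_eq_mul,
        Matrix.mulVec, dotProduct]
      rw [h]
      exact Finset.sum_congr rfl fun _ _ => mul_comm _ _

theorem HasMat.change {S G M G' M' Q : Mat4} (h : HasMat S G M) (hG : Qᵀ * G * Q = G')
    (hM : M * Q = Q * M') : HasMat S G' M' := by
  obtain ⟨P, h1, h2⟩ := h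
  refine ⟨P * Q, ?_, ?_⟩
  · rw [← hG, ← h1, Matrix.transpose_mul]
    simp only [mul_assoc]
  · rw [← mul_assoc, h2, mul_assoc, hM, mul_assoc]

theorem hasMat_iff_of_change {S G M G' M' Q : Mat4} (hQ : IsUnit Q.det) (hG : Qᵀ * G * Q = G')
    (hM : M * Q = Q * M') : HasMat S G M ↔ HasMat S G' M' := by
  refine ⟨fun h => h.change hG hM, fun h => h.change (Q := Q⁻¹) ?_ ?_⟩
  · rw [← hG, Matrix.transpose_nonsing_inv]
    have hQt : IsUnit Qᵀ.det := by rwa [Matrix.det_transpose]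
    calc Qᵀ⁻¹ * (Qᵀ * G * Q) * Q⁻¹ = (Qᵀ⁻¹ * Qᵀ) * G * (Q * Q⁻¹) := by simp only [mul_assoc]
      _ = G := by rw [Matrix.nonsing_inv_mul _ hQt, Matrix.mul_nonsing_inv _ hQ, one_mul, mul_one]
  · calc M' * Q⁻¹ = Q⁻¹ * Q * M' * Q⁻¹ := by rw [Matrix.nonsing_inv_mul _ hQ, one_mul]
      _ = Q⁻¹ * (Q * M') * Q⁻¹ := by simp only [mul_assoc]
      _ = Q⁻¹ * M := by
        rw [← hM, mul_assoc, mul_assoc, Matrix.mul_nonsing_inv _ hQ, mul_one]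

/-- A matrix with pseudo-orthonormal columns is itself an element of the group, and `S P = P T` says
that this element carries `T` to `S`. -/
theorem mem_orbit_iff_hasMat (S T : EndPlus) :
    S ∈ MulAction.orbit O22 T ↔ HasMat S psiGram T := by
  constructor
  · rintro ⟨L, rfl⟩
    refine ⟨O22.mat L, (mem_O22_iff_transpose _).1 L.2, ?_⟩
    change O22.mat L * (T : Mat4) * O22.mat L⁻¹ * O22.mat L = _
    rw [mul_assoc, O22.mat_inv_mul, mul_one]
  · rintro ⟨P, h1, h2⟩
    refine ⟨O22.ofMat P ((adj_mul_self_eq_one_iff _).2 h1), Subtype.ext ?_⟩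
    change O22.mat (O22.ofMat P _) * (T : Mat4) * O22.mat (O22.ofMat P _)⁻¹ = S
    rw [O22.mat_ofMat, ← h2, mul_assoc]
    nth_rewrite 1 [← O22.mat_ofMat P ((adj_mul_self_eq_one_iff _).2 h1)]
    rw [O22.mat_mul_inv, mul_one]

/-! ### The normal forms -/

theorem sg_mul_self (e : ℤˣ) : sg e * sg e = 1 := by
  rcases Int.units_eq_one_or e with rfl | rfl <;> norm_num [sg]

theorem inv_sqrt_two_mul_self : (√2)⁻¹ * (√2)⁻¹ = (2⁻¹ : ℝ) := by
  rw [← mul_inv, Real.mul_self_sqrt (by norm_num)]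

/-- The pseudo-orthonormal basis of the normal form, in terms of the adapted basis. -/
def adaptedToPsi : (τ : EType) → (Fin τ.numSigns → ℤˣ) → Mat4
  | .I, (e : Fin 1 → ℤˣ) => (√2)⁻¹ •
      !![1, 0, 1, 0; 0, 1, 0, 1; 0, sg (e 0), 0, -sg (e 0); sg (e 0), 0, -sg (e 0), 0]
  | .II, _ => (√2)⁻¹ • !![1, 0, 1, 0; 0, 1, 0, 1; 1, 0, -1, 0; 0, -1, 0, 1]
  | .IIIa, _ => !![1, 0, 0, 0; 0, (√2)⁻¹, 0, (√2)⁻¹; 0, 0, 1, 0; 0, -(√2)⁻¹, 0, (√2)⁻¹]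
  | .IIIb, _ => !![(√2)⁻¹, 0, (√2)⁻¹, 0; 0, 1, 0, 0; (√2)⁻¹, 0, -(√2)⁻¹, 0; 0, 0, 0, 1]
  | .IV, (e : Fin 1 → ℤˣ) => !![1, 0, 0, 0; 0, (√2)⁻¹, (√2)⁻¹, 0;
      0, sg (e 0) * (√2)⁻¹, -(sg (e 0) * (√2)⁻¹), 0; 0, 0, 0, 1]
  | .VI, (e : Fin 1 → ℤˣ) => !![(√2)⁻¹, 0, 0, (√2)⁻¹;
      sg (e 0) * (√2)⁻¹, 0, 0, -(sg (e 0) * (√2)⁻¹); 0, 1, 0, 0; 0, 0, 1, 0]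
  | .VII, (e : Fin 2 → ℤˣ) => (√2)⁻¹ •
      !![1, 0, 1, 0; sg (e 0), 0, -sg (e 0), 0; 0, 1, 0, 1; 0, sg (e 1), 0, -sg (e 1)]
  | .VIII, _ => !![1, 0, 0, 0; 0, 0, 1, 0; 0, 1, 0, 0; 0, 0, 0, 1]
  | _, _ => 1

theorem adaptedToPsi_gram (τ : EType) (e : Fin τ.numSigns → ℤˣ) :
    (adaptedToPsi τ e)ᵀ * adaptedGram τ e * adaptedToPsi τ e = psiGram := by
  have h2 := inv_sqrt_two_mul_self
  have h3 : ∀ e : ℤˣ, sg e ^ 2 = 1 := fun e => by rw [sq, sg_mul_self]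
  rw [← sq] at h2
  cases τ <;> ext i j <;> fin_cases i <;> fin_cases j <;>
    simp [adaptedToPsi, adaptedGram, psiGram, Matrix.mul_apply, Fin.sum_univ_four] <;>
    ring_nf <;> simp [h3]

theorem jordan_mul_adaptedToPsi (τ : EType) (e : Fin τ.numSigns → ℤˣ)
    (x : Fin τ.numParams → ℝ) :
    jordan τ x * adaptedToPsi τ e = adaptedToPsi τ e * normalForm τ e x := by
  cases τ <;> ext i j <;> fin_cases i <;> fin_cases j <;>
    simp [adaptedToPsi, jordan, normalForm, Matrix.mul_apply, Fin.sum_univ_four] <;>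
    ring_nf <;> simp

theorem isUnit_det_adaptedToPsi (τ : EType) (e : Fin τ.numSigns → ℤˣ) :
    IsUnit (adaptedToPsi τ e).det := by
  have h := isUnit_det_psiGram
  rw [← adaptedToPsi_gram τ e, Matrix.det_mul] at h
  exact isUnit_of_mul_isUnit_right h

theorem isUnit_det_adaptedGram (τ : EType) (e : Fin τ.numSigns → ℤˣ) :
    IsUnit (adaptedGram τ e).det := by
  have h := isUnit_det_psiGram
  rw [← adaptedToPsi_gram τ e, Matrix.det_mul, Matrix.det_mul] at h
  exact isUnit_of_mul_isUnit_right (isUnit_of_mul_isUnit_left h)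

theorem hasMat_adapted_iff (S : Mat4) (τ : EType) (e : Fin τ.numSigns → ℤˣ)
    (x : Fin τ.numParams → ℝ) :
    HasMat S (adaptedGram τ e) (jordan τ x) ↔ HasMat S psiGram (normalForm τ e x) :=
  hasMat_iff_of_change (isUnit_det_adaptedToPsi τ e) (adaptedToPsi_gram τ e)
    (jordan_mul_adaptedToPsi τ e x)

theorem mem_ofType_iff (S : EndPlus) (τ : EType) :
    S ∈ ofType τ ↔ ∃ p : Param τ, HasMat S (adaptedGram τ p.sign) (jordan τ p.val) := by
  constructor
  · rintro ⟨e, x, hx, h⟩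
    exact ⟨⟨e, x, hx⟩, (hasMatrixInBasis_iff S _ (isUnit_det_adaptedGram τ e)).1 h⟩
  · rintro ⟨p, h⟩
    exact ⟨p.sign, p.val, p.adm,
      (hasMatrixInBasis_iff S _ (isUnit_det_adaptedGram τ p.sign)).2 h⟩

theorem mem_orbit_T_iff {τ : EType} (p : Param τ) (S : EndPlus) :
    S ∈ MulAction.orbit O22 p.T ↔ HasMat S psiGram (normalForm τ p.sign p.val) :=
  mem_orbit_iff_hasMat S p.T

theorem mem_orbit_T_iff_adapted {τ : EType} (p : Param τ) (S : EndPlus) :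
    S ∈ MulAction.orbit O22 p.T ↔ HasMat S (adaptedGram τ p.sign) (jordan τ p.val) :=
  (mem_orbit_T_iff p S).trans (hasMat_adapted_iff _ _ _ _).symm

theorem ofType_eq_iUnion_orbit (τ : EType) :
    ofType τ = ⋃ p : Param τ, MulAction.orbit O22 p.T := by
  ext S
  simp only [mem_ofType_iff, mem_iUnion, mem_orbit_T_iff_adapted]

theorem stdWitt_mul_self : stdWitt * stdWitt = 1 := by
  have h2 := inv_sqrt_two_mul_self
  ext i j
  fin_cases i <;> fin_cases j <;>
    simp [stdWitt, Matrix.mul_apply, Fin.sum_univ_four, neg_div, h2] <;> norm_num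

theorem stdWitt_gram : stdWittᵀ * psiGram * stdWitt = wittGram := by
  have h2 := inv_sqrt_two_mul_self
  ext i j
  fin_cases i <;> fin_cases j <;>
    simp [stdWitt, psiGram, wittGram, Matrix.mul_apply, Fin.sum_univ_four, neg_div, h2] <;>
    norm_num

theorem isUnit_det_stdWitt : IsUnit stdWitt.det := by
  have h := congrArg Matrix.det stdWitt_mul_self
  rw [Matrix.det_mul, Matrix.det_one] at h
  exact .of_mul_eq_one _ h

theorem isUnit_det_wittGram : IsUnit wittGram.det := by
  rw [← stdWitt_gram, Matrix.det_mul, Matrix.det_mul, Matrix.det_transpose]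
  exact (isUnit_det_stdWitt.mul isUnit_det_psiGram).mul isUnit_det_stdWitt

/-- Only I, II and VII have explicitly written Witt forms and need a computation; for the other
types the Witt form is defined as the conjugate by the involution `stdWitt`. -/
theorem stdWitt_mul_wittForm (τ : EType) (e : Fin τ.numSigns → ℤˣ) (x : Fin τ.numParams → ℝ) :
    normalForm τ e x * stdWitt = stdWitt * wittForm τ e x := by
  have generic : ∀ N : Mat4, N * stdWitt = stdWitt * (stdWitt * N * stdWitt) := fun N => by
    rw [← mul_assoc, ← mul_assoc, stdWitt_mul_self, one_mul]
  cases τ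
  case I | II | VII =>
    ext i j
    fin_cases i <;> fin_cases j <;>
      simp [stdWitt, normalForm, wittForm, Matrix.mul_apply, Fin.sum_univ_four] <;> ring
  all_goals exact generic _

theorem mem_orbit_T_iff_bases {τ : EType} (p : Param τ) (S : EndPlus) :
    (S ∈ MulAction.orbit O22 p.T ↔
      HasMatrixInBasis S psiGram (normalForm τ p.sign p.val)) ∧
    (S ∈ MulAction.orbit O22 p.T ↔
      HasMatrixInBasis S wittGram (wittForm τ p.sign p.val)) := by
  rw [hasMatrixInBasis_iff S _ isUnit_det_psiGram, hasMatrixInBasis_iff S _ isUnit_det_wittGram,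
    mem_orbit_T_iff]
  exact ⟨Iff.rfl, hasMat_iff_of_change isUnit_det_stdWitt stdWitt_gram
    (stdWitt_mul_wittForm τ p.sign p.val)⟩

/-! ### Relabelling the parameters -/

/-- Relabellings are realized by isometries of the standard basis: reflections change the sign of an
imaginary part, permutations of vectors of equal square exchange summands. -/
theorem orbit_eq_of_change {τ : EType} {p q : Param τ} (Q : Mat4)
    (hG : Qᵀ * psiGram * Q = psiGram)
    (hM : normalForm τ p.sign p.val * Q = Q * normalForm τ q.sign q.val) :
    MulAction.orbit O22 p.T = MulAction.orbit O22 q.T := by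
  ext S
  rw [mem_orbit_T_iff, mem_orbit_T_iff]
  exact hasMat_iff_of_change (isUnit_det_of_gram isUnit_det_psiGram hG) hG hM

/-- Exchange the first two and the last two vectors of the standard basis. -/
def swapBoth : Mat4 := !![0, 1, 0, 0; 1, 0, 0, 0; 0, 0, 0, 1; 0, 0, 1, 0]

/-- Exchange the first two vectors of the standard basis. -/
def swapPos : Mat4 := !![0, 1, 0, 0; 1, 0, 0, 0; 0, 0, 1, 0; 0, 0, 0, 1]

/-- Exchange the last two vectors of the standard basis. -/
def swapNeg : Mat4 := !![1, 0, 0, 0; 0, 1, 0, 0; 0, 0, 0, 1; 0, 0, 1, 0]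

theorem diagonal_gram {s : Fin 4 → ℝ} (hs : ∀ i, s i * s i = 1) :
    (Matrix.diagonal s)ᵀ * psiGram * Matrix.diagonal s = psiGram := by
  ext i j
  have h := hs i
  rw [Matrix.diagonal_transpose, Matrix.mul_diagonal, Matrix.diagonal_mul]
  fin_cases i <;> fin_cases j <;> simp_all [psiGram]

theorem swapBoth_gram : swapBothᵀ * psiGram * swapBoth = psiGram := by
  ext i j
  fin_cases i <;> fin_cases j <;>
    simp [swapBoth, psiGram, Matrix.mul_apply, Fin.sum_univ_four]

theorem swapPos_gram : swapPosᵀ * psiGram * swapPos = psiGram := by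
  ext i j
  fin_cases i <;> fin_cases j <;>
    simp [swapPos, psiGram, Matrix.mul_apply, Fin.sum_univ_four]

theorem swapNeg_gram : swapNegᵀ * psiGram * swapNeg = psiGram := by
  ext i j
  fin_cases i <;> fin_cases j <;>
    simp [swapNeg, psiGram, Matrix.mul_apply, Fin.sum_univ_four]

/-- The sign by which two numbers with equal absolute value differ. -/
theorem exists_sign_of_abs_eq {a b : ℝ} (h : |a| = |b|) : ∃ s : ℝ, s * s = 1 ∧ a * s = b := by
  rcases abs_eq_abs.1 h with rfl | rfl
  · exact ⟨1, by norm_num, by ring⟩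
  · exact ⟨-1, by norm_num, by ring⟩

theorem mul_sign_symm {a b s : ℝ} (hs : s * s = 1) (h : a * s = b) : a = b * s := by
  rw [← h, mul_assoc, hs, mul_one]

theorem orbit_eq_of_sameData (τ : EType) (p q : Param τ) (h : SameData τ p q) :
    MulAction.orbit O22 p.T = MulAction.orbit O22 q.T := by
  obtain ⟨e, x, hx⟩ := p
  obtain ⟨f, y, hy⟩ := q
  cases τ
  case I | IIIa | IIIb | IV => exact congrArg (fun r : Param _ => MulAction.orbit O22 r.T) h
  case II =>
    obtain ⟨h0, h1⟩ := h
    obtain ⟨s, hs, h1⟩ := exists_sign_of_abs_eq h1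
    have h2 := mul_sign_symm hs h1
    refine orbit_eq_of_change (Matrix.diagonal ![1, s, 1, s]) (diagonal_gram fun i => ?_) ?_
    · fin_cases i <;> simp [hs]
    · ext i j
      rw [Matrix.mul_diagonal, Matrix.diagonal_mul]
      fin_cases i <;> fin_cases j <;> simp [normalForm] <;> grind
  case V =>
    obtain ⟨h0, h1, h2, h3⟩ := h
    obtain ⟨s, hs, h4⟩ := exists_sign_of_abs_eq h2
    have h5 := mul_sign_symm hs h4
    refine orbit_eq_of_change (Matrix.diagonal ![1, 1, s, 1]) (diagonal_gram fun i => ?_) ?_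
    · fin_cases i <;> simp [hs]
    · ext i j
      rw [Matrix.mul_diagonal, Matrix.diagonal_mul]
      fin_cases i <;> fin_cases j <;> simp [normalForm] <;> grind
  case VI =>
    obtain ⟨h0, h1, h2, h3⟩ := h
    obtain ⟨s, hs, h4⟩ := exists_sign_of_abs_eq h3
    have h5 := mul_sign_symm hs h4
    refine orbit_eq_of_change (Matrix.diagonal ![1, 1, s, 1]) (diagonal_gram fun i => ?_) ?_
    · fin_cases i <;> simp [hs]
    · ext i j
      rw [Matrix.mul_diagonal, Matrix.diagonal_mul]
      fin_cases i <;> fin_cases j <;> simp [normalForm] <;> grind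
  case VII =>
    rcases h with ⟨⟨h0, h1⟩, h2, h3⟩ | ⟨⟨h0, h1⟩, h2, h3⟩
    · refine orbit_eq_of_change 1 (by simp) ?_
      ext i j
      fin_cases i <;> fin_cases j <;> simp [normalForm, h0, h1, h2, h3]
    · refine orbit_eq_of_change swapBoth swapBoth_gram ?_
      ext i j
      fin_cases i <;> fin_cases j <;>
        simp [normalForm, swapBoth, Matrix.mul_apply, Fin.sum_univ_four, h0, h1, h2, h3]
  case VIII =>
    rcases h with ⟨⟨h0, h1⟩, h2, h3⟩ | ⟨⟨h0, h1⟩, h2, h3⟩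
    all_goals
      obtain ⟨s, hs, h4⟩ := exists_sign_of_abs_eq h1
      obtain ⟨t, ht, h5⟩ := exists_sign_of_abs_eq h3
      have h6 := mul_sign_symm hs h4
      have h7 := mul_sign_symm ht h5
    · refine orbit_eq_of_change (Matrix.diagonal ![1, 1, s, t]) (diagonal_gram fun i => ?_) ?_
      · fin_cases i <;> simp [hs, ht]
      · ext i j
        rw [Matrix.mul_diagonal, Matrix.diagonal_mul]
        fin_cases i <;> fin_cases j <;> simp [normalForm] <;> grind
    · refine orbit_eq_of_change (Matrix.diagonal ![1, 1, s, t] * swapBoth) ?_ ?_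
      · have h8 := diagonal_gram (s := ![1, 1, s, t]) fun i => by
          fin_cases i <;> simp [hs, ht]
        rw [Matrix.transpose_mul]
        calc _ = swapBothᵀ * ((Matrix.diagonal ![1, 1, s, t])ᵀ * psiGram *
              Matrix.diagonal ![1, 1, s, t]) * swapBoth := by simp only [mul_assoc]
          _ = psiGram := by rw [h8, swapBoth_gram]
      · ext i j
        fin_cases i <;> fin_cases j <;>
          simp [normalForm, swapBoth, Matrix.mul_apply, Fin.sum_univ_four,
            Matrix.diagonal_apply] <;> grind
  case IX =>
    obtain ⟨h1, h2⟩ := h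
    have key : ∀ i j : Fin 4, ∀ Q : Mat4,
        (normalForm .IX e x * Q) i j = x i * Q i j ∧ (Q * normalForm .IX f y) i j = Q i j * y j := by
      intro i j Q
      have hd : ∀ (e : Fin 0 → ℤˣ) (z : Fin 4 → ℝ), normalForm .IX e z = Matrix.diagonal z := by
        intro e z
        ext i j
        fin_cases i <;> fin_cases j <;> simp [normalForm]
      rw [hd, hd, Matrix.diagonal_mul, Matrix.mul_diagonal]
      exact ⟨rfl, rfl⟩
    rcases h1 with ⟨h1, h1'⟩ | ⟨h1, h1'⟩ <;> rcases h2 with ⟨h2, h2'⟩ | ⟨h2, h2'⟩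
    · refine orbit_eq_of_change 1 (by simp) ?_
      ext i j
      rw [(key i j _).1, (key i j _).2]
      fin_cases i <;> fin_cases j <;> simp [*]
    · refine orbit_eq_of_change swapNeg swapNeg_gram ?_
      ext i j
      rw [(key i j _).1, (key i j _).2]
      fin_cases i <;> fin_cases j <;> simp [swapNeg, *]
    · refine orbit_eq_of_change swapPos swapPos_gram ?_
      ext i j
      rw [(key i j _).1, (key i j _).2]
      fin_cases i <;> fin_cases j <;> simp [swapPos, *]
    · refine orbit_eq_of_change swapBoth swapBoth_gram ?_
      ext i j
      rw [(key i j _).1, (key i j _).2]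
      fin_cases i <;> fin_cases j <;> simp [swapBoth, *]

/-- Zero is fixed by conjugation and is not the identity. -/
theorem not_isPretransitive : ¬ MulAction.IsPretransitive O22 EndPlus := by
  intro h
  have h1 : (1 : Mat4) ∈ EndPlus := (mem_EndPlus_iff _).2 adj_one
  obtain ⟨L, hL⟩ := h.exists_smul_eq (0 : EndPlus) ⟨1, h1⟩
  have h2 := congrArg (Subtype.val : EndPlus → Mat4) hL
  rw [coe_smul_EndPlus] at h2
  simp at h2

/-! ### Splitting a self-adjoint endomorphism into blocks -/

section Splitting

open Polynomial

/-- The indecomposable blocks: a real Jordan block of size `k + 1` with eigenvalue `t` and sign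
`ε`, and the blocks `K_1(a, b)` and `K_2(a, b)`. -/
inductive Block : Type
  | J (k : ℕ) (t : ℝ) (ε : ℤˣ)
  | K1 (a b : ℝ)
  | K2 (a b : ℝ)

/-- The dimension of a block. -/
def Block.size : Block → ℕ
  | .J k _ _ => k + 1
  | .K1 _ _ => 2
  | .K2 _ _ => 4

variable {V : Type*} [AddCommGroup V] [Module ℝ V]

/-- The vectors `w 0, w 1, …` span a block of the endomorphism `S`, and have the scalar products
of the normal form of that block. -/
def IsBlock (B : LinearMap.BilinForm ℝ V) (S : V →ₗ[ℝ] V) : Block → (ℕ → V) → Prop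
  | .J k t ε, w =>
      (∀ i ≤ k, ∀ j ≤ k, B (w i) (w j) = if i + j = k then sg ε else 0) ∧
      S (w 0) = t • w 0 ∧ ∀ i < k, S (w (i + 1)) = t • w (i + 1) + w i
  | .K1 a b, w => b ≠ 0 ∧
      (B (w 0) (w 0) = 1 ∧ B (w 1) (w 1) = -1 ∧ B (w 0) (w 1) = 0) ∧
      S (w 0) = a • w 0 - b • w 1 ∧ S (w 1) = b • w 0 + a • w 1
  | .K2 a b, w => b ≠ 0 ∧
      (B (w 0) (w 0) = 0 ∧ B (w 1) (w 1) = 0 ∧ B (w 2) (w 2) = 0 ∧ B (w 3) (w 3) = 0 ∧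
        B (w 0) (w 1) = 0 ∧ B (w 0) (w 2) = 1 ∧ B (w 0) (w 3) = 0 ∧ B (w 1) (w 2) = 0 ∧
        B (w 1) (w 3) = -1 ∧ B (w 2) (w 3) = 0) ∧
      S (w 0) = a • w 0 - b • w 1 ∧ S (w 1) = b • w 0 + a • w 1 ∧
      S (w 2) = w 0 + a • w 2 - b • w 3 ∧ S (w 3) = w 1 + b • w 2 + a • w 3

variable {B : LinearMap.BilinForm ℝ V} {S : V →ₗ[ℝ] V}

theorem selfAdjoint_aeval (hS : ∀ x y, B (S x) y = B x (S y)) (f : ℝ[X]) (x y : V) :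
    B (aeval S f x) y = B x (aeval S f y) := by
  induction f using Polynomial.induction_on' generalizing x y with
  | add f g hf hg => simp [hf, hg]
  | monomial n c =>
    have h : ∀ n : ℕ, ∀ x y, B ((S ^ n) x) y = B x ((S ^ n) y) := by
      intro n
      induction n with
      | zero => simp
      | succ n ih =>
        intro x y
        rw [pow_succ, Module.End.mul_apply, ih, hS, ← Module.End.mul_apply, ← pow_succ', pow_succ]
    simp [aeval_monomial, h, Algebra.algebraMap_eq_smul_one]

theorem selfAdjoint_pow (hS : ∀ x y, B (S x) y = B x (S y)) (n : ℕ) (x y : V) :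
    B ((S ^ n) x) y = B x ((S ^ n) y) := by
  simpa using selfAdjoint_aeval hS (X ^ n) x y

/-- Polarization: a symmetric form vanishing on the diagonal vanishes, and then nondegeneracy of `B`
kills `A`. -/
theorem exists_apply_self_ne_zero (hB : ∀ x y, B x y = B y x)
    (hnd : ∀ x, (∀ y, B x y = 0) → x = 0) {A : V →ₗ[ℝ] V}
    (hA : ∀ x y, B (A x) y = B x (A y)) (h : A ≠ 0) : ∃ x, B (A x) x ≠ 0 := by
  by_contra! h0
  refine h (LinearMap.ext fun x => hnd _ fun y => ?_)
  have h1 := h0 (x + y)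
  have h2 : B (A y) x = B (A x) y := by rw [hA, hB]
  simp only [map_add, LinearMap.add_apply, h0, h2] at h1
  linarith

theorem exists_sign_scale {c : ℝ} (hc : c ≠ 0) : ∃ (r : ℝ) (ε : ℤˣ), r * r * c = sg ε := by
  rcases lt_or_gt_of_ne hc with h | h
  · refine ⟨(√(-c))⁻¹, -1, ?_⟩
    rw [← mul_inv, Real.mul_self_sqrt (by linarith), inv_neg, neg_mul, inv_mul_cancel₀ hc]
    simp [sg]
  · refine ⟨(√c)⁻¹, 1, ?_⟩
    rw [← mul_inv, Real.mul_self_sqrt h.le, inv_mul_cancel₀ hc]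
    simp [sg]

/-- The numbers `B(N ^ i y, y)` determine the Gram matrix of the Jordan chain of `y`. After scaling
the top one to a sign, the others are removed one at a time in descending order: adding a multiple
of `N ^ (j + 1) y` leaves the moments already treated unchanged. -/
theorem exists_normalized_cyclic_vector {N : V →ₗ[ℝ] V} (hN : ∀ x y, B (N x) y = B x (N y))
    {m : ℕ} {x : V} (hx : (N ^ (m + 1)) x = 0) (hx' : B ((N ^ m) x) x ≠ 0) :
    ∃ (y : V) (ε : ℤˣ), (N ^ (m + 1)) y = 0 ∧ ∀ i ≤ m, B ((N ^ i) y) y =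
      if i = m then sg ε else 0 := by
  obtain ⟨r, ε, hr⟩ := exists_sign_scale hx'
  suffices H : ∀ j ≤ m, ∃ y : V, (N ^ (m + 1)) y = 0 ∧ B ((N ^ m) y) y = sg ε ∧
      ∀ i < m, m ≤ i + j → B ((N ^ i) y) y = 0 by
    obtain ⟨y, h1, h2, h3⟩ := H m le_rfl
    refine ⟨y, ε, h1, fun i hi => ?_⟩
    split_ifs with h
    · rw [h, h2]
    · exact h3 i (by omega) (by omega)
  intro j
  induction j with
  | zero =>
    refine fun _ => ⟨r • x, by simp [hx], ?_, fun i hi hi' => by omega⟩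
    simp only [map_smul, LinearMap.smul_apply, smul_eq_mul]
    rw [← mul_assoc, hr]
  | succ j ih =>
    intro hj
    obtain ⟨y, h1, h2, h3⟩ := ih (by omega)
    have hz : ∀ n, m + 1 ≤ n → (N ^ n) y = 0 := by
      intro n hn
      obtain ⟨l, rfl⟩ := Nat.exists_eq_add_of_le hn
      rw [add_comm, pow_add, Module.End.mul_apply, h1, map_zero]
    -- Chosen so that `2 * c * sg ε` cancels the moment of index `m - (j + 1)`. The term quadratic
    -- in `c` carries a power of `N` above `m` and drops out.
    set c : ℝ := -(sg ε * B ((N ^ (m - (j + 1))) y) y / 2) with hc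
    have key : ∀ i, B ((N ^ i) (y + c • (N ^ (j + 1)) y)) (y + c • (N ^ (j + 1)) y) =
        B ((N ^ i) y) y + 2 * c * B ((N ^ (i + (j + 1))) y) y
          + c * c * B ((N ^ (i + (j + 1) + (j + 1))) y) y := by
      intro i
      have e1 : B ((N ^ i) y) ((N ^ (j + 1)) y) = B ((N ^ (i + (j + 1))) y) y := by
        rw [← selfAdjoint_pow hN, ← Module.End.mul_apply, ← pow_add, add_comm]
      have e2 : (N ^ i) ((N ^ (j + 1)) y) = (N ^ (i + (j + 1))) y := by
        rw [← Module.End.mul_apply, ← pow_add]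
      have e3 : B ((N ^ (i + (j + 1))) y) ((N ^ (j + 1)) y) =
          B ((N ^ (i + (j + 1) + (j + 1))) y) y := by
        rw [← selfAdjoint_pow hN, ← Module.End.mul_apply, ← pow_add, add_comm]
      simp only [map_add, map_smul, LinearMap.add_apply, LinearMap.smul_apply, smul_eq_mul, e1,
        e2, e3]
      ring
    refine ⟨y + c • (N ^ (j + 1)) y, ?_, ?_, fun i hi hi' => ?_⟩
    · rw [map_add, map_smul, h1, ← Module.End.mul_apply, ← pow_add, hz _ (by omega)]
      simp
    · rw [key, h2, hz _ (by omega), hz _ (by omega)]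
      simp
    · rw [key, hz (i + (j + 1) + (j + 1)) (by omega)]
      by_cases h : m ≤ i + j
      · rw [h3 i hi h, hz _ (by omega)]
        simp
      · have h4 : i = m - (j + 1) := by omega
        have h5 : i + (j + 1) = m := by omega
        rw [h5, h2, h4, hc]
        have := sg_mul_self ε
        simp only [map_zero, LinearMap.zero_apply, mul_zero, add_zero]
        linear_combination (-B ((N ^ (m - (j + 1))) y) y) * this

theorem exists_isBlock_J (hS : ∀ x y, B (S x) y = B x (S y)) {t : ℝ} {m : ℕ} {x : V}
    (hx : ((S - t • 1) ^ (m + 1)) x = 0) (hx' : B (((S - t • 1) ^ m) x) x ≠ 0) :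
    ∃ ε w, IsBlock B S (.J m t ε) w := by
  have hN : ∀ x y, B ((S - t • 1) x) y = B x ((S - t • 1) y) := by
    intro x y
    simp [hS]
  obtain ⟨y, ε, h1, h2⟩ := exists_normalized_cyclic_vector hN hx hx'
  set N := S - t • 1 with hNdef
  have hSN : ∀ z, S z = t • z + N z := fun z => by simp [hNdef]
  have hz : ∀ n, m + 1 ≤ n → (N ^ n) y = 0 := by
    intro n hn
    obtain ⟨l, rfl⟩ := Nat.exists_eq_add_of_le hn
    rw [add_comm, pow_add, Module.End.mul_apply, h1, map_zero]
  -- The chain is read backwards, so that `w 0` is the eigenvector; products of `w i` and `w j` are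
  -- moments of index `2 * m - i - j`.
  refine ⟨ε, fun i => (N ^ (m - i)) y, ?_, ?_, ?_⟩
  · intro i hi j hj
    rw [← selfAdjoint_pow hN, ← Module.End.mul_apply, ← pow_add]
    by_cases h : m ≤ i + j
    · rw [h2 _ (by omega)]
      exact if_congr (by omega) rfl rfl
    · rw [hz _ (by omega), if_neg (by omega)]
      simp
  · simp only [Nat.sub_zero]
    rw [hSN, ← Module.End.mul_apply, ← pow_succ', h1, add_zero]
  · intro i hi
    simp only
    rw [hSN, ← Module.End.mul_apply, ← pow_succ', show m - (i + 1) + 1 = m - i by omega]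

/-- A complex number `u + iv` with `(u + iv)² = p + iq`. -/
theorem exists_complex_sqrt (p q : ℝ) : ∃ u v : ℝ, u * u - v * v = p ∧ 2 * (u * v) = q := by
  obtain ⟨z, hz⟩ := IsAlgClosed.exists_pow_nat_eq (⟨p, q⟩ : ℂ) (n := 2) (by norm_num)
  refine ⟨z.re, z.im, ?_, ?_⟩
  · simpa [sq] using congrArg Complex.re hz
  · have := congrArg Complex.im hz
    simp [sq] at this
    linarith

/-- Rescaling by a complex number: if `f` is a symmetric functional on `ℝ[J]`, `J² = -1`, given by
its values `α = f(1)`, `β = f(J)`, then some `u + vJ` satisfies `f((u+vJ)²) = 1` and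
`f(J (u+vJ)²) = 0`. -/
theorem exists_complex_scale {α β : ℝ} (h : α ≠ 0 ∨ β ≠ 0) : ∃ u v : ℝ,
    (u * u - v * v) * α + 2 * (u * v) * β = 1 ∧ (u * u - v * v) * β - 2 * (u * v) * α = 0 := by
  have h0 : α * α + β * β ≠ 0 := by
    rcases h with h | h
    · have := mul_self_pos.2 h
      nlinarith [mul_self_nonneg β]
    · have := mul_self_pos.2 h
      nlinarith [mul_self_nonneg α]
  -- The two conditions say that `(u + iv)²` is the inverse of `α - iβ`.
  obtain ⟨u, v, h1, h2⟩ := exists_complex_sqrt (α / (α * α + β * β)) (β / (α * α + β * β))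
  refine ⟨u, v, ?_, ?_⟩
  · rw [h1, h2, div_mul_eq_mul_div, div_mul_eq_mul_div, ← add_div, div_self h0]
  · rw [h1, h2]
    field_simp
    ring

/-- On the plane spanned by `x` and `S x` the operator `J = (S - a) / b` is a self-adjoint complex
structure. Hence `B(J x, J x) = -B(x, x)`, and a complex multiple of `x` can be made a unit vector
orthogonal to its image under `J`. -/
theorem exists_isBlock_K1 (hB : ∀ x y, B x y = B y x) (hS : ∀ x y, B (S x) y = B x (S y))
    {a b : ℝ} (hb : b ≠ 0) {x : V} (hx : S (S x) = (2 * a) • S x - (a * a + b * b) • x)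
    (hx' : B x x ≠ 0) : ∃ w, IsBlock B S (.K1 a b) w := by
  set y := b⁻¹ • (S x - a • x) with hy
  have hSx : S x = a • x + b • y := by
    rw [hy, smul_inv_smul₀ hb]
    abel
  have hSy : S y = a • y - b • x := by
    rw [hy, map_smul, map_sub, map_smul, hx]
    match_scalars <;> field_simp <;> ring
  have hyy : B y y = -B x x := by
    have h1 := hS x y
    rw [hSx, hSy] at h1
    simp only [map_add, map_sub, map_smul, LinearMap.add_apply, LinearMap.smul_apply,
      smul_eq_mul] at h1
    refine mul_left_cancel₀ hb ?_
    linarith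
  obtain ⟨u, v, h1, h2⟩ := exists_complex_scale (α := B x x) (β := B x y) (Or.inl hx')
  have hyx := hB y x
  -- The pair is `z = (u + vJ) x` and `-J z`; the sign matches the convention of `K_1`, whose lower
  -- left entry is `-b`.
  refine ⟨fun i => if i = 0 then u • x + v • y else v • x - u • y, hb, ⟨?_, ?_, ?_⟩, ?_, ?_⟩
  · simp [hyy, hyx]
    linear_combination h1
  · simp [hyy, hyx]
    linear_combination -h1
  · simp [hyy, hyx]
    linear_combination -h2
  · simp only [if_true, map_add, map_smul, hSx, hSy, one_ne_zero, if_false]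
    module
  · simp only [if_true, map_sub, map_smul, hSx, hSy, one_ne_zero, if_false]
    module

/-- A block `K_2(a, b)` from vectors on which the endomorphism acts as `a + bJ + N`, where
`e₁ = J e₀`, `f₀ = N e₀` and `f₁ = J N e₀`. -/
theorem exists_isBlock_K2_of_frame (hB : ∀ x y, B x y = B y x) {a b : ℝ} (hb : b ≠ 0)
    {e0 e1 f0 f1 : V} {γ δ : ℝ}
    (he0 : S e0 = a • e0 + b • e1 + f0) (he1 : S e1 = a • e1 - b • e0 + f1)
    (hf0 : S f0 = a • f0 + b • f1) (hf1 : S f1 = a • f1 - b • f0)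
    (h1 : B f0 e0 = 1) (h2 : B f1 e0 = 0) (h3 : B f0 e1 = 0) (h4 : B f1 e1 = -1)
    (h5 : B f0 f0 = 0) (h6 : B f0 f1 = 0) (h7 : B f1 f1 = 0)
    (h8 : B e0 e0 = γ) (h9 : B e0 e1 = δ) (h10 : B e1 e1 = -γ) :
    ∃ w, IsBlock B S (.K2 a b) w := by
  have h1' := (hB e0 f0).trans h1
  have h2' := (hB e0 f1).trans h2
  have h3' := (hB e1 f0).trans h3
  have h4' := (hB e1 f1).trans h4
  have h6' := (hB f1 f0).trans h6
  -- Adding a complex multiple of the nilpotent image to `e0` leaves the action of `S` unchanged.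
  -- The coefficients `γ / 2` and `δ / 2` are the ones that make the upper pair isotropic and
  -- mutually orthogonal.
  refine ⟨fun i => match i with
    | 0 => f0
    | 1 => -f1
    | 2 => e0 - (γ / 2) • f0 + (δ / 2) • f1
    | _ => -(e1 - (γ / 2) • f1 - (δ / 2) • f0), hb,
    ⟨?_, ?_, ?_, ?_, ?_, ?_, ?_, ?_, ?_, ?_⟩, ?_, ?_, ?_, ?_⟩
  iterate 10
    simp only [map_add, map_sub, map_neg, map_smul, LinearMap.add_apply, LinearMap.sub_apply,
      LinearMap.neg_apply, LinearMap.smul_apply, smul_eq_mul, h1, h2, h3, h4, h5, h6, h7, h8, h9,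
      h10, h1', h2', h3', h4', h6']
    first | ring1 | ring_nf
  all_goals
    simp only [map_add, map_sub, map_neg, map_smul, he0, he1, hf0, hf1]
    module

/-- With `D = (S - a) / b` one has `(D² + 1)² x = 0`. Splitting `D` on the cyclic space of `x` into
its semisimple part `J`, with `J² = -1`, and a nilpotent remainder gives the frame required by
`exists_isBlock_K2_of_frame`, up to multiplication by a complex scalar. -/
theorem exists_isBlock_K2 (hB : ∀ x y, B x y = B y x) (hS : ∀ x y, B (S x) y = B x (S y))
    {a b : ℝ} (hb : b ≠ 0) {x : V} {Q : V →ₗ[ℝ] V}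
    (hQ : Q = (S - a • 1) ^ 2 + (b * b) • 1) (hx : Q (Q x) = 0)
    (hx' : B (Q x) x ≠ 0) : ∃ w, IsBlock B S (.K2 a b) w := by
  set D : V →ₗ[ℝ] V := b⁻¹ • (S - a • 1) with hD
  have hSD : ∀ z, S z = a • z + b • D z := by
    intro z
    simp [hD, smul_smul, hb]
  have hDD : ∀ x y, B (D x) y = B x (D y) := by
    intro x y
    simp [hD, hS]
  have hQD : ∀ z, Q z = (b * b) • (D (D z) + z) := by
    intro z
    simp only [hQ, hD, sq, LinearMap.add_apply, LinearMap.smul_apply, Module.End.mul_apply,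
      Module.End.one_apply, map_smul, LinearMap.sub_apply]
    match_scalars <;> field_simp
  have hD4 : D (D (D (D x))) = -(2 : ℝ) • D (D x) - x := by
    rw [hQD, hQD] at hx
    have h0 : b * b ≠ 0 := mul_ne_zero hb hb
    simp only [map_smul, map_add] at hx
    have h1 : (b * b * (b * b)) • (D (D (D (D x))) - (-(2 : ℝ) • D (D x) - x)) = 0 := by
      rw [← hx]
      module
    exact sub_eq_zero.1 ((smul_eq_zero.1 h1).resolve_left (mul_ne_zero h0 h0))
  have hβ : B (D (D x)) x + B x x ≠ 0 := by
    intro h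
    apply hx'
    rw [hQD]
    simp only [map_smul, map_add, LinearMap.smul_apply, LinearMap.add_apply, smul_eq_mul, h,
      mul_zero]
  -- the scalar products of the vectors `Dⁱ x`
  have g11 : B (D x) (D x) = B (D (D x)) x := by rw [← hDD]
  have g12 : B (D x) (D (D x)) = B (D (D (D x))) x := by rw [← hDD, ← hDD]
  have g22 : B (D (D x)) (D (D x)) = -2 * B (D (D x)) x - B x x := by
    rw [← hDD, ← hDD, hD4]
    simp
  have g13 : B (D x) (D (D (D x))) = -2 * B (D (D x)) x - B x x := by
    rw [← g22, hDD, hB, hDD, hDD]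
  have g23 : B (D (D x)) (D (D (D x))) = -2 * B (D (D (D x))) x - B (D x) x := by
    rw [← hDD, ← hDD, ← hDD, hD4]
    simp
  have g33 : B (D (D (D x))) (D (D (D x))) = 3 * B (D (D x)) x + 2 * B x x := by
    rw [hDD, hD4]
    simp only [map_sub, map_smul, smul_eq_mul, g22]
    ring
  have s01 := hB x (D x)
  have s02 := hB x (D (D x))
  have s03 := hB x (D (D (D x)))
  have s12 := hB (D (D x)) (D x)
  have s13 := hB (D (D (D x))) (D x)
  have s23 := hB (D (D (D x))) (D (D x))
  generalize hx1 : D x = x1 at *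
  generalize hx2 : D x1 = x2 at *
  generalize hx3 : D x2 = x3 at *
  -- Here `α` and `β` are the products of the unscaled `f0` and `f1` with `x`. Nonvanishing of `β`
  -- is the hypothesis `hx'`.
  obtain ⟨u, v, huv1, huv2⟩ := exists_complex_scale (α := -(b / 2) * (B x1 x + B x3 x))
    (β := (b / 2) * (B x2 x + B x x))
    (Or.inr (mul_ne_zero (div_ne_zero hb two_ne_zero) hβ))
  -- One Newton step from `D` gives `J = (3 D + D³) / 2`. Accordingly `e1 = J x`, `f0 = b (D - J) x`
  -- and `f1 = J f0`.
  obtain ⟨e1, he1⟩ : ∃ y, y = (1 / 2 : ℝ) • ((3 : ℝ) • x1 + x3) := ⟨_, rfl⟩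
  obtain ⟨f0, hf0⟩ : ∃ y, y = (-(b / 2)) • (x1 + x3) := ⟨_, rfl⟩
  obtain ⟨f1, hf1⟩ : ∃ y, y = (b / 2) • (x2 + x) := ⟨_, rfl⟩
  refine exists_isBlock_K2_of_frame hB hb (e0 := u • x + v • e1) (e1 := u • e1 - v • x)
    (f0 := u • f0 + v • f1) (f1 := u • f1 - v • f0) (γ := B (u • x + v • e1) (u • x + v • e1))
    (δ := B (u • x + v • e1) (u • e1 - v • x)) ?_ ?_ ?_ ?_ ?_ ?_ ?_ ?_ ?_ ?_ ?_ rfl rfl ?_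
  iterate 4
    simp only [he1, hf0, hf1, hSD, map_add, map_sub, map_smul, hx1, hx2, hx3, hD4]
    module
  all_goals
    simp only [he1, hf0, hf1, map_add, map_sub, map_smul, LinearMap.add_apply,
      LinearMap.sub_apply, LinearMap.smul_apply, smul_eq_mul, s01, s02, s03, s12, s13, s23, g11,
      g12, g22, g13, g23, g33]
  · linear_combination huv1
  · linear_combination huv2
  · linear_combination huv2
  · linear_combination -huv1
  all_goals ring

end Splitting

/-! ### Existence of one block and induction on the dimension -/

section Decomposition

open Polynomial

variable {V : Type*} [AddCommGroup V] [Module ℝ V] {B : LinearMap.BilinForm ℝ V} {S : V →ₗ[ℝ] V}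

/-- Complete the square; a constant term that is not positive would produce a real root. -/
theorem eq_quadratic_of_irreducible {q : ℝ[X]} (hm : q.Monic) (hirr : Irreducible q)
    (h2 : q.natDegree = 2) : ∃ a b : ℝ, b ≠ 0 ∧ q = (X - C a) ^ 2 + C (b * b) := by
  have hq := hm.as_sum
  rw [h2, Finset.sum_range_succ, Finset.sum_range_one] at hq
  set c := q.coeff 1
  set d := q.coeff 0
  have hpos : 0 < d - c ^ 2 / 4 := by
    by_contra! hle
    have hroot : q.IsRoot (-c / 2 + √(c ^ 2 / 4 - d)) := by
      have hs := Real.sq_sqrt (show 0 ≤ c ^ 2 / 4 - d by linarith)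
      rw [hq, IsRoot.def]
      simp only [eval_add, eval_mul, eval_pow, eval_X, eval_C]
      nlinarith
    have h1 : q.natDegree = 1 := natDegree_eq_of_degree_eq_some (degree_eq_one_of_irreducible_of_root hirr hroot)
    omega
  refine ⟨-c / 2, √(d - c ^ 2 / 4), (Real.sqrt_pos.2 hpos).ne', ?_⟩
  have h3 : C (-c / 2) * C (2 : ℝ) = -C c := by
    rw [← C_mul, ← C_neg]
    congr 1
    ring
  have h4 : C (-c / 2) ^ 2 + C (d - c ^ 2 / 4) = C d := by
    rw [← C_pow, ← C_add]
    congr 1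
    ring
  have h5 : (C (2 : ℝ) : ℝ[X]) = 2 := rfl
  rw [Real.mul_self_sqrt hpos.le, hq]
  rw [h5] at h3
  linear_combination -h4 + X * h3

/-- The exponent of `q` in the minimal polynomial is the longest chain length for `q`. The argument
finds a chain of exactly this length on which the form is nondegenerate, by looking for a nonzero
value of the quadratic form of `(q ^ m * r * r)(S)`. -/
theorem exists_isBlock [FiniteDimensional ℝ V] [Nontrivial V] (hdim : Module.finrank ℝ V ≤ 4)
    (hB : ∀ x y, B x y = B y x) (hnd : ∀ x, (∀ y, B x y = 0) → x = 0)
    (hS : ∀ x y, B (S x) y = B x (S y)) : ∃ b w, IsBlock B S b w := by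
  set p := minpoly ℝ S with hp
  have hp0 : p ≠ 0 := minpoly.ne_zero (Algebra.IsIntegral.isIntegral S)
  obtain ⟨q, hqm, hqi, hqp⟩ := exists_monic_irreducible_factor p (minpoly.not_isUnit ℝ S)
  have hqd : 0 < q.degree := degree_pos_of_irreducible hqi
  obtain ⟨r, hr, hqr⟩ := (finiteMultiplicity_of_degree_pos_of_monic hqd hqm
    hp0).exists_eq_pow_mul_and_not_dvd
  have hk : multiplicity q p ≠ 0 := by
    intro h
    rw [h, pow_zero, one_mul] at hr
    exact hqr (hr ▸ hqp)
  obtain ⟨m, hm⟩ := Nat.exists_eq_succ_of_ne_zero hk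
  rw [hm] at hr
  -- If this operator vanished, `q ^ (m + 1) * r` would divide `q ^ m * r * r`, hence `q` would
  -- divide `r`. The second factor `r` is there so that one `r` can be moved to the other side of
  -- `B`.
  have hA : aeval S (q ^ m * r * r) ≠ 0 := by
    intro h
    obtain ⟨s, hs⟩ := minpoly.dvd_iff.2 h
    rw [← hp, hr, pow_succ] at hs
    have hr0 : r ≠ 0 := by
      rintro rfl
      exact hqr (dvd_zero _)
    refine hqr ⟨s, mul_left_cancel₀ (mul_ne_zero (pow_ne_zero m hqi.ne_zero) hr0) ?_⟩
    linear_combination hs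
  obtain ⟨x0, hx0⟩ := exists_apply_self_ne_zero hB hnd (selfAdjoint_aeval hS _) hA
  set x := aeval S r x0 with hx
  have h1 : (aeval S q ^ (m + 1)) x = 0 := by
    rw [hx, ← map_pow, ← Module.End.mul_apply, ← map_mul, ← hr, hp, minpoly.aeval,
      LinearMap.zero_apply]
  have h2 : B ((aeval S q ^ m) x) x ≠ 0 := by
    rw [hx, ← selfAdjoint_aeval hS, ← map_pow, ← Module.End.mul_apply, ← Module.End.mul_apply,
      ← map_mul, ← map_mul]
    rwa [show r * q ^ m * r = q ^ m * r * r by ring]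
  have hdeg : q.natDegree = 1 ∨ q.natDegree = 2 := by
    have := hqi.natDegree_le_two
    have := natDegree_pos_iff_degree_pos.2 hqd
    omega
  rcases hdeg with hd | hd
  · have hq := hqm.eq_X_add_C hd
    have hqS : aeval S q = S - (-q.coeff 0) • 1 := by
      rw [hq]
      simp [Algebra.algebraMap_eq_smul_one]
    rw [hqS] at h1 h2
    obtain ⟨ε, w, hw⟩ := exists_isBlock_J hS h1 h2
    exact ⟨_, w, hw⟩
  · obtain ⟨a, b, hb, hq⟩ := eq_quadratic_of_irreducible hqm hqi hd
    have hqS : aeval S q = (S - a • 1) ^ 2 + (b * b) • 1 := by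
      rw [hq]
      simp [Algebra.algebraMap_eq_smul_one, smul_smul]
    have hple : p.natDegree ≤ 4 := by
      refine (natDegree_le_of_dvd (LinearMap.minpoly_dvd_charpoly S)
        (LinearMap.charpoly_monic S).ne_zero).trans ?_
      rwa [LinearMap.charpoly_natDegree]
    have hr0 : r ≠ 0 := by
      rintro rfl
      exact hqr (dvd_zero _)
    have hpd : p.natDegree = (m + 1) * 2 + r.natDegree := by
      rw [hr, natDegree_mul (pow_ne_zero _ hqi.ne_zero) hr0, natDegree_pow, hd]
    -- The minimal polynomial has degree at least `2 * (m + 1)` and at most four, so a complex chain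
    -- has length one or two.
    have hm1 : m = 0 ∨ m = 1 := by omega
    rcases hm1 with rfl | rfl
    · obtain ⟨w, hw⟩ := exists_isBlock_K1 hB hS (a := a) hb (x := x) (by
        simp only [hqS, sq, zero_add, pow_one, LinearMap.add_apply, LinearMap.smul_apply,
          Module.End.mul_apply, Module.End.one_apply, map_smul, LinearMap.sub_apply,
          map_sub] at h1
        rw [← sub_eq_zero, ← h1]
        module) (by simpa using h2)
      exact ⟨_, w, hw⟩
    · obtain ⟨w, hw⟩ := exists_isBlock_K2 hB hS hb (x := x) hqS (by
        rw [← Module.End.mul_apply, ← sq]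
        exact h1) (by simpa using h2)
      exact ⟨_, w, hw⟩

/-- The vectors dual to those of a block. -/
theorem IsBlock.exists_dual {b : Block} {w : ℕ → V} (hB : ∀ x y, B x y = B y x)
    (h : IsBlock B S b w) : ∃ w' : Fin b.size → V,
      (∀ j, w' j ∈ Submodule.span ℝ (range fun i : Fin b.size => w i)) ∧
      ∀ i j : Fin b.size, B (w i) (w' j) = if i = j then 1 else 0 := by
  have hmem : ∀ i : Fin b.size, w i ∈ Submodule.span ℝ (range fun i : Fin b.size => w i) :=
    fun i => Submodule.subset_span ⟨i, rfl⟩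
  cases b with
  | J k t ε =>
    refine ⟨fun j => sg ε • w (k - j), fun j => Submodule.smul_mem _ _
      (hmem ⟨k - j, by change _ < k + 1; omega⟩), fun i j => ?_⟩
    have hi : (i : ℕ) < k + 1 := i.2
    have hj : (j : ℕ) < k + 1 := j.2
    rw [map_smul, h.1 _ (by omega) _ (by omega), smul_eq_mul]
    by_cases hij : i = j
    · rw [if_pos hij, if_pos (by rw [hij]; omega), sg_mul_self]
    · have : (i : ℕ) ≠ j := fun h => hij (Fin.ext h)
      rw [if_neg hij, if_neg (by omega), mul_zero]
  | K1 a b =>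
    obtain ⟨-, ⟨h1, h2, h3⟩, -⟩ := h
    have h3' := (hB _ _).trans h3
    refine ⟨![w 0, -w 1], fun j => ?_, fun (i : Fin 2) (j : Fin 2) => ?_⟩
    · fin_cases j
      · exact hmem (0 : Fin 2)
      · exact Submodule.neg_mem _ (hmem (1 : Fin 2))
    · change B (w (i : Fin 2)) ((![w 0, -w 1] : Fin 2 → V) j) = if (i : Fin 2) = j then 1 else 0
      fin_cases i <;> fin_cases j <;> simp [h1, h2, h3, h3']
  | K2 a b =>
    obtain ⟨-, ⟨h1, h2, h3, h4, h5, h6, h7, h8, h9, h10⟩, -⟩ := h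
    have h5' := (hB _ _).trans h5
    have h6' := (hB _ _).trans h6
    have h7' := (hB _ _).trans h7
    have h8' := (hB _ _).trans h8
    have h9' := (hB _ _).trans h9
    have h10' := (hB _ _).trans h10
    refine ⟨![w 2, -w 3, w 0, -w 1], fun j => ?_, fun (i : Fin 4) (j : Fin 4) => ?_⟩
    · fin_cases j
      · exact hmem (2 : Fin 4)
      · exact Submodule.neg_mem _ (hmem (3 : Fin 4))
      · exact hmem (0 : Fin 4)
      · exact Submodule.neg_mem _ (hmem (1 : Fin 4))
    · change B (w (i : Fin 4)) ((![w 2, -w 3, w 0, -w 1] : Fin 4 → V) j) =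
        if (i : Fin 4) = j then 1 else 0
      fin_cases i <;> fin_cases j <;>
        simp [h1, h2, h3, h4, h5, h6, h7, h8, h9, h10, h5', h6', h7', h8', h9', h10']

theorem IsBlock.map_mem_span {b : Block} {w : ℕ → V} (h : IsBlock B S b w) (i : Fin b.size) :
    S (w i) ∈ Submodule.span ℝ (range fun i : Fin b.size => w i) := by
  have hmem : ∀ i : Fin b.size, w i ∈ Submodule.span ℝ (range fun i : Fin b.size => w i) :=
    fun i => Submodule.subset_span ⟨i, rfl⟩
  have hc : ∀ (c : ℝ) (i : Fin b.size), c • w i ∈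
      Submodule.span ℝ (range fun i : Fin b.size => w i) :=
    fun c i => Submodule.smul_mem _ _ (hmem i)
  cases b with
  | J k t ε =>
    obtain ⟨-, h1, h2⟩ := h
    obtain ⟨i, hi⟩ := i
    change i < k + 1 at hi
    rcases i with _ | i
    · exact h1 ▸ hc t ⟨0, hi⟩
    · change S (w (i + 1)) ∈ _
      rw [h2 i (by omega)]
      exact Submodule.add_mem _ (hc t ⟨i + 1, hi⟩) (hmem ⟨i, by change _ < k + 1; omega⟩)
  | K1 a b =>
    obtain ⟨-, -, h1, h2⟩ := h
    change Fin 2 at i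
    fin_cases i
    · exact h1 ▸ Submodule.sub_mem _ (hc a (0 : Fin 2)) (hc b (1 : Fin 2))
    · exact h2 ▸ Submodule.add_mem _ (hc b (0 : Fin 2)) (hc a (1 : Fin 2))
  | K2 a b =>
    obtain ⟨-, -, h1, h2, h3, h4⟩ := h
    change Fin 4 at i
    fin_cases i
    · exact h1 ▸ Submodule.sub_mem _ (hc a (0 : Fin 4)) (hc b (1 : Fin 4))
    · exact h2 ▸ Submodule.add_mem _ (hc b (0 : Fin 4)) (hc a (1 : Fin 4))
    · exact h3 ▸ Submodule.sub_mem _ (Submodule.add_mem _ (hmem (0 : Fin 4))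
        (hc a (2 : Fin 4))) (hc b (3 : Fin 4))
    · exact h4 ▸ Submodule.add_mem _ (Submodule.add_mem _ (hmem (1 : Fin 4))
        (hc b (2 : Fin 4))) (hc a (3 : Fin 4))

/-- A dual family inside the span shows at once that the vectors are independent and that the form
restricted to their span is nondegenerate, which is what splitting off the complement requires. -/
theorem isCompl_span_of_dual [FiniteDimensional ℝ V] {n : ℕ} {w w' : Fin n → V}
    (hB : ∀ x y, B x y = B y x) (hw' : ∀ j, w' j ∈ Submodule.span ℝ (range w))
    (hd : ∀ i j, B (w i) (w' j) = if i = j then 1 else 0) :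
    IsCompl (Submodule.span ℝ (range w)) (B.orthogonal (Submodule.span ℝ (range w))) ∧
      Module.finrank ℝ (Submodule.span ℝ (range w)) = n := by
  have hrefl : B.IsRefl := fun x y h => (hB y x).trans h
  have hcoef : ∀ c : Fin n → ℝ, ∀ j, B (∑ i, c i • w i) (w' j) = c j := by
    intro c j
    simp [hd]
  refine ⟨(LinearMap.BilinForm.isCompl_orthogonal_iff_disjoint hrefl).2 ?_, ?_⟩
  · rw [Submodule.disjoint_def]
    intro x hx hx'
    obtain ⟨c, rfl⟩ := (Submodule.mem_span_range_iff_exists_fun ℝ).1 hx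
    refine Finset.sum_eq_zero fun j _ => ?_
    have h := LinearMap.BilinForm.mem_orthogonal_iff.1 hx' (w' j) (hw' j)
    rw [hB, hcoef] at h
    rw [h, zero_smul]
  · have hli : LinearIndependent ℝ w := by
      rw [Fintype.linearIndependent_iff]
      intro c hc j
      rw [← hcoef c j, hc, map_zero, LinearMap.zero_apply]
    rw [finrank_span_eq_card hli, Fintype.card_fin]

/-- A basis of `V` that splits into mutually orthogonal blocks of `S`. -/
def IsDecomposition (B : LinearMap.BilinForm ℝ V) (S : V →ₗ[ℝ] V) {n : ℕ} (b : Fin n → Block)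
    (w : Fin n → ℕ → V) : Prop :=
  (∀ i, IsBlock B S (b i) (w i)) ∧
  ∀ i j, i ≠ j → ∀ k < (b i).size, ∀ l < (b j).size, B (w i k) (w j l) = 0

theorem IsBlock.of_restrict {W : Submodule ℝ V} (hW : ∀ x ∈ W, S x ∈ W) {b : Block} {w : ℕ → W}
    (h : IsBlock (B.restrict W) (S.restrict hW) b w) : IsBlock B S b fun i => (w i : V) := by
  cases b with
  | J k t ε =>
    obtain ⟨h1, h2, h3⟩ := h
    exact ⟨h1, congrArg Subtype.val h2, fun i hi => congrArg Subtype.val (h3 i hi)⟩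
  | K1 a b =>
    obtain ⟨h0, h1, h2, h3⟩ := h
    exact ⟨h0, h1, congrArg Subtype.val h2, congrArg Subtype.val h3⟩
  | K2 a b =>
    obtain ⟨h0, h1, h2, h3, h4, h5⟩ := h
    exact ⟨h0, h1, congrArg Subtype.val h2, congrArg Subtype.val h3, congrArg Subtype.val h4,
      congrArg Subtype.val h5⟩

/-- Induction on the dimension with the space itself quantified, because the next step takes place
in the orthogonal complement of a block with the restricted form and endomorphism. -/
theorem exists_isDecomposition (d : ℕ) : ∀ (V : Type) [AddCommGroup V] [Module ℝ V]
    [FiniteDimensional ℝ V] (B : LinearMap.BilinForm ℝ V) (S : V →ₗ[ℝ] V),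
    Module.finrank ℝ V = d → d ≤ 4 → (∀ x y, B x y = B y x) →
    (∀ x, (∀ y, B x y = 0) → x = 0) → (∀ x y, B (S x) y = B x (S y)) →
    ∃ (n : ℕ) (b : Fin n → Block) (w : Fin n → ℕ → V),
      IsDecomposition B S b w ∧ ∑ i, (b i).size = d := by
  induction d using Nat.strong_induction_on with
  | _ d ih =>
    intro V _ _ _ B S hd hd4 hB hnd hS
    rcases Nat.eq_zero_or_pos d with rfl | hpos
    · exact ⟨0, Fin.elim0, Fin.elim0, ⟨fun i => i.elim0, fun i => i.elim0⟩, rfl⟩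
    have : Nontrivial V := Module.nontrivial_of_finrank_pos (R := ℝ) (hd ▸ hpos)
    obtain ⟨b, w, hw⟩ := exists_isBlock (hd.trans_le hd4) hB hnd hS
    obtain ⟨w', hw', hdual⟩ := hw.exists_dual hB
    obtain ⟨hc, hfr⟩ := isCompl_span_of_dual hB hw' hdual
    set U := Submodule.span ℝ (range fun i : Fin b.size => w i) with hU
    set W := B.orthogonal U with hW
    have hUinv : ∀ u ∈ U, S u ∈ U := by
      intro u hu
      induction hu using Submodule.span_induction with
      | mem x hx =>
        obtain ⟨i, rfl⟩ := hx
        exact hw.map_mem_span i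
      | zero => simp
      | add x y _ _ hx hy => simpa using U.add_mem hx hy
      | smul c x _ hx => simpa using U.smul_mem c hx
    have hWinv : ∀ x ∈ W, S x ∈ W := by
      intro x hx
      rw [hW, LinearMap.BilinForm.mem_orthogonal_iff] at hx ⊢
      intro u hu
      rw [← hS]
      exact hx _ (hUinv u hu)
    have hsum := Submodule.finrank_add_eq_of_isCompl hc
    have hsize : 0 < b.size := by cases b <;> simp [Block.size]
    rw [hfr, hd] at hsum
    -- The restricted form is nondegenerate: a vector of `W` orthogonal to `W` is also orthogonal to
    -- `U`, and the two subspaces span `V`.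
    obtain ⟨n, c, v, ⟨hv1, hv2⟩, hv3⟩ := ih (Module.finrank ℝ W) (by omega) W (B.restrict W)
      (S.restrict hWinv) rfl (by omega) (fun x y => hB _ _) (fun x hx => by
        refine Subtype.ext (hnd _ fun y => ?_)
        obtain ⟨u, hu, z, hz, rfl⟩ := Submodule.mem_sup.1
          (hc.sup_eq_top ▸ (Submodule.mem_top : y ∈ ⊤))
        have h1 := hx ⟨z, hz⟩
        have h2 := LinearMap.BilinForm.mem_orthogonal_iff.1 x.2 u hu
        rw [map_add, hB _ u, h2, zero_add]
        exact h1) (fun x y => hS _ _)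
    have hcross : ∀ k < b.size, ∀ x : W, B (w k) x = 0 := fun k hk x =>
      LinearMap.BilinForm.mem_orthogonal_iff.1 x.2 _ (Submodule.subset_span ⟨⟨k, hk⟩, rfl⟩)
    refine ⟨n + 1, Fin.cons b c, Fin.cons w fun i k => v i k, ⟨fun i => ?_, fun i j hij => ?_⟩, ?_⟩
    · refine Fin.cases ?_ (fun i => ?_) i
      · exact hw
      · exact (hv1 i).of_restrict hWinv
    · revert hij
      refine Fin.cases ?_ (fun i => ?_) i <;> refine Fin.cases ?_ (fun j => ?_) j
      · exact fun h => (h rfl).elim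
      · exact fun _ k hk l _ => hcross k hk _
      · exact fun _ k _ l hl => (hB _ _).trans (hcross l hl _)
      · exact fun hij k hk l hl => hv2 i j (fun h => hij (h ▸ rfl)) k hk l hl
    · rw [Fin.sum_univ_succ]
      simp only [Fin.cons_zero, Fin.cons_succ]
      omega

end Decomposition

/-! ### Every self-adjoint endomorphism has one of the ten types -/

/-- The scalar product of `ℝ^{2,2}` as a bilinear form. -/
def form : LinearMap.BilinForm ℝ (Fin 4 → ℝ) :=
  LinearMap.mk₂ ℝ s22 (by intros; simp [s22]; ring) (by intros; simp [s22]; ring)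
    (by intros; simp [s22]; ring) (by intros; simp [s22]; ring)

theorem form_apply (v w : Fin 4 → ℝ) : form v w = s22 v w := rfl

theorem s22_comm (v w : Fin 4 → ℝ) : s22 v w = s22 w v := by
  simp only [s22]
  ring

theorem eq_zero_of_forall_s22 (v : Fin 4 → ℝ) (h : ∀ w, s22 v w = 0) : v = 0 := by
  ext i
  have h1 := h (Pi.single i 1)
  fin_cases i <;> simpa [s22] using h1

theorem hasMat_of_vectors {S G M : Mat4} (u : Fin 4 → Fin 4 → ℝ)
    (hG : ∀ i j, s22 (u i) (u j) = G i j) (hM : ∀ j, S *ᵥ u j = ∑ i, M i j • u i) :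
    HasMat S G M := by
  refine ⟨Matrix.of fun i j => u j i, ?_, ?_⟩
  · ext i j
    have h := s22_mulVec (Matrix.of fun i j => u j i) (Matrix.of fun i j => u j i)
      (Pi.single i 1) (Pi.single j 1)
    simp only [single_one_dotProduct, Matrix.mulVec_single_one] at h
    exact Eq.trans h.symm (hG i j)
  · ext i j
    have h := congrFun (hM j) i
    simp only [Finset.sum_apply, Pi.smul_apply, smul_eq_mul, Matrix.mulVec, dotProduct] at h
    simp only [Matrix.mul_apply, Matrix.of_apply, h]
    exact Finset.sum_congr rfl fun _ _ => mul_comm _ _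

/-- Such vectors span a three-dimensional subspace that is definite with sign `ε`. It must meet the
two-dimensional coordinate plane on which the form has the opposite sign. -/
theorem not_three_orthogonal (ε : ℤˣ) {x y z : Fin 4 → ℝ} (hx : 0 < sg ε * s22 x x)
    (hy : 0 < sg ε * s22 y y) (hz : 0 < sg ε * s22 z z) (hxy : s22 x y = 0) (hxz : s22 x z = 0)
    (hyz : s22 y z = 0) : False := by
  have key : ∀ i j : Fin 4, ∃ c : Fin 3 → ℝ, c ≠ 0 ∧
      c 0 * x i + c 1 * y i + c 2 * z i = 0 ∧ c 0 * x j + c 1 * y j + c 2 * z j = 0 := by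
    intro i j
    have hk : LinearMap.ker (Matrix.toLin' !![x i, y i, z i; x j, y j, z j]) ≠ ⊥ :=
      LinearMap.ker_ne_bot_of_finrank_lt (by simp)
    obtain ⟨c, hc, hc0⟩ := (Submodule.ne_bot_iff _).1 hk
    have h0 := congrFun (LinearMap.mem_ker.1 hc) 0
    have h1 := congrFun (LinearMap.mem_ker.1 hc) 1
    simp [Matrix.mulVec, dotProduct, Fin.sum_univ_three] at h0 h1
    exact ⟨c, hc0, by linarith, by linarith⟩
  have hpos : ∀ c : Fin 3 → ℝ, c ≠ 0 →
      0 < sg ε * s22 (c 0 • x + c 1 • y + c 2 • z) (c 0 • x + c 1 • y + c 2 • z) := by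
    intro c hc
    have h1 : sg ε * s22 (c 0 • x + c 1 • y + c 2 • z) (c 0 • x + c 1 • y + c 2 • z) =
        c 0 ^ 2 * (sg ε * s22 x x) + c 1 ^ 2 * (sg ε * s22 y y) + c 2 ^ 2 * (sg ε * s22 z z) := by
      have h2 : ∀ v w, form v w = s22 v w := fun _ _ => rfl
      rw [← h2]
      simp only [map_add, map_smul, LinearMap.add_apply, LinearMap.smul_apply, smul_eq_mul, h2,
        s22_comm y x, s22_comm z x, s22_comm z y, hxy, hxz, hyz]
      ring
    rw [h1]
    by_contra! hle
    have e0 := mul_nonneg (sq_nonneg (c 0)) hx.le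
    have e1 := mul_nonneg (sq_nonneg (c 1)) hy.le
    have e2 := mul_nonneg (sq_nonneg (c 2)) hz.le
    refine hc (funext fun i => ?_)
    fin_cases i
    · exact pow_eq_zero_iff (two_ne_zero) |>.1
        ((mul_eq_zero.1 (show c 0 ^ 2 * _ = 0 by linarith)).resolve_right hx.ne')
    · exact pow_eq_zero_iff (two_ne_zero) |>.1
        ((mul_eq_zero.1 (show c 1 ^ 2 * _ = 0 by linarith)).resolve_right hy.ne')
    · exact pow_eq_zero_iff (two_ne_zero) |>.1
        ((mul_eq_zero.1 (show c 2 ^ 2 * _ = 0 by linarith)).resolve_right hz.ne')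
  rcases Int.units_eq_one_or ε with rfl | rfl
  -- For the positive sign the two positive coordinates are made to vanish; for the negative sign,
  -- the last two.
  · obtain ⟨c, hc, h0, h1⟩ := key 0 1
    have h := hpos c hc
    simp only [s22, Pi.add_apply, Pi.smul_apply, smul_eq_mul, h0, h1] at h
    norm_num [sg] at h
    nlinarith [mul_self_nonneg (c 0 * x 2 + c 1 * y 2 + c 2 * z 2),
      mul_self_nonneg (c 0 * x 3 + c 1 * y 3 + c 2 * z 3)]
  · obtain ⟨c, hc, h0, h1⟩ := key 2 3
    have h := hpos c hc
    simp only [s22, Pi.add_apply, Pi.smul_apply, smul_eq_mul, h0, h1] at h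
    norm_num [sg] at h
    nlinarith [mul_self_nonneg (c 0 * x 0 + c 1 * y 0 + c 2 * z 0),
      mul_self_nonneg (c 0 * x 1 + c 1 * y 1 + c 2 * z 1)]

theorem sg_neg_one : sg (-1) = -1 := by norm_num [sg]

/-! ### Signature restrictions and assembly of the ten types -/

section Assembly

variable {S : Mat4} {v w x y : ℕ → Fin 4 → ℝ} {t μ ν σ a b c d : ℝ} {ε ε' : ℤˣ}

/-- Some parameter value of the type `τ` describes `S`. -/
def HasType (S : Mat4) (τ : EType) : Prop :=
  ∃ p : Param τ, HasMat S (adaptedGram τ p.sign) (jordan τ p.val)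

theorem IsBlock.gram_J {k : ℕ} (h : IsBlock form (Matrix.toLin' S) (.J k t ε) w)
    (i j : Fin (k + 1)) : s22 (w i) (w j) = if (i : ℕ) + j = k then sg ε else 0 :=
  h.1 i (by omega) j (by omega)

theorem IsBlock.apply_J0 (h : IsBlock form (Matrix.toLin' S) (.J 0 t ε) w) :
    s22 (w 0) (w 0) = sg ε ∧ S *ᵥ w 0 = t • w 0 :=
  ⟨h.gram_J 0 0, h.2.1⟩

theorem IsBlock.apply_J1 (h : IsBlock form (Matrix.toLin' S) (.J 1 t ε) w) :
    (s22 (w 0) (w 0) = 0 ∧ s22 (w 0) (w 1) = sg ε ∧ s22 (w 1) (w 0) = sg ε ∧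
      s22 (w 1) (w 1) = 0) ∧ S *ᵥ w 0 = t • w 0 ∧ S *ᵥ w 1 = t • w 1 + w 0 :=
  ⟨⟨h.gram_J 0 0, h.gram_J 0 1, h.gram_J 1 0, h.gram_J 1 1⟩, h.2.1, h.2.2 0 (by norm_num)⟩

theorem IsBlock.apply_J2 (h : IsBlock form (Matrix.toLin' S) (.J 2 t ε) w) :
    (s22 (w 0) (w 0) = 0 ∧ s22 (w 0) (w 1) = 0 ∧ s22 (w 0) (w 2) = sg ε ∧
      s22 (w 1) (w 0) = 0 ∧ s22 (w 1) (w 1) = sg ε ∧ s22 (w 1) (w 2) = 0 ∧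
      s22 (w 2) (w 0) = sg ε ∧ s22 (w 2) (w 1) = 0 ∧ s22 (w 2) (w 2) = 0) ∧
      S *ᵥ w 0 = t • w 0 ∧ S *ᵥ w 1 = t • w 1 + w 0 ∧ S *ᵥ w 2 = t • w 2 + w 1 :=
  ⟨⟨h.gram_J 0 0, h.gram_J 0 1, h.gram_J 0 2, h.gram_J 1 0, h.gram_J 1 1, h.gram_J 1 2,
    h.gram_J 2 0, h.gram_J 2 1, h.gram_J 2 2⟩, h.2.1, h.2.2 0 (by norm_num),
    h.2.2 1 (by norm_num)⟩

theorem IsBlock.apply_K1 (h : IsBlock form (Matrix.toLin' S) (.K1 a b) w) :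
    b ≠ 0 ∧ (s22 (w 0) (w 0) = 1 ∧ s22 (w 1) (w 1) = -1 ∧ s22 (w 0) (w 1) = 0 ∧
      s22 (w 1) (w 0) = 0) ∧ S *ᵥ w 0 = a • w 0 - b • w 1 ∧ S *ᵥ w 1 = b • w 0 + a • w 1 :=
  ⟨h.1, ⟨h.2.1.1, h.2.1.2.1, h.2.1.2.2, (s22_comm _ _).trans h.2.1.2.2⟩, h.2.2.1, h.2.2.2⟩

/-- The first `m` vectors of `v` are orthogonal to the first `n` vectors of `w`. -/
def Perp (m n : ℕ) (v w : ℕ → Fin 4 → ℝ) : Prop :=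
  ∀ k < m, ∀ l < n, s22 (v k) (w l) = 0 ∧ s22 (w l) (v k) = 0

theorem hasType_I (hw : IsBlock form (Matrix.toLin' S) (.J 3 t ε) w) : HasType S .I := by
  refine ⟨⟨![ε], ![t], trivial⟩, hasMat_of_vectors (fun i => w i) (fun i j => ?_) fun j => ?_⟩
  · rw [hw.gram_J i j]
    fin_cases i <;> fin_cases j <;> simp [adaptedGram]
  · obtain ⟨-, h1, h2⟩ := hw
    have e1 := h2 0 (by norm_num)
    have e2 := h2 1 (by norm_num)
    have e3 := h2 2 (by norm_num)
    simp only [Matrix.toLin'_apply] at h1 e1 e2 e3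
    fin_cases j <;> simp [jordan, Fin.sum_univ_four, h1, e1, e2, e3] <;> abel

theorem hasType_II (hw : IsBlock form (Matrix.toLin' S) (.K2 a b) w) : HasType S .II := by
  obtain ⟨hb, ⟨h1, h2, h3, h4, h5, h6, h7, h8, h9, h10⟩, e1, e2, e3, e4⟩ := hw
  simp only [form_apply, Matrix.toLin'_apply] at *
  have h5' := (s22_comm _ _).trans h5
  have h6' := (s22_comm _ _).trans h6
  have h7' := (s22_comm _ _).trans h7
  have h8' := (s22_comm _ _).trans h8
  have h9' := (s22_comm _ _).trans h9
  have h10' := (s22_comm _ _).trans h10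
  refine ⟨⟨![], ![a, b], hb⟩, hasMat_of_vectors ![w 0, w 1, w 2, w 3] (fun i j => ?_) fun j => ?_⟩
  · fin_cases i <;> fin_cases j <;> simp [adaptedGram, *]
  · fin_cases j <;> simp [jordan, Fin.sum_univ_four, e1, e2, e3, e4] <;> abel

theorem hasType_IIIa (hv : IsBlock form (Matrix.toLin' S) (.J 0 t 1) v)
    (hw : IsBlock form (Matrix.toLin' S) (.J 2 μ (-1)) w) (h : Perp 1 3 v w) :
    HasType S .IIIa := by
  obtain ⟨h1, e1⟩ := hv.apply_J0
  obtain ⟨h2, e2, e3, e4⟩ := hw.apply_J2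
  refine ⟨⟨![], ![t, μ], trivial⟩, hasMat_of_vectors ![v 0, w 0, w 1, w 2] (fun i j => ?_)
    fun j => ?_⟩
  · fin_cases i <;> fin_cases j <;> simp [adaptedGram, sg_neg_one, h1, h2, h 0]
  · fin_cases j <;> simp [jordan, Fin.sum_univ_four, e1, e2, e3, e4] <;> abel

theorem hasType_IIIb (hw : IsBlock form (Matrix.toLin' S) (.J 2 t 1) w)
    (hv : IsBlock form (Matrix.toLin' S) (.J 0 μ (-1)) v) (h : Perp 1 3 v w) :
    HasType S .IIIb := by
  obtain ⟨h1, e1⟩ := hv.apply_J0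
  obtain ⟨h2, e2, e3, e4⟩ := hw.apply_J2
  refine ⟨⟨![], ![t, μ], trivial⟩, hasMat_of_vectors ![w 0, w 1, w 2, v 0] (fun i j => ?_)
    fun j => ?_⟩
  · fin_cases i <;> fin_cases j <;> simp [adaptedGram, sg_neg_one, h1, h2, h 0]
  · fin_cases j <;> simp [jordan, Fin.sum_univ_four, e1, e2, e3, e4] <;> abel

theorem hasType_IV (hv : IsBlock form (Matrix.toLin' S) (.J 0 t 1) v)
    (hw : IsBlock form (Matrix.toLin' S) (.J 1 μ ε) w)
    (hx : IsBlock form (Matrix.toLin' S) (.J 0 ν (-1)) x)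
    (h : Perp 1 2 v w) (h' : Perp 1 1 v x) (h'' : Perp 1 2 x w) : HasType S .IV := by
  obtain ⟨h1, e1⟩ := hv.apply_J0
  obtain ⟨h2, e2, e3⟩ := hw.apply_J1
  obtain ⟨h3, e4⟩ := hx.apply_J0
  refine ⟨⟨![ε], ![t, μ, ν], trivial⟩, hasMat_of_vectors ![v 0, w 0, w 1, x 0] (fun i j => ?_)
    fun j => ?_⟩
  · fin_cases i <;> fin_cases j <;> simp [adaptedGram, sg_neg_one, h1, h2, h3, h 0, h' 0, h'' 0]
  · fin_cases j <;> simp [jordan, Fin.sum_univ_four, e1, e2, e3, e4] <;> abel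

theorem hasType_V (hv : IsBlock form (Matrix.toLin' S) (.J 0 t 1) v)
    (hw : IsBlock form (Matrix.toLin' S) (.K1 a b) w)
    (hx : IsBlock form (Matrix.toLin' S) (.J 0 ν (-1)) x)
    (h : Perp 1 2 v w) (h' : Perp 1 1 v x) (h'' : Perp 1 2 x w) : HasType S .V := by
  obtain ⟨h1, e1⟩ := hv.apply_J0
  obtain ⟨hb, h2, e2, e3⟩ := hw.apply_K1
  obtain ⟨h3, e4⟩ := hx.apply_J0
  refine ⟨⟨![], ![t, a, b, ν], hb⟩, hasMat_of_vectors ![v 0, w 0, w 1, x 0] (fun i j => ?_)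
    fun j => ?_⟩
  · fin_cases i <;> fin_cases j <;> simp [adaptedGram, sg_neg_one, h1, h2, h3, h 0, h' 0, h'' 0]
  · fin_cases j <;> simp [jordan, Fin.sum_univ_four, e1, e2, e3, e4] <;> abel

theorem hasType_VI (hv : IsBlock form (Matrix.toLin' S) (.J 1 t ε) v)
    (hw : IsBlock form (Matrix.toLin' S) (.K1 a b) w) (h : Perp 2 2 v w) : HasType S .VI := by
  obtain ⟨h1, e1, e2⟩ := hv.apply_J1
  obtain ⟨hb, h2, e3, e4⟩ := hw.apply_K1
  refine ⟨⟨![ε], ![t, a, b], hb⟩, hasMat_of_vectors ![v 0, v 1, w 0, w 1] (fun i j => ?_)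
    fun j => ?_⟩
  · fin_cases i <;> fin_cases j <;> simp [adaptedGram, h1, h2, h 0, h 1]
  · fin_cases j <;> simp [jordan, Fin.sum_univ_four, e1, e2, e3, e4] <;> abel

theorem hasType_VII (hv : IsBlock form (Matrix.toLin' S) (.J 1 t ε) v)
    (hw : IsBlock form (Matrix.toLin' S) (.J 1 μ ε') w) (h : Perp 2 2 v w) : HasType S .VII := by
  obtain ⟨h1, e1, e2⟩ := hv.apply_J1
  obtain ⟨h2, e3, e4⟩ := hw.apply_J1
  refine ⟨⟨![ε, ε'], ![t, μ], trivial⟩, hasMat_of_vectors ![v 0, v 1, w 0, w 1] (fun i j => ?_)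
    fun j => ?_⟩
  · fin_cases i <;> fin_cases j <;> simp [adaptedGram, h1, h2, h 0, h 1]
  · fin_cases j <;> simp [jordan, Fin.sum_univ_four, e1, e2, e3, e4] <;> abel

theorem hasType_VIII (hv : IsBlock form (Matrix.toLin' S) (.K1 a b) v)
    (hw : IsBlock form (Matrix.toLin' S) (.K1 c d) w) (h : Perp 2 2 v w) : HasType S .VIII := by
  obtain ⟨hb, h1, e1, e2⟩ := hv.apply_K1
  obtain ⟨hd, h2, e3, e4⟩ := hw.apply_K1
  refine ⟨⟨![], ![a, b, c, d], hb, hd⟩, hasMat_of_vectors ![v 0, v 1, w 0, w 1] (fun i j => ?_)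
    fun j => ?_⟩
  · fin_cases i <;> fin_cases j <;> simp [adaptedGram, h1, h2, h 0, h 1]
  · fin_cases j <;> simp [jordan, Fin.sum_univ_four, e1, e2, e3, e4] <;> abel

theorem hasType_IX (hv : IsBlock form (Matrix.toLin' S) (.J 0 t 1) v)
    (hw : IsBlock form (Matrix.toLin' S) (.J 0 μ 1) w)
    (hx : IsBlock form (Matrix.toLin' S) (.J 0 ν (-1)) x)
    (hy : IsBlock form (Matrix.toLin' S) (.J 0 σ (-1)) y)
    (h1 : Perp 1 1 v w) (h2 : Perp 1 1 v x) (h3 : Perp 1 1 v y) (h4 : Perp 1 1 w x)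
    (h5 : Perp 1 1 w y) (h6 : Perp 1 1 x y) : HasType S .IX := by
  obtain ⟨g1, e1⟩ := hv.apply_J0
  obtain ⟨g2, e2⟩ := hw.apply_J0
  obtain ⟨g3, e3⟩ := hx.apply_J0
  obtain ⟨g4, e4⟩ := hy.apply_J0
  refine ⟨⟨![], ![t, μ, ν, σ], trivial⟩, hasMat_of_vectors ![v 0, w 0, x 0, y 0]
    (fun i j => ?_) fun j => ?_⟩
  · fin_cases i <;> fin_cases j <;>
      simp [adaptedGram, sg_neg_one, g1, g2, g3, g4, h1 0, h2 0, h3 0, h4 0, h5 0, h6 0]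
  · fin_cases j <;> simp [jordan, Fin.sum_univ_four, e1, e2, e3, e4]

theorem Perp.symm {m n : ℕ} (h : Perp m n v w) : Perp n m w v :=
  fun k hk l hl => (h l hl k hk).symm

/-- A vector in the span of a block of size two, of either given sign. -/
theorem exists_vector_of_sign {β : Block} (hβ : β.size = 2)
    (hw : IsBlock form (Matrix.toLin' S) β w) (ε' : ℤˣ) :
    ∃ r q : ℝ, 0 < sg ε' * s22 (r • w 0 + q • w 1) (r • w 0 + q • w 1) := by
  have h2 : ∀ r q : ℝ, s22 (r • w 0 + q • w 1) (r • w 0 + q • w 1) = r * r * s22 (w 0) (w 0) +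
      2 * (r * q) * s22 (w 0) (w 1) + q * q * s22 (w 1) (w 1) := by
    intro r q
    simp only [s22, Pi.add_apply, Pi.smul_apply, smul_eq_mul]
    ring
  have hs := sg_mul_self ε'
  rcases β with ⟨k, t, ε⟩ | ⟨a, b⟩ | ⟨a, b⟩
  · obtain rfl : k = 1 := by simpa [Block.size] using hβ
    obtain ⟨⟨g1, g2, g3, g4⟩, -⟩ := hw.apply_J1
    have hs' := sg_mul_self ε
    -- In the hyperbolic plane of a Jordan block only the mixed product survives, and `2 * sg ε' *
    -- sg ε * sg ε` has sign `ε'`.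
    refine ⟨sg ε', sg ε, ?_⟩
    rw [h2, g1, g2, g4]
    nlinarith
  · obtain ⟨-, ⟨g1, g2, g3, g4⟩, -⟩ := hw.apply_K1
    rcases Int.units_eq_one_or ε' with rfl | rfl
    · refine ⟨1, 0, ?_⟩
      rw [h2, g1, g2, g3]
      norm_num
    · refine ⟨0, 1, ?_⟩
      rw [h2, g1, g2, g3, sg_neg_one]
      norm_num
  · simp [Block.size] at hβ

theorem s22_comb_eq_zero {z : Fin 4 → ℝ} (h0 : s22 z (w 0) = 0) (h1 : s22 z (w 1) = 0) (r q : ℝ) :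
    s22 z (r • w 0 + q • w 1) = 0 := by
  have h : s22 z (r • w 0 + q • w 1) = r * s22 z (w 0) + q * s22 z (w 1) := by
    simp only [s22, Pi.add_apply, Pi.smul_apply, smul_eq_mul]
    ring
  rw [h, h0, h1]
  ring

/-- Two one-dimensional blocks orthogonal to a block of size two have opposite signs. -/
theorem sign_eq_neg_of_two_one_one {β : Block} (hβ : β.size = 2)
    (hw : IsBlock form (Matrix.toLin' S) β w)
    (hv : IsBlock form (Matrix.toLin' S) (.J 0 t ε) v)
    (hx : IsBlock form (Matrix.toLin' S) (.J 0 μ ε') x)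
    (h : Perp 1 2 v w) (h' : Perp 1 1 v x) (h'' : Perp 1 2 x w) : ε' = -ε := by
  by_contra hne
  have he : ε' = ε := by
    rcases Int.units_eq_one_or ε with rfl | rfl <;> rcases Int.units_eq_one_or ε' with rfl | rfl <;>
      simp_all
  subst he
  obtain ⟨r, q, hz⟩ := exists_vector_of_sign hβ hw ε'
  refine not_three_orthogonal ε' (x := v 0) (y := x 0) ?_ ?_ hz (h' 0 one_pos 0 one_pos).1
    (s22_comb_eq_zero (h 0 one_pos 0 two_pos).1 (h 0 one_pos 1 one_lt_two).1 r q)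
    (s22_comb_eq_zero (h'' 0 one_pos 0 two_pos).1 (h'' 0 one_pos 1 one_lt_two).1 r q)
  · rw [hv.apply_J0.1, sg_mul_self]
    exact one_pos
  · rw [hx.apply_J0.1, sg_mul_self]
    exact one_pos

/-- A Jordan block of size three and sign `ε` contains the orthogonal vectors `w 1` and `w 0 + w 2`,
both of sign `ε`; a third one orthogonal to them is excluded by the signature. -/
theorem sign_eq_neg_of_three_one (hw : IsBlock form (Matrix.toLin' S) (.J 2 t ε) w)
    (hv : IsBlock form (Matrix.toLin' S) (.J 0 μ ε') v) (h : Perp 1 3 v w) : ε' = -ε := by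
  by_contra hne
  have he : ε' = ε := by
    rcases Int.units_eq_one_or ε with rfl | rfl <;> rcases Int.units_eq_one_or ε' with rfl | rfl <;>
      simp_all
  subst he
  obtain ⟨⟨g1, g2, g3, g4, g5, g6, g7, g8, g9⟩, -⟩ := hw.apply_J2
  have hs := sg_mul_self ε'
  have h0 := (h 0 one_pos 0 (by norm_num)).1
  have h1 := (h 0 one_pos 1 (by norm_num)).1
  have h2 := (h 0 one_pos 2 (by norm_num)).1
  have e1 : s22 (w 0 + w 2) (w 0 + w 2) = s22 (w 0) (w 0) + s22 (w 0) (w 2) + s22 (w 2) (w 0) +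
      s22 (w 2) (w 2) := by
    simp only [s22, Pi.add_apply]
    ring
  have e2 : ∀ z, s22 z (w 0 + w 2) = s22 z (w 0) + s22 z (w 2) := by
    intro z
    simp only [s22, Pi.add_apply]
    ring
  refine not_three_orthogonal ε' (x := v 0) (y := w 1) (z := w 0 + w 2) ?_ ?_ ?_ h1 ?_ ?_
  · rw [hv.apply_J0.1, hs]
    exact one_pos
  · rw [g5, hs]
    exact one_pos
  · rw [e1, g1, g3, g7, g9]
    linarith
  · rw [e2, h0, h2, add_zero]
  · rw [e2, g4, g6, add_zero]

theorem not_three_equal_signs (hv : IsBlock form (Matrix.toLin' S) (.J 0 t ε) v)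
    (hw : IsBlock form (Matrix.toLin' S) (.J 0 μ ε) w)
    (hx : IsBlock form (Matrix.toLin' S) (.J 0 ν ε) x)
    (h1 : Perp 1 1 v w) (h2 : Perp 1 1 v x) (h3 : Perp 1 1 w x) : False := by
  have hs := sg_mul_self ε
  refine not_three_orthogonal ε (x := v 0) (y := w 0) (z := x 0) ?_ ?_ ?_
    (h1 0 one_pos 0 one_pos).1 (h2 0 one_pos 0 one_pos).1 (h3 0 one_pos 0 one_pos).1
  · rw [hv.apply_J0.1, hs]
    exact one_pos
  · rw [hw.apply_J0.1, hs]
    exact one_pos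
  · rw [hx.apply_J0.1, hs]
    exact one_pos

theorem IsDecomposition.perp {n : ℕ} {β : Fin n → Block} {u : Fin n → ℕ → Fin 4 → ℝ}
    (h : IsDecomposition form (Matrix.toLin' S) β u) {i j : Fin n} (hij : i ≠ j) {k l : ℕ}
    (hi : (β i).size = k) (hj : (β j).size = l) : Perp k l (u i) (u j) := by
  subst hi hj
  exact fun k hk l hl => ⟨h.2 i j hij k hk l hl, h.2 j i hij.symm l hl k hk⟩

theorem Block.eq_J0_of_size {β : Block} (h : β.size = 1) : ∃ t ε, β = .J 0 t ε := by
  rcases β with ⟨k, t, ε⟩ | _ | _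
  · obtain rfl : k = 0 := by simpa [Block.size] using h
    exact ⟨t, ε, rfl⟩
  all_goals simp [Block.size] at h

theorem hasType_of_three_one {β : Fin 2 → Block} {u : Fin 2 → ℕ → Fin 4 → ℝ}
    (h : IsDecomposition form (Matrix.toLin' S) β u) (h3 : (β 0).size = 3)
    (h1 : (β 1).size = 1) : ∃ τ, HasType S τ := by
  have hp := h.perp (i := 1) (j := 0) (by decide) h1 h3
  have b0 := h.1 0
  have b1 := h.1 1
  obtain ⟨t, ε, e1⟩ := Block.eq_J0_of_size h1
  rw [e1] at b1
  rcases e0 : β 0 with ⟨k, μ, ε'⟩ | _ | _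
  · obtain rfl : k = 2 := by simpa [Block.size, e0] using h3
    rw [e0] at b0
    have hs := sign_eq_neg_of_three_one b0 b1 hp
    rcases Int.units_eq_one_or ε' with rfl | rfl
    · rw [hs] at b1
      exact ⟨_, hasType_IIIb b0 b1 hp⟩
    · rw [hs, neg_neg] at b1
      exact ⟨_, hasType_IIIa b1 b0 hp⟩
  all_goals simp [Block.size, e0] at h3

theorem hasType_of_two_two {β : Fin 2 → Block} {u : Fin 2 → ℕ → Fin 4 → ℝ}
    (h : IsDecomposition form (Matrix.toLin' S) β u) (h0 : (β 0).size = 2)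
    (h1 : (β 1).size = 2) : ∃ τ, HasType S τ := by
  have hp := h.perp (i := 0) (j := 1) (by decide) h0 h1
  have b0 := h.1 0
  have b1 := h.1 1
  rcases e0 : β 0 with ⟨k, μ, ε⟩ | ⟨a, b⟩ | ⟨a, b⟩ <;>
    rcases e1 : β 1 with ⟨l, ν, ε'⟩ | ⟨c, d⟩ | ⟨c, d⟩ <;>
    simp [Block.size, e0, e1] at h0 h1 <;> rw [e0] at b0 <;> rw [e1] at b1
  · subst h0 h1
    exact ⟨_, hasType_VII b0 b1 hp⟩
  · subst h0
    exact ⟨_, hasType_VI b0 b1 hp⟩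
  · subst h1
    exact ⟨_, hasType_VI b1 b0 hp.symm⟩
  · exact ⟨_, hasType_VIII b0 b1 hp⟩

theorem hasType_of_two_one_one {β : Fin 3 → Block} {u : Fin 3 → ℕ → Fin 4 → ℝ}
    (h : IsDecomposition form (Matrix.toLin' S) β u) (h0 : (β 0).size = 2)
    (h1 : (β 1).size = 1) (h2 : (β 2).size = 1) : ∃ τ, HasType S τ := by
  have p10 := h.perp (i := 1) (j := 0) (by decide) h1 h0
  have p12 := h.perp (i := 1) (j := 2) (by decide) h1 h2
  have p20 := h.perp (i := 2) (j := 0) (by decide) h2 h0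
  have b0 := h.1 0
  have b1 := h.1 1
  have b2 := h.1 2
  obtain ⟨t, ε, e1⟩ := Block.eq_J0_of_size h1
  obtain ⟨ν, ε', e2⟩ := Block.eq_J0_of_size h2
  rw [e1] at b1
  rw [e2] at b2
  have hs := sign_eq_neg_of_two_one_one h0 b0 b1 b2 p10 p12 p20
  rcases e0 : β 0 with ⟨k, μ, ε''⟩ | ⟨a, b⟩ | ⟨a, b⟩
  · obtain rfl : k = 1 := by simpa [Block.size, e0] using h0
    rw [e0] at b0
    rcases Int.units_eq_one_or ε with rfl | rfl
    · rw [hs] at b2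
      exact ⟨_, hasType_IV b1 b0 b2 p10 p12 p20⟩
    · rw [hs, neg_neg] at b2
      exact ⟨_, hasType_IV b2 b0 b1 p20 p12.symm p10⟩
  · rw [e0] at b0
    rcases Int.units_eq_one_or ε with rfl | rfl
    · rw [hs] at b2
      exact ⟨_, hasType_V b1 b0 b2 p10 p12 p20⟩
    · rw [hs, neg_neg] at b2
      exact ⟨_, hasType_V b2 b0 b1 p20 p12.symm p10⟩
  · simp [Block.size, e0] at h0

/-- No sign occurs three times among four mutually orthogonal lines, so exactly two are positive.
The six ways of choosing these two are relabelled to the order of type IX. -/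
theorem hasType_of_one_one_one_one {β : Fin 4 → Block} {u : Fin 4 → ℕ → Fin 4 → ℝ}
    (h : IsDecomposition form (Matrix.toLin' S) β u) (h1 : ∀ i, (β i).size = 1) :
    ∃ τ, HasType S τ := by
  have hp : ∀ {i j}, i ≠ j → Perp 1 1 (u i) (u j) := fun hij => h.perp hij (h1 _) (h1 _)
  choose t ε e using fun i => Block.eq_J0_of_size (h1 i)
  have hb : ∀ i, IsBlock form (Matrix.toLin' S) (.J 0 (t i) (ε i)) (u i) := fun i => e i ▸ h.1 i
  have h3 : ∀ i j k, i ≠ j → i ≠ k → j ≠ k → ε i = ε j → ε i = ε k → False := by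
    intro i j k hij hik hjk h1 h2
    have hj := hb j
    have hk := hb k
    rw [← h1] at hj
    rw [← h2] at hk
    exact not_three_equal_signs (hb i) hj hk (hp hij) (hp hik) (hp hjk)
  have h4 : ∀ i j k l, i ≠ j → i ≠ k → i ≠ l → j ≠ k → j ≠ l → k ≠ l → ε i = 1 → ε j = 1 →
      ∃ τ, HasType S τ := by
    intro i j k l hij hik hil hjk hjl hkl hi hj
    have bi := hb i
    have bj := hb j
    have bk := hb k
    have bl := hb l
    have hk := (Int.units_eq_one_or (ε k)).resolve_left fun hk =>
      h3 i j k hij hik hjk (hi.trans hj.symm) (hi.trans hk.symm)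
    have hl := (Int.units_eq_one_or (ε l)).resolve_left fun hl =>
      h3 i j l hij hil hjl (hi.trans hj.symm) (hi.trans hl.symm)
    rw [hi] at bi
    rw [hj] at bj
    rw [hk] at bk
    rw [hl] at bl
    exact ⟨_, hasType_IX bi bj bk bl (hp hij) (hp hik) (hp hil) (hp hjk) (hp hjl) (hp hkl)⟩
  have n012 := h3 0 1 2 (by decide) (by decide) (by decide)
  have n013 := h3 0 1 3 (by decide) (by decide) (by decide)
  have n023 := h3 0 2 3 (by decide) (by decide) (by decide)
  have n123 := h3 1 2 3 (by decide) (by decide) (by decide)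
  rcases Int.units_eq_one_or (ε 0) with s0 | s0 <;> rcases Int.units_eq_one_or (ε 1) with s1 | s1 <;>
    rcases Int.units_eq_one_or (ε 2) with s2 | s2 <;>
    rcases Int.units_eq_one_or (ε 3) with s3 | s3 <;> simp [s0, s1, s2, s3] at n012 n013 n023 n123
  · exact h4 0 1 2 3 (by decide) (by decide) (by decide) (by decide) (by decide) (by decide) s0 s1
  · exact h4 0 2 1 3 (by decide) (by decide) (by decide) (by decide) (by decide) (by decide) s0 s2
  · exact h4 0 3 1 2 (by decide) (by decide) (by decide) (by decide) (by decide) (by decide) s0 s3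
  · exact h4 1 2 0 3 (by decide) (by decide) (by decide) (by decide) (by decide) (by decide) s1 s2
  · exact h4 1 3 0 2 (by decide) (by decide) (by decide) (by decide) (by decide) (by decide) s1 s3
  · exact h4 2 3 0 1 (by decide) (by decide) (by decide) (by decide) (by decide) (by decide) s2 s3

theorem IsDecomposition.comp {n : ℕ} {β : Fin n → Block} {u : Fin n → ℕ → Fin 4 → ℝ}
    (h : IsDecomposition form (Matrix.toLin' S) β u) (σ : Equiv.Perm (Fin n)) :
    IsDecomposition form (Matrix.toLin' S) (β ∘ σ) (u ∘ σ) :=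
  ⟨fun i => h.1 (σ i), fun i j hij => h.2 (σ i) (σ j) (σ.injective.ne hij)⟩

end Assembly

/-- The block sizes form a composition of four. After a permutation of the blocks, the cases left
are `4`, `3 + 1`, `2 + 2`, `2 + 1 + 1` and `1 + 1 + 1 + 1`. -/
theorem exists_hasType (S : EndPlus) : ∃ τ, HasType (S : Mat4) τ := by
  obtain ⟨n, β, u, h, hsum⟩ := exists_isDecomposition 4 (Fin 4 → ℝ) form (Matrix.toLin' (S : Mat4))
    (by simp) le_rfl s22_comm eq_zero_of_forall_s22 (fun x y => S.2 x y)
  have hpos : ∀ i, 1 ≤ (β i).size := fun i => by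
    cases β i <;> simp [Block.size]
  have hn : n ≤ 4 := by
    calc n = ∑ _i : Fin n, 1 := by simp
      _ ≤ ∑ i, (β i).size := Finset.sum_le_sum fun i _ => hpos i
      _ = 4 := hsum
  interval_cases n
  · simp at hsum
  · rw [Fin.sum_univ_one] at hsum
    have b0 := h.1 0
    rcases e0 : β 0 with ⟨k, t, ε⟩ | ⟨a, b⟩ | ⟨a, b⟩ <;> simp [Block.size, e0] at hsum <;>
      rw [e0] at b0
    · subst hsum
      exact ⟨_, hasType_I b0⟩
    · exact ⟨_, hasType_II b0⟩
  · rw [Fin.sum_univ_two] at hsum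
    have g0 := hpos 0
    have g1 := hpos 1
    rcases (by omega : (β 0).size = 3 ∧ (β 1).size = 1 ∨ (β 0).size = 2 ∧ (β 1).size = 2 ∨
      (β 0).size = 1 ∧ (β 1).size = 3) with ⟨h0, h1⟩ | ⟨h0, h1⟩ | ⟨h0, h1⟩
    · exact hasType_of_three_one h h0 h1
    · exact hasType_of_two_two h h0 h1
    · exact hasType_of_three_one (h.comp (Equiv.swap 0 1)) h1 h0
  · rw [Fin.sum_univ_three] at hsum
    have g0 := hpos 0
    have g1 := hpos 1
    have g2 := hpos 2
    rcases (by omega : ((β 0).size = 2 ∧ (β 1).size = 1 ∧ (β 2).size = 1) ∨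
      ((β 1).size = 2 ∧ (β 0).size = 1 ∧ (β 2).size = 1) ∨
      ((β 2).size = 2 ∧ (β 1).size = 1 ∧ (β 0).size = 1)) with
      ⟨h0, h1, h2⟩ | ⟨h0, h1, h2⟩ | ⟨h0, h1, h2⟩
    · exact hasType_of_two_one_one h h0 h1 h2
    · exact hasType_of_two_one_one (h.comp (Equiv.swap 0 1)) h0 h1 h2
    · exact hasType_of_two_one_one (h.comp (Equiv.swap 0 2)) h0 h1 h2
  · rw [Fin.sum_univ_four] at hsum
    have g0 := hpos 0
    have g1 := hpos 1
    have g2 := hpos 2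
    have g3 := hpos 3
    refine hasType_of_one_one_one_one h fun i => ?_
    fin_cases i <;> simp only [Fin.zero_eta, Fin.mk_one, Fin.reduceFinMk] <;> omega

/-! ### The blocks of a decomposition are determined by the endomorphism -/

section Index

variable {V : Type*} [AddCommGroup V] [Module ℝ V] {B : LinearMap.BilinForm ℝ V} {S : V →ₗ[ℝ] V}

/-- The subspace spanned by the vectors of a block. -/
def blockSpan (b : Block) (w : ℕ → V) : Submodule ℝ V :=
  Submodule.span ℝ (range fun i : Fin b.size => w i)

theorem mem_blockSpan {b : Block} {w : ℕ → V} {k : ℕ} (hk : k < b.size) : w k ∈ blockSpan b w :=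
  Submodule.subset_span ⟨⟨k, hk⟩, rfl⟩

theorem IsBlock.map_mem_blockSpan {b : Block} {w : ℕ → V} (h : IsBlock B S b w) {y : V}
    (hy : y ∈ blockSpan b w) : S y ∈ blockSpan b w := by
  induction hy using Submodule.span_induction with
  | mem x hx =>
    obtain ⟨i, rfl⟩ := hx
    exact h.map_mem_span i
  | zero => simp
  | add x y _ _ hx hy => simpa using Submodule.add_mem _ hx hy
  | smul c x _ hx => simpa using Submodule.smul_mem _ c hx

theorem IsBlock.pow_mem_blockSpan {b : Block} {w : ℕ → V} (h : IsBlock B S b w) (t : ℝ) (n : ℕ)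
    {y : V} (hy : y ∈ blockSpan b w) : ((S - t • 1) ^ n) y ∈ blockSpan b w := by
  induction n with
  | zero => simpa using hy
  | succ n ih =>
    rw [pow_succ', Module.End.mul_apply, LinearMap.sub_apply]
    exact Submodule.sub_mem _ (h.map_mem_blockSpan ih) (Submodule.smul_mem _ _ ih)

/-- Nondegeneracy of the form on one block, in the shape used repeatedly below: a vector of the
block is determined by its products with the block vectors. -/
theorem IsBlock.eq_zero_of_orthogonal {b : Block} {w : ℕ → V} (hB : ∀ x y, B x y = B y x)
    (h : IsBlock B S b w) {y : V} (hy : y ∈ blockSpan b w) (h0 : ∀ k < b.size, B y (w k) = 0) :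
    y = 0 := by
  obtain ⟨w', hw', hd⟩ := h.exists_dual hB
  have h1 : ∀ z ∈ blockSpan b w, B y z = 0 := by
    intro z hz
    induction hz using Submodule.span_induction with
    | mem x hx =>
      obtain ⟨i, rfl⟩ := hx
      exact h0 i i.2
    | zero => simp
    | add x y _ _ hx hy => simp [hx, hy]
    | smul c x _ hx => simp [hx]
  obtain ⟨c, rfl⟩ := (Submodule.mem_span_range_iff_exists_fun ℝ).1 hy
  refine Finset.sum_eq_zero fun j _ => ?_
  have h2 := h1 (w' j) (hw' j)
  have h3 : B (∑ i, c i • w i) (w' j) = c j := by simp [hd]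
  rw [h3] at h2
  rw [h2, zero_smul]

theorem eq_zero_of_rotation {t a b p q : ℝ} (hb : b ≠ 0) (h1 : t * p = a * p - b * q)
    (h2 : t * q = b * p + a * q) : p = 0 ∧ q = 0 := by
  -- This is the determinant of the linear system, positive because a real `t` is not an eigenvalue
  -- of a block with `b ≠ 0`.
  have hpos : 0 < (t - a) ^ 2 + b ^ 2 := by positivity
  have e1 : ((t - a) ^ 2 + b ^ 2) * p = 0 := by linear_combination (t - a) * h1 - b * h2
  have e2 : ((t - a) ^ 2 + b ^ 2) * q = 0 := by linear_combination b * h1 + (t - a) * h2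
  exact ⟨(mul_eq_zero.1 e1).resolve_left hpos.ne', (mul_eq_zero.1 e2).resolve_left hpos.ne'⟩

/-- A block other than a real Jordan block for `t` has no eigenvector for `t`. -/
theorem IsBlock.eq_zero_of_eigenvector {b : Block} {w : ℕ → V} (hB : ∀ x y, B x y = B y x)
    (hS : ∀ x y, B (S x) y = B x (S y)) (h : IsBlock B S b w) {t : ℝ}
    (ht : ∀ k ε, b ≠ .J k t ε) {y : V} (hy : y ∈ blockSpan b w) (hSy : S y = t • y) : y = 0 := by
  have key : ∀ z, t * B y z = B y (S z) := fun z => by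
    rw [← hS, hSy, map_smul, LinearMap.smul_apply, smul_eq_mul]
  refine h.eq_zero_of_orthogonal hB hy ?_
  rcases b with ⟨k, s, ε⟩ | ⟨a, b⟩ | ⟨a, b⟩
  · obtain ⟨-, h0, h1⟩ := h
    have hst : t - s ≠ 0 := fun hst => ht k ε (by rw [sub_eq_zero.1 hst])
    intro j
    induction j with
    | zero =>
      intro _
      have := key (w 0)
      rw [h0, map_smul, smul_eq_mul] at this
      exact (mul_eq_zero.1 (show (t - s) * B y (w 0) = 0 by linarith)).resolve_left hst
    | succ j ih =>
      intro hj
      change j + 1 < k + 1 at hj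
      have e := ih (by change j < k + 1; omega)
      have := key (w (j + 1))
      rw [h1 j (by omega), map_add, e, map_smul, smul_eq_mul] at this
      exact (mul_eq_zero.1 (show (t - s) * B y (w (j + 1)) = 0 by linarith)).resolve_left hst
  · obtain ⟨hb, -, h0, h1⟩ := h
    have k0 := key (w 0)
    have k1 := key (w 1)
    rw [h0] at k0
    rw [h1] at k1
    simp only [map_add, map_sub, map_smul, smul_eq_mul] at k0 k1
    obtain ⟨e0, e1⟩ := eq_zero_of_rotation hb k0 k1
    intro j hj
    change j < 2 at hj
    interval_cases j <;> assumption
  · obtain ⟨hb, -, h0, h1, h2, h3⟩ := h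
    have k0 := key (w 0)
    have k1 := key (w 1)
    have k2 := key (w 2)
    have k3 := key (w 3)
    rw [h0] at k0
    rw [h1] at k1
    rw [h2] at k2
    rw [h3] at k3
    simp only [map_add, map_sub, map_smul, smul_eq_mul] at k0 k1 k2 k3
    obtain ⟨e0, e1⟩ := eq_zero_of_rotation hb k0 k1
    rw [e0, zero_add] at k2
    rw [e1, zero_add] at k3
    obtain ⟨e2, e3⟩ := eq_zero_of_rotation hb k2 k3
    intro j hj
    change j < 4 at hj
    interval_cases j <;> assumption

theorem IsBlock.eq_zero_of_pow {b : Block} {w : ℕ → V} (hB : ∀ x y, B x y = B y x)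
    (hS : ∀ x y, B (S x) y = B x (S y)) (h : IsBlock B S b w) {t : ℝ}
    (ht : ∀ k ε, b ≠ .J k t ε) (n : ℕ) {y : V} (hy : y ∈ blockSpan b w)
    (hN : ((S - t • 1) ^ n) y = 0) : y = 0 := by
  induction n with
  | zero => simpa using hN
  | succ n ih =>
    refine ih (h.eq_zero_of_eigenvector hB hS ht (h.pow_mem_blockSpan t n hy) ?_)
    rw [pow_succ', Module.End.mul_apply, LinearMap.sub_apply] at hN
    simpa using sub_eq_zero.1 hN

theorem IsBlock.pow_apply_J {k : ℕ} {t : ℝ} {ε : ℤˣ} {w : ℕ → V} (h : IsBlock B S (.J k t ε) w)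
    {n j : ℕ} (hj : j ≤ k) :
    ((S - t • 1) ^ n) (w j) = if n ≤ j then w (j - n) else 0 := by
  obtain ⟨-, h0, h1⟩ := h
  induction n with
  | zero => simp
  | succ n ih =>
    rw [pow_succ', Module.End.mul_apply, ih]
    by_cases hn : n ≤ j
    · rw [if_pos hn]
      by_cases hn' : n + 1 ≤ j
      · rw [if_pos hn', show j - n = j - (n + 1) + 1 by omega, LinearMap.sub_apply,
          h1 _ (by omega)]
        simp
      · rw [if_neg hn', show j - n = 0 by omega, LinearMap.sub_apply, h0]
        simp
    · rw [if_neg hn, if_neg (by omega), map_zero]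

theorem selfAdjoint_sub_smul (hS : ∀ x y, B (S x) y = B x (S y)) (t : ℝ) (x y : V) :
    B ((S - t • 1) x) y = B x ((S - t • 1) y) := by
  simp [hS]

-- On a single block the form `ε B(N ^ k y, y)`, restricted to the kernel of `N ^ (k + 1)` with `N =
-- S - t`, is nonpositive unless the block has exactly the given size, eigenvalue and sign; in that
-- case it is the square of one linear functional. Summed over blocks, this bounds the positive
-- index from above.
open Classical in
theorem IsBlock.index_le {b : Block} {w : ℕ → V} (hB : ∀ x y, B x y = B y x)
    (hS : ∀ x y, B (S x) y = B x (S y)) (h : IsBlock B S b w) (k : ℕ) (t : ℝ) (ε : ℤˣ) {y : V}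
    (hy : y ∈ blockSpan b w) (hN : ((S - t • 1) ^ (k + 1)) y = 0) :
    sg ε * B (((S - t • 1) ^ k) y) y ≤ if b = .J k t ε then B y (w 0) ^ 2 else 0 := by
  by_cases ht : ∀ k ε, b ≠ .J k t ε
  · rw [if_neg (ht k ε), h.eq_zero_of_pow hB hS ht _ hy hN]
    simp
  push Not at ht
  obtain ⟨l, ε', rfl⟩ := ht
  have hNs := selfAdjoint_sub_smul hS t
  set v := ((S - t • 1) ^ k) y with hv
  have hNv : (S - t • 1) v = 0 := by rwa [hv, ← Module.End.mul_apply, ← pow_succ']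
  have hw0 : ∀ j ≤ l, B (w 0) (w j) = if j = l then sg ε' else 0 := fun j hj => by
    rw [h.1 0 (by omega) j hj, zero_add]
  have hvw : ∀ j < l, B v (w j) = 0 := by
    intro j hj
    have h1 := h.pow_apply_J (n := 1) (j := j + 1) (by omega)
    rw [if_pos (by omega), pow_one, Nat.add_sub_cancel] at h1
    rw [← h1, ← hNs, hNv]
    simp
  -- The kernel of `N` in a Jordan block is the line of `w 0`, so `N ^ k y` is determined by its
  -- product with the last vector `w l`.
  have hvw0 : v = (sg ε' * B v (w l)) • w 0 := by
    rw [← sub_eq_zero]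
    refine h.eq_zero_of_orthogonal hB (Submodule.sub_mem _ (h.pow_mem_blockSpan t k hy)
      (Submodule.smul_mem _ _ (mem_blockSpan (by change 0 < l + 1; omega)))) fun j hj => ?_
    change j < l + 1 at hj
    rw [map_sub, LinearMap.sub_apply, map_smul, LinearMap.smul_apply, hw0 j (by omega)]
    by_cases hjl : j = l
    · rw [if_pos hjl, hjl, smul_eq_mul]
      linear_combination (-B v (w l)) * sg_mul_self ε'
    · rw [if_neg hjl, hvw j (by omega)]
      simp
  have hval : B v y = sg ε' * B v (w l) * B (w 0) y := by
    conv_lhs => rw [hvw0]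
    rw [map_smul, LinearMap.smul_apply, smul_eq_mul]
  have hvl : B v (w l) = B y (((S - t • 1) ^ k) (w l)) := by
    rw [hv, selfAdjoint_pow hNs]
  rw [h.pow_apply_J le_rfl] at hvl
  -- In a longer block `w 0` is a power of `N` of exponent at least `k + 1`, hence orthogonal to
  -- `y`. In a shorter block `N ^ k` vanishes. Only equal length contributes, with the sign of the
  -- block.
  rcases lt_trichotomy k l with hkl | rfl | hkl
  · have h1 : B (w 0) y = 0 := by
      have h2 := h.pow_apply_J (n := l) (j := l) le_rfl
      rw [if_pos le_rfl, Nat.sub_self] at h2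
      obtain ⟨r, rfl⟩ := Nat.exists_eq_add_of_lt hkl
      rw [← h2, selfAdjoint_pow hNs, show k + r + 1 = r + (k + 1) by ring, pow_add,
        Module.End.mul_apply, hN]
      simp
    rw [hval, h1, if_neg (by simp; omega)]
    simp
  · rw [if_pos le_rfl, Nat.sub_self] at hvl
    rw [hval, hvl, hB (w 0) y]
    by_cases hε : ε' = ε
    · rw [if_pos (by rw [hε]), hε]
      refine le_of_eq ?_
      linear_combination (B y (w 0) ^ 2) * sg_mul_self ε
    · rw [if_neg (by simpa using hε)]
      have h1 : sg ε * sg ε' = -1 := by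
        rcases Int.units_eq_one_or ε with rfl | rfl <;>
          rcases Int.units_eq_one_or ε' with rfl | rfl
        · exact absurd rfl hε
        · norm_num [sg]
        · norm_num [sg]
        · exact absurd rfl hε
      nlinarith [sq_nonneg (B y (w 0))]
  · rw [if_neg (by omega), map_zero] at hvl
    rw [hval, hvl, if_neg (by simp; omega)]
    simp

variable {n : ℕ} {β : Fin n → Block} {u : Fin n → ℕ → V}

theorem IsDecomposition.blockSpan_orthogonal (h : IsDecomposition B S β u) {i j : Fin n}
    (hij : i ≠ j) {x y : V} (hx : x ∈ blockSpan (β i) (u i)) (hy : y ∈ blockSpan (β j) (u j)) :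
    B x y = 0 := by
  induction hx using Submodule.span_induction with
  | zero => simp
  | add x x' _ _ hx hx' => simp [hx, hx']
  | smul c x _ hx => simp [hx]
  | mem x hx =>
    obtain ⟨k, rfl⟩ := hx
    induction hy using Submodule.span_induction with
    | zero => simp
    | add y y' _ _ hy hy' => simp [hy, hy']
    | smul c y _ hy => simp [hy]
    | mem y hy =>
      obtain ⟨l, rfl⟩ := hy
      exact h.2 i j hij k k.2 l l.2

theorem IsDecomposition.exists_sum [FiniteDimensional ℝ V] (hB : ∀ x y, B x y = B y x)
    (h : IsDecomposition B S β u) (hsum : ∑ i, (β i).size = Module.finrank ℝ V) (x : V) :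
    ∃ y : Fin n → V, (∀ i, y i ∈ blockSpan (β i) (u i)) ∧ x = ∑ i, y i := by
  choose w' hw' hd using fun i => (h.1 i).exists_dual hB
  have hli : LinearIndependent ℝ fun q : Σ i, Fin (β i).size => u q.1 q.2 := by
    rw [Fintype.linearIndependent_iff]
    rintro c hc ⟨i, k⟩
    have h1 : B (∑ q : Σ i, Fin (β i).size, c q • u q.1 q.2) (w' i k) = c ⟨i, k⟩ := by
      rw [map_sum, LinearMap.sum_apply, Fintype.sum_sigma, Finset.sum_eq_single i]
      · simp [hd]
      · intro j _ hj
        refine Finset.sum_eq_zero fun l _ => ?_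
        rw [map_smul, LinearMap.smul_apply,
          h.blockSpan_orthogonal hj (mem_blockSpan l.2) (hw' i k), smul_zero]
      · simp
    rw [← h1, hc]
    simp
  have hspan := hli.span_eq_top_of_card_eq_finrank' (by simp [hsum])
  obtain ⟨c, rfl⟩ := (Submodule.mem_span_range_iff_exists_fun ℝ).1
    (hspan ▸ (Submodule.mem_top : x ∈ ⊤))
  refine ⟨fun i => ∑ k, c ⟨i, k⟩ • u i k, fun i => Submodule.sum_mem _ fun k _ =>
    Submodule.smul_mem _ _ (mem_blockSpan k.2), ?_⟩
  rw [Fintype.sum_sigma]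

theorem IsDecomposition.eq_zero_of_sum (hB : ∀ x y, B x y = B y x) (h : IsDecomposition B S β u)
    {y : Fin n → V} (hy : ∀ i, y i ∈ blockSpan (β i) (u i)) (h0 : ∑ i, y i = 0) (i : Fin n) :
    y i = 0 := by
  refine (h.1 i).eq_zero_of_orthogonal hB (hy i) fun k hk => ?_
  have h1 : B (∑ i, y i) (u i k) = B (y i) (u i k) := by
    rw [map_sum, LinearMap.sum_apply, Finset.sum_eq_single i]
    · exact fun j _ hj => h.blockSpan_orthogonal hj (hy j) (mem_blockSpan hk)
    · simp
  rw [← h1, h0]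
  simp

open Classical in
/-- The number of real Jordan blocks with given size, eigenvalue and sign. -/
def realCount {n : ℕ} (β : Fin n → Block) (k : ℕ) (t : ℝ) (ε : ℤˣ) : ℕ :=
  Fintype.card {i : Fin n // β i = .J k t ε}

-- Blocks are mutually orthogonal and invariant, so both the kernel condition and the quadratic form
-- split into the contributions bounded by `IsBlock.index_le`.
open Classical in
theorem IsDecomposition.index_le [FiniteDimensional ℝ V] (hB : ∀ x y, B x y = B y x)
    (hS : ∀ x y, B (S x) y = B x (S y)) (h : IsDecomposition B S β u)
    (hsum : ∑ i, (β i).size = Module.finrank ℝ V) (k : ℕ) (t : ℝ) (ε : ℤˣ) {x : V}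
    (hx : ((S - t • 1) ^ (k + 1)) x = 0) :
    sg ε * B (((S - t • 1) ^ k) x) x ≤
      ∑ i : {i : Fin n // β i = .J k t ε}, B x (u i 0) ^ 2 := by
  obtain ⟨y, hy, rfl⟩ := h.exists_sum hB hsum x
  rw [map_sum] at hx
  have h0 := h.eq_zero_of_sum hB (fun i => (h.1 i).pow_mem_blockSpan t (k + 1) (hy i)) hx
  have h1 : B (((S - t • 1) ^ k) (∑ i, y i)) (∑ i, y i) =
      ∑ i, B (((S - t • 1) ^ k) (y i)) (y i) := by
    rw [map_sum, map_sum]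
    refine Finset.sum_congr rfl fun i _ => ?_
    rw [map_sum, LinearMap.sum_apply, Finset.sum_eq_single i]
    · exact fun j _ hj => h.blockSpan_orthogonal hj ((h.1 j).pow_mem_blockSpan t k (hy j))
        (hy i)
    · simp
  have h2 : ∀ i, B (∑ j, y j) (u i 0) = B (y i) (u i 0) := by
    intro i
    rw [map_sum, LinearMap.sum_apply, Finset.sum_eq_single i]
    · refine fun j _ hj => h.blockSpan_orthogonal hj (hy j) (mem_blockSpan ?_)
      cases β i <;> simp [Block.size]
    · simp
  rw [h1, Finset.mul_sum]
  calc ∑ i, sg ε * B (((S - t • 1) ^ k) (y i)) (y i)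
      ≤ ∑ i, if β i = .J k t ε then B (y i) (u i 0) ^ 2 else 0 :=
        Finset.sum_le_sum fun i _ => (h.1 i).index_le hB hS k t ε (hy i) (h0 i)
    _ = ∑ i : {i : Fin n // β i = .J k t ε}, B (∑ j, y j) (u i 0) ^ 2 := by
        rw [← Finset.sum_filter, Finset.sum_subtype _ (p := fun i => β i = .J k t ε) (by simp)]
        exact Finset.sum_congr rfl fun i _ => by rw [h2]

/-- Sylvester's law of inertia: the form `ε B((S - t) ^ k x, x)` is positive definite on the span of
the last vectors of the matching blocks of one decomposition, while it is at most a sum of as many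
squares as there are matching blocks in the other. -/
theorem IsDecomposition.realCount_le [FiniteDimensional ℝ V] (hB : ∀ x y, B x y = B y x)
    (hS : ∀ x y, B (S x) y = B x (S y)) (h : IsDecomposition B S β u)
    {n' : ℕ} {β' : Fin n' → Block} {u' : Fin n' → ℕ → V} (h' : IsDecomposition B S β' u')
    (hsum' : ∑ i, (β' i).size = Module.finrank ℝ V) (k : ℕ) (t : ℝ) (ε : ℤˣ) :
    realCount β k t ε ≤ realCount β' k t ε := by
  classical
  by_contra! hlt
  unfold realCount at hlt
  set ι := {i : Fin n // β i = .J k t ε}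
  set ι' := {i : Fin n' // β' i = .J k t ε}
  have hb : ∀ i : ι, IsBlock B S (.J k t ε) (u i) := fun i => by
    have hi := h.1 i
    rwa [i.2] at hi
  let L : (ι → ℝ) →ₗ[ℝ] (ι' → ℝ) := LinearMap.pi fun j =>
    ∑ i : ι, (LinearMap.proj i : (ι → ℝ) →ₗ[ℝ] ℝ).smulRight (B (u i k) (u' j 0))
  -- If the other decomposition had fewer matching blocks, some nonzero combination would be
  -- annihilated by all its functionals; the form would then be nonpositive there.
  have hk : LinearMap.ker L ≠ ⊥ := LinearMap.ker_ne_bot_of_finrank_lt (by simpa using hlt)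
  obtain ⟨c, hc, hc0⟩ := (Submodule.ne_bot_iff _).1 hk
  set x : V := ∑ i : ι, c i • u i k with hx
  have hN : ∀ m : ℕ, ((S - t • 1) ^ m) x = ∑ i : ι, c i • ((S - t • 1) ^ m) (u i k) := by
    intro m
    simp [hx, map_sum]
  have h1 : ((S - t • 1) ^ (k + 1)) x = 0 := by
    rw [hN]
    refine Finset.sum_eq_zero fun i _ => ?_
    rw [(hb i).pow_apply_J le_rfl, if_neg (by omega), smul_zero]
  have h2 := h'.index_le hB hS hsum' k t ε h1
  have h3 : ∀ j : ι', B x (u' j 0) = 0 := by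
    intro j
    have := congrFun (LinearMap.mem_ker.1 hc) j
    simpa [L, hx] using this
  have h4 : sg ε * B (((S - t • 1) ^ k) x) x = ∑ i : ι, c i ^ 2 := by
    rw [hN, hx, map_sum, Finset.mul_sum]
    refine Finset.sum_congr rfl fun i _ => ?_
    have h5 : ∀ j : ι, ((S - t • 1) ^ k) (u j k) = u j 0 := fun j => by
      rw [(hb j).pow_apply_J le_rfl, if_pos le_rfl, Nat.sub_self]
    rw [map_sum, LinearMap.sum_apply, Finset.sum_eq_single i]
    · simp only [h5, map_smul, LinearMap.smul_apply, smul_eq_mul]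
      rw [(hb i).1 0 (by omega) k le_rfl, if_pos (by omega)]
      linear_combination (c i ^ 2) * sg_mul_self ε
    · intro j _ hj
      have hij : (j : Fin n) ≠ i := fun hij => hj (Subtype.ext hij)
      rw [h5, map_smul, map_smul, LinearMap.smul_apply, h.2 j i hij 0 (by
        rw [j.2]
        exact Nat.succ_pos k) k (by
        rw [i.2]
        exact Nat.lt_succ_self k)]
      simp
    · simp
  rw [h4] at h2
  simp only [h3, ne_eq, OfNat.ofNat_ne_zero, not_false_eq_true, zero_pow,
    Finset.sum_const_zero] at h2
  refine hc0 (funext fun i => ?_)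
  have h5 := (Finset.sum_eq_zero_iff_of_nonneg fun i _ => sq_nonneg (c i)).1
    (le_antisymm h2 (Finset.sum_nonneg fun i _ => sq_nonneg (c i))) i (Finset.mem_univ i)
  exact pow_eq_zero_iff two_ne_zero |>.1 h5

end Index

/-! ### Parameters of the normal forms are invariants -/

/-- The real Jordan block in a block, given by its size minus one, sign and eigenvalue. -/
def Block.real : Block → Multiset (ℕ × ℤˣ × ℝ)
  | .J k t ε => {(k, ε, t)}
  | _ => 0

theorem realCount_eq_count {n : ℕ} (β : Fin n → Block) (k : ℕ) (t : ℝ) (ε : ℤˣ) :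
    realCount β k t ε = Multiset.count (k, ε, t) (∑ i, (β i).real) := by
  classical
  rw [Multiset.count_sum', realCount, Fintype.card_subtype, Finset.card_filter]
  refine Finset.sum_congr rfl fun i _ => ?_
  cases β i with
  | J k' t' ε' =>
    simp only [Block.real, Multiset.count_singleton, Block.J.injEq, Prod.mk.injEq]
    refine if_congr ?_ rfl rfl
    tauto
  | K1 a b => simp [Block.real]
  | K2 a b => simp [Block.real]

/-- The real Jordan blocks of a type, given by their size minus one, sign and eigenvalue. -/
def realBlocks : (τ : EType) → (Fin τ.numSigns → ℤˣ) → (Fin τ.numParams → ℝ) →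
    Multiset (ℕ × ℤˣ × ℝ)
  | .I, (e : Fin 1 → ℤˣ), (x : Fin 1 → ℝ) => {(3, e 0, x 0)}
  | .II, _, _ => 0
  | .IIIa, _, (x : Fin 2 → ℝ) => {(0, 1, x 0), (2, -1, x 1)}
  | .IIIb, _, (x : Fin 2 → ℝ) => {(2, 1, x 0), (0, -1, x 1)}
  | .IV, (e : Fin 1 → ℤˣ), (x : Fin 3 → ℝ) => {(0, 1, x 0), (1, e 0, x 1), (0, -1, x 2)}
  | .V, _, (x : Fin 4 → ℝ) => {(0, 1, x 0), (0, -1, x 3)}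
  | .VI, (e : Fin 1 → ℤˣ), (x : Fin 3 → ℝ) => {(1, e 0, x 0)}
  | .VII, (e : Fin 2 → ℤˣ), (x : Fin 2 → ℝ) => {(1, e 0, x 0), (1, e 1, x 1)}
  | .VIII, _, _ => 0
  | .IX, _, (x : Fin 4 → ℝ) => {(0, 1, x 0), (0, 1, x 1), (0, -1, x 2), (0, -1, x 3)}

theorem HasMat.exists_columns {S G M : Mat4} (h : HasMat S G M) : ∃ c : ℕ → Fin 4 → ℝ,
    (∀ i j : Fin 4, s22 (c i) (c j) = G i j) ∧
      ∀ j : Fin 4, S *ᵥ c j = ∑ i : Fin 4, M i j • c i := by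
  obtain ⟨P, h1, h2⟩ := h
  have hc : ∀ j : Fin 4, (fun i => P i (Fin.ofNat 4 j)) = P *ᵥ Pi.single j 1 := by
    intro j
    ext i
    simp [Fin.ofNat_eq_cast]
  refine ⟨fun k i => P i (Fin.ofNat 4 k), fun i j => ?_, fun j => ?_⟩
  · change s22 (fun k => P k (Fin.ofNat 4 i)) (fun k => P k (Fin.ofNat 4 j)) = _
    rw [hc, hc, s22_mulVec, h1]
    simp
  · ext i
    have h3 := congrFun (congrFun h2 i) j
    simp only [Matrix.mul_apply] at h3
    simp only [Fin.ofNat_eq_cast, Fin.cast_val_eq_self, Matrix.mulVec, dotProduct,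
      Finset.sum_apply, Pi.smul_apply, smul_eq_mul, h3]
    exact Finset.sum_congr rfl fun _ _ => mul_comm _ _

theorem forall_le_one_iff {P : ℕ → Prop} : (∀ i ≤ 1, P i) ↔ P 0 ∧ P 1 := by
  refine ⟨fun h => ⟨h 0 (by norm_num), h 1 (by norm_num)⟩, ?_⟩
  rintro ⟨h0, h1⟩ i hi
  interval_cases i <;> assumption

theorem forall_le_two_iff {P : ℕ → Prop} : (∀ i ≤ 2, P i) ↔ P 0 ∧ P 1 ∧ P 2 := by
  refine ⟨fun h => ⟨h 0 (by norm_num), h 1 (by norm_num), h 2 (by norm_num)⟩, ?_⟩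
  rintro ⟨h0, h1, h2⟩ i hi
  interval_cases i <;> assumption

theorem forall_le_three_iff {P : ℕ → Prop} : (∀ i ≤ 3, P i) ↔ P 0 ∧ P 1 ∧ P 2 ∧ P 3 := by
  refine ⟨fun h => ⟨h 0 (by norm_num), h 1 (by norm_num), h 2 (by norm_num),
    h 3 (by norm_num)⟩, ?_⟩
  rintro ⟨h0, h1, h2, h3⟩ i hi
  interval_cases i <;> assumption

theorem forall_lt_three_iff {P : ℕ → Prop} : (∀ i < 3, P i) ↔ P 0 ∧ P 1 ∧ P 2 :=
  (forall_congr' fun _ => by rw [Nat.lt_succ_iff]).trans forall_le_two_iff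

theorem sg_one : sg 1 = 1 := by simp

-- Turns an adapted basis back into abstract blocks, so that the invariants computed for
-- decompositions apply to the explicit parameter values.
set_option linter.unusedSimpArgs false in
theorem exists_isDecomposition_of_hasMat {S : Mat4} (τ : EType) (e : Fin τ.numSigns → ℤˣ)
    (x : Fin τ.numParams → ℝ) (hx : Admissible τ x)
    (h : HasMat S (adaptedGram τ e) (jordan τ x)) :
    ∃ (n : ℕ) (β : Fin n → Block) (u : Fin n → ℕ → Fin 4 → ℝ),
      IsDecomposition form (Matrix.toLin' S) β u ∧ ∑ i, (β i).size = 4 ∧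
      ∑ i, (β i).real = realBlocks τ e x := by
  obtain ⟨c, hG, hM⟩ := h.exists_columns
  -- Each block occupies consecutive vectors of the adapted basis; `o i` is the position of its
  -- first vector.
  obtain ⟨n, β, o, h1, h2, h3, h4⟩ : ∃ (n : ℕ) (β : Fin n → Block) (o : Fin n → ℕ),
      (∀ i, IsBlock form (Matrix.toLin' S) (β i) fun k => c (o i + k)) ∧
      (∀ i j, i ≠ j → ∀ k < (β i).size, ∀ l < (β j).size,
        form (c (o i + k)) (c (o j + l)) = 0) ∧ ∑ i, (β i).size = 4 ∧
      ∑ i, (β i).real = realBlocks τ e x := by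
    cases τ
    all_goals
      simp only [Fin.forall_fin_succ, adaptedGram] at hG
      simp [Fin.forall_fin_succ, Fin.sum_univ_four, jordan] at hG hM
    case' I => refine ⟨1, ![.J 3 (x 0) (e 0)], ![0], ?_⟩
    case' II => refine ⟨1, ![.K2 (x 0) (x 1)], ![0], ?_⟩
    case' IIIa => refine ⟨2, ![.J 0 (x 0) 1, .J 2 (x 1) (-1)], ![0, 1], ?_⟩
    case' IIIb => refine ⟨2, ![.J 2 (x 0) 1, .J 0 (x 1) (-1)], ![0, 3], ?_⟩
    case' IV => refine ⟨3, ![.J 0 (x 0) 1, .J 1 (x 1) (e 0), .J 0 (x 2) (-1)], ![0, 1, 3], ?_⟩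
    case' V => refine ⟨3, ![.J 0 (x 0) 1, .K1 (x 1) (x 2), .J 0 (x 3) (-1)], ![0, 1, 3], ?_⟩
    case' VI => refine ⟨2, ![.J 1 (x 0) (e 0), .K1 (x 1) (x 2)], ![0, 2], ?_⟩
    case' VII => refine ⟨2, ![.J 1 (x 0) (e 0), .J 1 (x 1) (e 1)], ![0, 2], ?_⟩
    case' VIII => refine ⟨2, ![.K1 (x 0) (x 1), .K1 (x 2) (x 3)], ![0, 2], ?_⟩
    case' IX => refine ⟨4, ![.J 0 (x 0) 1, .J 0 (x 1) 1, .J 0 (x 2) (-1), .J 0 (x 3) (-1)], ![0, 1, 2, 3], ?_⟩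
    all_goals
      refine ⟨?_, ?_, ?_, ?_⟩
      · simp [Fin.forall_fin_succ, IsBlock, form_apply, forall_le_one_iff, forall_le_two_iff,
          forall_le_three_iff, forall_lt_three_iff, sg_one, hG, hM, sg_neg_one, sub_eq_add_neg,
          add_comm, add_left_comm]
        try exact hx
      · simp [Fin.forall_fin_succ, Block.size, form_apply, forall_le_one_iff, forall_lt_three_iff,
          hG]
      · simp [Fin.sum_univ_succ, Block.size]
      · simp only [Fin.sum_univ_succ, Block.real, realBlocks]
        simp only [Finset.univ_eq_empty, Finset.sum_empty, Matrix.cons_val_zero,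
          Matrix.cons_val_succ, ← Multiset.singleton_add, Multiset.insert_eq_cons, Block.real,
          add_zero]
        try abel
  exact ⟨n, β, fun i k => c (o i + k), ⟨h1, h2⟩, h3, h4⟩

/-- Two decompositions of the same endomorphism bound each other's block counts in both directions,
so the multisets of real blocks agree. -/
theorem realBlocks_eq {S : EndPlus} {τ τ' : EType} (p : Param τ) (q : Param τ')
    (h : HasMat (S : Mat4) (adaptedGram τ p.sign) (jordan τ p.val))
    (h' : HasMat (S : Mat4) (adaptedGram τ' q.sign) (jordan τ' q.val)) :
    realBlocks τ p.sign p.val = realBlocks τ' q.sign q.val := by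
  obtain ⟨n, β, u, h1, h2, h3⟩ := exists_isDecomposition_of_hasMat τ _ _ p.adm h
  obtain ⟨n', β', u', h1', h2', h3'⟩ := exists_isDecomposition_of_hasMat τ' _ _ q.adm h'
  have hB : ∀ x y, form x y = form y x := s22_comm
  have hS : ∀ x y, form (Matrix.toLin' (S : Mat4) x) y = form x (Matrix.toLin' (S : Mat4) y) := by
    intro x y
    simpa only [Matrix.toLin'_apply, form_apply] using S.2 x y
  rw [← h3, ← h3']
  ext ⟨k, ε, t⟩
  rw [← realCount_eq_count, ← realCount_eq_count]
  exact le_antisymm (h1.realCount_le hB hS h1' (by simpa using h2') k t ε)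
    (h1'.realCount_le hB hS h1 (by simpa using h2) k t ε)

/-- A number that determines the sizes, and where necessary the signs, of the real Jordan blocks
of a type. -/
def blockWeight (q : ℕ × ℤˣ × ℝ) : ℕ :=
  if q.1 = 0 then 1 else if q.1 = 1 then 5 else if q.1 = 2 then (if q.2.1 = 1 then 40 else 30)
  else 50

/-- The sum of the weights of the real Jordan blocks of a type. -/
def typeWeight : EType → ℕ
  | .I => 50 | .II => 0 | .IIIa => 31 | .IIIb => 41 | .IV => 7
  | .V => 2 | .VI => 5 | .VII => 10 | .VIII => 0 | .IX => 4

/-- The weights are chosen so that the totals of the types differ, except for II and VIII, which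
have no real blocks. The sign enters only for blocks of size three, where it separates IIIa from
IIIb. -/
theorem sum_blockWeight (τ : EType) (e : Fin τ.numSigns → ℤˣ) (x : Fin τ.numParams → ℝ) :
    ((realBlocks τ e x).map blockWeight).sum = typeWeight τ := by
  cases τ <;> simp [realBlocks, blockWeight, typeWeight]

/-- The parameters of a type describe a block with the eigenvalues `a ± ib`. -/
def HasComplexPair : (τ : EType) → (Fin τ.numParams → ℝ) → ℝ → ℝ → Prop
  | .II, (x : Fin 2 → ℝ), a, b => a = x 0 ∧ |b| = |x 1|
  | .V, (x : Fin 4 → ℝ), a, b => a = x 1 ∧ |b| = |x 2|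
  | .VI, (x : Fin 3 → ℝ), a, b => a = x 1 ∧ |b| = |x 2|
  | .VIII, (x : Fin 4 → ℝ), a, b => (a = x 0 ∧ |b| = |x 1|) ∨ (a = x 2 ∧ |b| = |x 3|)
  | _, _, _, _ => False

theorem quadratic_eq_zero_iff {a b a' b' : ℝ} (hb : b ≠ 0) :
    ((⟨a, b⟩ : ℂ) - a') * ((⟨a, b⟩ : ℂ) - a') + (b' : ℂ) * b' = 0 ↔ a = a' ∧ |b| = |b'| := by
  rw [Complex.ext_iff, abs_eq_iff_mul_self_eq]
  simp only [Complex.add_re, Complex.mul_re, Complex.sub_re, Complex.ofReal_re, Complex.sub_im,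
    Complex.ofReal_im, sub_zero, mul_zero, Complex.zero_re, Complex.add_im, Complex.mul_im,
    zero_mul, add_zero, Complex.zero_im]
  constructor
  · rintro ⟨h1, h2⟩
    have h3 : a = a' := by
      have : (a - a') * b = 0 := by linarith
      rcases mul_eq_zero.1 this with h | h
      · linarith
      · exact absurd h hb
    subst h3
    exact ⟨rfl, by linarith⟩
  · rintro ⟨rfl, h⟩
    exact ⟨by linarith, by ring⟩

theorem linear_ne_zero {a b t : ℝ} (hb : b ≠ 0) : (⟨a, b⟩ : ℂ) - t ≠ 0 := by
  intro h
  exact hb (by simpa using congrArg Complex.im h)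

theorem det_fin_four {R : Type*} [CommRing R] (A : Matrix (Fin 4) (Fin 4) R) : A.det =
    A 0 0 * (A 1 1 * (A 2 2 * A 3 3 - A 2 3 * A 3 2) - A 1 2 * (A 2 1 * A 3 3 - A 2 3 * A 3 1) +
      A 1 3 * (A 2 1 * A 3 2 - A 2 2 * A 3 1)) -
    A 0 1 * (A 1 0 * (A 2 2 * A 3 3 - A 2 3 * A 3 2) - A 1 2 * (A 2 0 * A 3 3 - A 2 3 * A 3 0) +
      A 1 3 * (A 2 0 * A 3 2 - A 2 2 * A 3 0)) +
    A 0 2 * (A 1 0 * (A 2 1 * A 3 3 - A 2 3 * A 3 1) - A 1 1 * (A 2 0 * A 3 3 - A 2 3 * A 3 0) +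
      A 1 3 * (A 2 0 * A 3 1 - A 2 1 * A 3 0)) -
    A 0 3 * (A 1 0 * (A 2 1 * A 3 2 - A 2 2 * A 3 1) - A 1 1 * (A 2 0 * A 3 2 - A 2 2 * A 3 0) +
      A 1 2 * (A 2 0 * A 3 1 - A 2 1 * A 3 0)) := by
  rw [Matrix.det_succ_row_zero, Fin.sum_univ_four]
  simp only [Matrix.det_fin_three, Matrix.submatrix_apply]
  have e1 : (1 : Fin 4).succAbove 0 = 0 := rfl
  have e2 : (1 : Fin 4).succAbove 1 = 2 := rfl
  have e3 : (1 : Fin 4).succAbove 2 = 3 := rfl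
  have e4 : (2 : Fin 4).succAbove 0 = 0 := rfl
  have e5 : (2 : Fin 4).succAbove 1 = 1 := rfl
  have e6 : (2 : Fin 4).succAbove 2 = 3 := rfl
  have e7 : (3 : Fin 4).succAbove 0 = 0 := rfl
  have e8 : (3 : Fin 4).succAbove 1 = 1 := rfl
  have e9 : (3 : Fin 4).succAbove 2 = 2 := rfl
  have s0 : (0 : Fin 3).succ = 1 := rfl
  have s1 : (1 : Fin 3).succ = 2 := rfl
  have s2 : (2 : Fin 3).succ = 3 := rfl
  simp only [Fin.zero_succAbove, e1, e2, e3, e4, e5, e6, e7, e8, e9, s0, s1, s2]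
  simp
  ring

/-- The characteristic polynomial is a product of linear real factors, which do not vanish at a
nonreal number, and of quadratic factors `(z - a')² + b'²`, one for each complex pair. -/
theorem det_jordan_eq_zero_iff (τ : EType) (x : Fin τ.numParams → ℝ) {a b : ℝ} (hb : b ≠ 0) :
    ((⟨a, b⟩ : ℂ) • (1 : Matrix (Fin 4) (Fin 4) ℂ) - (jordan τ x).map Complex.ofReal).det = 0 ↔
      HasComplexPair τ x a b := by
  have hQ : ∀ a' b' : ℝ, (((⟨a, b⟩ : ℂ) - a') * ((⟨a, b⟩ : ℂ) - a') + (b' : ℂ) * b' = 0) ↔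
    a = a' ∧ |b| = |b'| := fun a' b' => quadratic_eq_zero_iff hb
  have hL : ∀ t : ℝ, (⟨a, b⟩ : ℂ) - t ≠ 0 := fun t => linear_ne_zero hb
  generalize (⟨a, b⟩ : ℂ) = z at *
  simp only [det_fin_four, Matrix.sub_apply, Matrix.smul_apply, Matrix.map_apply, smul_eq_mul,
    Matrix.one_apply]
  cases τ <;> simp [jordan, HasComplexPair, ← hQ]
  case I => exact hL _
  case II =>
    rw [show (z - x 0) * ((z - x 0) * ((z - x 0) * (z - x 0) + x 1 * x 1)) +
      x 1 * (x 1 * ((z - x 0) * (z - x 0) + x 1 * x 1)) = ((z - x 0) * (z - x 0) + x 1 * x 1) *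
      ((z - x 0) * (z - x 0) + x 1 * x 1) by ring, mul_self_eq_zero]
  case IIIa => exact ⟨hL _, hL _⟩
  case IIIb => exact ⟨hL _, hL _⟩
  case IV => exact ⟨hL _, hL _, hL _⟩
  case V =>
    rw [show (z - x 1) * ((z - x 1) * (z - x 3)) + x 2 * (x 2 * (z - x 3)) =
      ((z - x 1) * (z - x 1) + x 2 * x 2) * (z - x 3) by ring, mul_eq_zero, or_iff_left (hL _),
      or_iff_right (hL _)]
  case VI => exact fun h => absurd h (hL _)
  case VII => exact ⟨hL _, hL _⟩
  case VIII =>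
    rw [show (z - x 0) * ((z - x 0) * ((z - x 2) * (z - x 2) + x 3 * x 3)) +
      x 1 * (x 1 * ((z - x 2) * (z - x 2) + x 3 * x 3)) = ((z - x 0) * (z - x 0) + x 1 * x 1) *
      ((z - x 2) * (z - x 2) + x 3 * x 3) by ring, mul_eq_zero]
  case IX => exact ⟨hL _, hL _, hL _, hL _⟩

theorem hasComplexPair_iff {S : Mat4} {τ τ' : EType} (p : Param τ) (q : Param τ')
    (h : HasMat S (adaptedGram τ p.sign) (jordan τ p.val))
    (h' : HasMat S (adaptedGram τ' q.sign) (jordan τ' q.val)) {a b : ℝ} (hb : b ≠ 0) :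
    HasComplexPair τ p.val a b ↔ HasComplexPair τ' q.val a b := by
  have key : ∀ {σ : EType} (r : Param σ), HasMat S (adaptedGram σ r.sign) (jordan σ r.val) →
      (((⟨a, b⟩ : ℂ) • (1 : Matrix (Fin 4) (Fin 4) ℂ) - S.map Complex.ofReal).det = 0 ↔
        HasComplexPair σ r.val a b) := by
    intro σ r ⟨P, h1, h2⟩
    have hP : IsUnit P.det := isUnit_det_of_gram (isUnit_det_adaptedGram _ _) h1
    have hP' : (P.map Complex.ofReal).det ≠ 0 := by
      have e1 : (P.map Complex.ofReal).det = (P.det : ℂ) := (Complex.ofRealHom.map_det P).symm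
      rw [e1]
      exact_mod_cast hP.ne_zero
    have h3 : S.map Complex.ofReal * P.map Complex.ofReal =
        P.map Complex.ofReal * (jordan σ r.val).map Complex.ofReal := by
      have := congrArg (fun A : Mat4 => A.map Complex.ofRealHom) h2
      simp only [Matrix.map_mul] at this
      exact this
    rw [← det_jordan_eq_zero_iff σ r.val hb, ← mul_eq_zero_iff_right hP', ← Matrix.det_mul,
      Matrix.sub_mul, h3, Matrix.smul_mul, Matrix.one_mul]
    nth_rewrite 1 [← Matrix.mul_one (P.map Complex.ofReal)]
    rw [← Matrix.mul_smul, ← Matrix.mul_sub, Matrix.det_mul, mul_eq_zero, or_iff_right hP']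
  rw [← key p h, key q h']

theorem type_eq_or {S : EndPlus} {τ τ' : EType} (p : Param τ) (q : Param τ')
    (h : HasMat (S : Mat4) (adaptedGram τ p.sign) (jordan τ p.val))
    (h' : HasMat (S : Mat4) (adaptedGram τ' q.sign) (jordan τ' q.val)) :
    τ = τ' ∨ (τ = .II ∧ τ' = .VIII) ∨ (τ = .VIII ∧ τ' = .II) := by
  have h1 := congrArg (fun m => (m.map blockWeight).sum) (realBlocks_eq p q h h')
  simp only [sum_blockWeight] at h1
  revert h1
  clear h h' p q
  cases τ <;> cases τ' <;> simp [typeWeight]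

/-- Equality of the complex eigenvalues forces both summands of type VIII to carry the pair of type
II. Then the corresponding real quadratic polynomial annihilates the diagonalizable form VIII but
not the form II. -/
theorem not_hasMat_II_VIII {S : Mat4} (p : Param .II) (q : Param .VIII)
    (h : HasMat S (adaptedGram .II p.sign) (jordan .II p.val)) :
    ¬ HasMat S (adaptedGram .VIII q.sign) (jordan .VIII q.val) := by
  intro h'
  have e1 := (hasComplexPair_iff p q h h' q.adm.1).2 (Or.inl ⟨rfl, rfl⟩)
  have e2 := (hasComplexPair_iff p q h h' q.adm.2).2 (Or.inr ⟨rfl, rfl⟩)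
  obtain ⟨P, h1, h2⟩ := h
  obtain ⟨P', h1', h2'⟩ := h'
  have hP : IsUnit P.det := isUnit_det_of_gram (isUnit_det_adaptedGram _ _) h1
  have hP' : IsUnit P'.det := isUnit_det_of_gram (isUnit_det_adaptedGram _ _) h1'
  obtain ⟨e, x, hx⟩ := p
  obtain ⟨f, y, hy⟩ := q
  simp only [HasComplexPair, abs_eq_iff_mul_self_eq] at e1 e2
  set Q : Mat4 → Mat4 := fun A => A * A - (2 * x 0) • A + (x 0 * x 0 + x 1 * x 1) • 1 with hQ
  have hmul : ∀ {R M : Mat4}, S * R = R * M → Q S * R = R * Q M := by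
    intro R M hR
    have h3 : S * S * R = R * (M * M) := by
      rw [mul_assoc, hR, ← mul_assoc, hR, mul_assoc]
    simp only [hQ, Matrix.add_mul, Matrix.sub_mul, Matrix.mul_add, Matrix.mul_sub, h3,
      Matrix.smul_mul, Matrix.mul_smul, hR, Matrix.one_mul, Matrix.mul_one]
  have hJ : Q (jordan .VIII y) = 0 := by
    ext i j
    have a1 := e1.1
    have a2 := e1.2
    have a3 := e2.1
    have a4 := e2.2
    fin_cases i <;> fin_cases j <;> simp [hQ, jordan]
    all_goals
      simp only [a1, a3]
      linarith
  have hS : Q S = 0 := by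
    have h3 := hmul h2'
    rw [hJ, Matrix.mul_zero] at h3
    have h4 := congrArg (· * P'⁻¹) h3
    simpa [mul_assoc, Matrix.mul_nonsing_inv _ hP'] using h4
  have h3 := hmul h2
  rw [hS, Matrix.zero_mul] at h3
  have h4 : Q (jordan .II x) = 0 := by
    have h5 := congrArg (P⁻¹ * ·) h3
    simpa [← mul_assoc, Matrix.nonsing_inv_mul _ hP] using h5.symm
  -- Above the diagonal the quadratic polynomial of `K_2(a, b)` is twice the skew part of its
  -- diagonal block, so this entry is `2 * b`.
  have h5 := congrFun (congrFun h4 0) 3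
  simp [hQ, jordan] at h5
  exact hx (by linarith)

theorem type_unique {S : EndPlus} {τ τ' : EType} (p : Param τ) (q : Param τ')
    (h : HasMat (S : Mat4) (adaptedGram τ p.sign) (jordan τ p.val))
    (h' : HasMat (S : Mat4) (adaptedGram τ' q.sign) (jordan τ' q.val)) : τ = τ' := by
  rcases type_eq_or p q h h' with h0 | ⟨rfl, rfl⟩ | ⟨rfl, rfl⟩
  · exact h0
  · exact absurd h' (not_hasMat_II_VIII p q h)
  · exact absurd h (not_hasMat_II_VIII q p h')

theorem Multiset.pair_eq_pair_iff {α : Type*} {a b c d : α} :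
    ({a, b} : Multiset α) = {c, d} ↔ (a = c ∧ b = d) ∨ (a = d ∧ b = c) := by
  constructor
  · intro h
    have ha : a ∈ ({c, d} : Multiset α) := by
      rw [← h]
      simp
    rcases (by simpa using ha : a = c ∨ a = d) with rfl | rfl
    · left
      simpa [Multiset.insert_eq_cons] using h
    · right
      rw [Multiset.pair_comm c] at h
      simpa [Multiset.insert_eq_cons] using h
  · rintro (⟨rfl, rfl⟩ | ⟨rfl, rfl⟩)
    · rfl
    · exact Multiset.pair_comm _ _

/-- Filtering the multiset of real blocks by size or sign isolates each real parameter; only for VII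
and IX can two blocks be exchanged. The complex pairs are compared through their roots. -/
theorem sameData_of_hasMat {S : EndPlus} {τ : EType} (p q : Param τ)
    (h : HasMat (S : Mat4) (adaptedGram τ p.sign) (jordan τ p.val))
    (h' : HasMat (S : Mat4) (adaptedGram τ q.sign) (jordan τ q.val)) : SameData τ p q := by
  have hr := realBlocks_eq p q h h'
  have hc : ∀ {a b : ℝ}, b ≠ 0 → (HasComplexPair τ p.val a b ↔ HasComplexPair τ q.val a b) :=
    hasComplexPair_iff p q h h'
  clear h h'
  obtain ⟨e, x, hx⟩ := p
  obtain ⟨f, y, hy⟩ := q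
  have hk := fun (P : ℕ × ℤˣ × ℝ → Prop) [DecidablePred P] => congrArg (Multiset.filter P) hr
  cases τ
  case I =>
    simp [realBlocks] at hr
    obtain ⟨h1, h2⟩ := hr
    simp only [SameData, Param.mk.injEq, funext_iff, Fin.forall_fin_one]
    exact ⟨h1, h2⟩
  case IIIa =>
    have h1 := hk (fun r => r.1 = 0)
    have h2 := hk (fun r => r.1 = 2)
    simp [realBlocks, Multiset.filter_singleton] at h1 h2
    simp only [SameData, Param.mk.injEq, funext_iff, Fin.forall_fin_two]
    exact ⟨fun i => i.elim0, h1, h2⟩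
  case IIIb =>
    have h1 := hk (fun r => r.1 = 0)
    have h2 := hk (fun r => r.1 = 2)
    simp [realBlocks, Multiset.filter_singleton] at h1 h2
    simp only [SameData, Param.mk.injEq, funext_iff, Fin.forall_fin_two]
    exact ⟨fun i => i.elim0, h2, h1⟩
  case IV =>
    have h1 := hk (fun r => r.1 = 1)
    have h2 := hk (fun r => r.1 = 0 ∧ r.2.1 = 1)
    have h3 := hk (fun r => r.1 = 0 ∧ r.2.1 = -1)
    simp [realBlocks, Multiset.filter_singleton] at h1 h2 h3
    simp only [SameData, Param.mk.injEq, funext_iff, Fin.forall_fin_one]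
    refine ⟨h1.1, fun i => ?_⟩
    fin_cases i
    exacts [h2, h1.2, h3]
  case II => exact (hc hx).1 ⟨rfl, rfl⟩
  case V =>
    have h1 := hk (fun r => r.2.1 = 1)
    have h2 := hk (fun r => r.2.1 = -1)
    simp [realBlocks, Multiset.filter_singleton] at h1 h2
    have h3 := (hc hx).1 ⟨rfl, rfl⟩
    exact ⟨h1, h3.1, h3.2, h2⟩
  case VI =>
    simp [realBlocks] at hr
    exact ⟨hr.1, hr.2, (hc hx).1 ⟨rfl, rfl⟩⟩
  case VII =>
    simp only [realBlocks, Multiset.pair_eq_pair_iff, Prod.mk.injEq, true_and] at hr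
    exact hr
  case VIII =>
    -- Roots are compared in both directions: one direction alone would not exclude that both pairs
    -- on one side match the same pair on the other.
    have h1 := (hc hx.1).1 (Or.inl ⟨rfl, rfl⟩)
    have h2 := (hc hx.2).1 (Or.inr ⟨rfl, rfl⟩)
    have h3 := (hc hy.1).2 (Or.inl ⟨rfl, rfl⟩)
    have h4 := (hc hy.2).2 (Or.inr ⟨rfl, rfl⟩)
    simp only [SameData]
    simp only [HasComplexPair] at h1 h2 h3 h4
    clear hc hr hk
    generalize |x 1| = b1, |x 3| = b2, |y 1| = c1, |y 3| = c2 at *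
    generalize x 0 = a1, x 2 = a2, y 0 = d1, y 2 = d2 at *
    grind
  case IX =>
    have h1 := congrArg (Multiset.map fun r => r.2.2) (hk (fun r => r.2.1 = 1))
    have h2 := congrArg (Multiset.map fun r => r.2.2) (hk (fun r => r.2.1 = -1))
    simp [realBlocks, Multiset.filter_singleton] at h1 h2
    exact ⟨Multiset.pair_eq_pair_iff.1 h1, Multiset.pair_eq_pair_iff.1 h2⟩

theorem existsUnique_type (S : EndPlus) : ∃! τ : EType, MulAction.orbit O22 S ⊆ ofType τ := by
  obtain ⟨τ, p, hp⟩ := exists_hasType S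
  have hmem : S ∈ ofType τ := (mem_ofType_iff _ _).2 ⟨p, hp⟩
  rw [ofType_eq_iUnion_orbit, mem_iUnion] at hmem
  obtain ⟨r, hr⟩ := hmem
  refine ⟨τ, ?_, fun τ' h => ?_⟩
  · dsimp only
    rw [ofType_eq_iUnion_orbit, MulAction.orbit_eq_iff.2 hr]
    exact subset_iUnion (fun p : Param τ => MulAction.orbit O22 p.T) r
  · obtain ⟨q, hq⟩ := (mem_ofType_iff _ _).1 (h (MulAction.mem_orbit_self S))
    exact type_unique q p hq hp

theorem disjoint_orbit_of_not_sameData {τ : EType} {p q : Param τ} (h : ¬ SameData τ p q) :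
    Disjoint (MulAction.orbit O22 p.T) (MulAction.orbit O22 q.T) := by
  rw [Set.disjoint_left]
  intro S h1 h2
  exact h (sameData_of_hasMat p q ((mem_orbit_T_iff_adapted _ _).1 h1)
    ((mem_orbit_T_iff_adapted _ _).1 h2))

/-! ### Commutants at generic parameter values -/

/-- The diagonals that are constant on the blocks of a type. -/
def IsBlockConstant : EType → (Fin 4 → ℝ) → Prop
  | .I, d | .II, d => d 1 = d 0 ∧ d 2 = d 0 ∧ d 3 = d 0
  | .IIIa, d => d 2 = d 1 ∧ d 3 = d 1
  | .IIIb, d => d 1 = d 0 ∧ d 2 = d 0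
  | .IV, d | .V, d => d 2 = d 1
  | .VI, d | .VII, d | .VIII, d => d 1 = d 0 ∧ d 3 = d 2
  | .IX, _ => True

theorem sq_add_sq_eq_zero_imp {u v : ℝ} (h : u ^ 2 + v ^ 2 = 0) : u = 0 ∧ v = 0 :=
  ⟨by nlinarith [sq_nonneg u, sq_nonneg v], by nlinarith [sq_nonneg u, sq_nonneg v]⟩

/-- Commuting with a single Jordan block leaves upper triangular Toeplitz matrices, the polynomials
in the block. The lemmas for the other types solve the same linear equations; without coincidences
the entries that couple different blocks vanish. -/
theorem commute_jordan_I {x : Fin (EType.numParams .I) → ℝ} {A : Mat4} (h : A * jordan .I x = jordan .I x * A) :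
    A 1 0 = 0 ∧ A 2 0 = 0 ∧ A 3 0 = 0 ∧ A 2 1 = 0 ∧ A 3 1 = 0 ∧ A 3 2 = 0 ∧ A 1 1 = A 0 0 ∧ A 2 2 = A 0 0 ∧ A 3 3 = A 0 0 ∧ A 1 2 = A 0 1 ∧ A 2 3 = A 0 1 ∧ A 1 3 = A 0 2 := by
  have h2 : ∀ i j, (A * jordan .I x) i j = (jordan .I x * A) i j := fun i j => by rw [h]
  clear h
  simp [Fin.forall_fin_succ, Matrix.mul_apply, Fin.sum_univ_four, jordan]
    at h2
  grind

theorem commute_jordan_II {x : Fin (EType.numParams .II) → ℝ} {A : Mat4} (hx : Admissible .II x)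
    (h : A * jordan .II x = jordan .II x * A) :
    A 2 0 = 0 ∧ A 3 0 = 0 ∧ A 2 1 = 0 ∧ A 3 1 = 0 ∧ A 1 1 = A 0 0 ∧ A 2 2 = A 0 0 ∧ A 3 3 = A 0 0 ∧ A 1 0 = -A 0 1 ∧ A 2 3 = A 0 1 ∧ A 3 2 = -A 0 1 ∧ A 1 3 = A 0 2 ∧ A 1 2 = - A 0 3 := by
  have h2 : ∀ i j, (A * jordan .II x) i j = (jordan .II x * A) i j := fun i j => by rw [h]
  clear h
  simp [Fin.forall_fin_succ, Matrix.mul_apply, Fin.sum_univ_four, jordan, Admissible]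
    at h2 hx
  grind

theorem commute_jordan_IIIa {x : Fin (EType.numParams .IIIa) → ℝ} {A : Mat4} (hn : NoCoincidence .IIIa x) (h : A * jordan .IIIa x = jordan .IIIa x * A) :
    A 0 1 = 0 ∧ A 0 2 = 0 ∧ A 0 3 = 0 ∧ A 1 0 = 0 ∧ A 2 0 = 0 ∧ A 3 0 = 0 ∧ A 2 1 = 0 ∧ A 3 1 = 0 ∧ A 3 2 = 0 ∧ A 2 2 = A 1 1 ∧ A 3 3 = A 1 1 ∧ A 2 3 = A 1 2 := by
  have h2 : ∀ i j, (A * jordan .IIIa x) i j = (jordan .IIIa x * A) i j := fun i j => by rw [h]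
  clear h
  simp [Fin.forall_fin_succ, Matrix.mul_apply, Fin.sum_univ_four, jordan, NoCoincidence]
    at h2 hn
  grind

theorem commute_jordan_IIIb {x : Fin (EType.numParams .IIIb) → ℝ} {A : Mat4} (hn : NoCoincidence .IIIb x) (h : A * jordan .IIIb x = jordan .IIIb x * A) :
    A 0 3 = 0 ∧ A 1 3 = 0 ∧ A 2 3 = 0 ∧ A 3 0 = 0 ∧ A 3 1 = 0 ∧ A 3 2 = 0 ∧ A 1 0 = 0 ∧ A 2 0 = 0 ∧ A 2 1 = 0 ∧ A 1 1 = A 0 0 ∧ A 2 2 = A 0 0 ∧ A 1 2 = A 0 1 := by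
  have h2 : ∀ i j, (A * jordan .IIIb x) i j = (jordan .IIIb x * A) i j := fun i j => by rw [h]
  clear h
  simp [Fin.forall_fin_succ, Matrix.mul_apply, Fin.sum_univ_four, jordan, NoCoincidence]
    at h2 hn
  grind

theorem commute_jordan_IV {x : Fin (EType.numParams .IV) → ℝ} {A : Mat4} (hn : NoCoincidence .IV x) (h : A * jordan .IV x = jordan .IV x * A) :
    A 0 1 = 0 ∧ A 0 2 = 0 ∧ A 0 3 = 0 ∧ A 1 0 = 0 ∧ A 2 0 = 0 ∧ A 3 0 = 0 ∧ A 1 3 = 0 ∧ A 2 3 = 0 ∧ A 3 1 = 0 ∧ A 3 2 = 0 ∧ A 2 1 = 0 ∧ A 2 2 = A 1 1 := by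
  have h2 : ∀ i j, (A * jordan .IV x) i j = (jordan .IV x * A) i j := fun i j => by rw [h]
  clear h
  simp [Fin.forall_fin_succ, Matrix.mul_apply, Fin.sum_univ_four, jordan, NoCoincidence]
    at h2 hn
  grind

theorem commute_jordan_V {x : Fin (EType.numParams .V) → ℝ} {A : Mat4} (hx : Admissible .V x)
    (hn : NoCoincidence .V x) (h : A * jordan .V x = jordan .V x * A) :
    A 0 1 = 0 ∧ A 0 2 = 0 ∧ A 0 3 = 0 ∧ A 1 0 = 0 ∧ A 2 0 = 0 ∧ A 3 0 = 0 ∧ A 1 3 = 0 ∧ A 2 3 = 0 ∧ A 3 1 = 0 ∧ A 3 2 = 0 ∧ A 2 1 = - A 1 2 ∧ A 2 2 = A 1 1 := by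
  have h2 : ∀ i j, (A * jordan .V x) i j = (jordan .V x * A) i j := fun i j => by rw [h]
  clear h
  simp [Fin.forall_fin_succ, Matrix.mul_apply, Fin.sum_univ_four, jordan, Admissible, NoCoincidence]
    at h2 hx hn
  -- These are the determinants of the equations that couple a real line with the complex block.
  have k1 : (x 0 - x 1) ^ 2 + x 2 ^ 2 ≠ 0 := by positivity
  have k2 : (x 3 - x 1) ^ 2 + x 2 ^ 2 ≠ 0 := by positivity
  grind

theorem commute_jordan_VI {x : Fin (EType.numParams .VI) → ℝ} {A : Mat4} (hx : Admissible .VI x)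
    (h : A * jordan .VI x = jordan .VI x * A) :
    A 0 2 = 0 ∧ A 0 3 = 0 ∧ A 1 2 = 0 ∧ A 1 3 = 0 ∧ A 2 0 = 0 ∧ A 2 1 = 0 ∧ A 3 0 = 0 ∧ A 3 1 = 0 ∧ A 1 0 = 0 ∧ A 1 1 = A 0 0 ∧ A 3 2 = - A 2 3 ∧ A 3 3 = A 2 2 := by
  have h2 : ∀ i j, (A * jordan .VI x) i j = (jordan .VI x * A) i j := fun i j => by rw [h]
  clear h
  simp [Fin.forall_fin_succ, Matrix.mul_apply, Fin.sum_univ_four, jordan, Admissible]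
    at h2 hx
  have k1 : (x 0 - x 1) ^ 2 + x 2 ^ 2 ≠ 0 := by positivity
  grind

theorem commute_jordan_VII {x : Fin (EType.numParams .VII) → ℝ} {A : Mat4} (hn : NoCoincidence .VII x) (h : A * jordan .VII x = jordan .VII x * A) :
    A 0 2 = 0 ∧ A 0 3 = 0 ∧ A 1 2 = 0 ∧ A 1 3 = 0 ∧ A 2 0 = 0 ∧ A 2 1 = 0 ∧ A 3 0 = 0 ∧ A 3 1 = 0 ∧ A 1 0 = 0 ∧ A 1 1 = A 0 0 ∧ A 3 2 = 0 ∧ A 3 3 = A 2 2 := by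
  have h2 : ∀ i j, (A * jordan .VII x) i j = (jordan .VII x * A) i j := fun i j => by rw [h]
  clear h
  simp [Fin.forall_fin_succ, Matrix.mul_apply, Fin.sum_univ_four, jordan, NoCoincidence]
    at h2 hn
  grind

theorem commute_jordan_VIII {x : Fin (EType.numParams .VIII) → ℝ} {A : Mat4} (hx : Admissible .VIII x)
    (hn : NoCoincidence .VIII x) (h : A * jordan .VIII x = jordan .VIII x * A) :
    A 0 2 = 0 ∧ A 0 3 = 0 ∧ A 1 2 = 0 ∧ A 1 3 = 0 ∧ A 2 0 = 0 ∧ A 2 1 = 0 ∧ A 3 0 = 0 ∧ A 3 1 = 0 ∧ A 1 0 = -A 0 1 ∧ A 1 1 = A 0 0 ∧ A 3 2 = - A 2 3 ∧ A 3 3 = A 2 2 := by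
  have h2 : ∀ i j, (A * jordan .VIII x) i j = (jordan .VIII x * A) i j := fun i j => by rw [h]
  clear h
  simp [Fin.forall_fin_succ, Matrix.mul_apply, Fin.sum_univ_four, jordan, Admissible, NoCoincidence]
    at h2 hx hn
  -- The equations coupling two complex blocks have as determinant the product of the differences of
  -- their eigenvalues, grouped into the two sums of squares `k1` and `k2`.
  have k0 : x 0 - x 2 = 0 → x 1 ^ 2 ≠ x 3 ^ 2 := fun h h' =>
    hn (sub_eq_zero.1 h) ((sq_eq_sq_iff_abs_eq_abs _ _).1 h')
  have sq0 : ∀ {u v : ℝ}, u ^ 2 + v ^ 2 = 0 → u = 0 ∧ v = 0 := sq_add_sq_eq_zero_imp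
  have k1 : (x 0 - x 2) ^ 2 + (x 1 - x 3) ^ 2 ≠ 0 := fun h =>
    k0 (sq0 h).1 (by rw [sub_eq_zero.1 (sq0 h).2])
  have k2 : (x 0 - x 2) ^ 2 + (x 1 + x 3) ^ 2 ≠ 0 := fun h =>
    k0 (sq0 h).1 (by rw [eq_neg_of_add_eq_zero_left (sq0 h).2, neg_sq])
  clear sq0
  grind

theorem commute_jordan_IX {x : Fin (EType.numParams .IX) → ℝ} {A : Mat4} (hn : NoCoincidence .IX x) (h : A * jordan .IX x = jordan .IX x * A) :
    A 0 1 = 0 ∧ A 0 2 = 0 ∧ A 0 3 = 0 ∧ A 1 0 = 0 ∧ A 1 2 = 0 ∧ A 1 3 = 0 ∧ A 2 0 = 0 ∧ A 2 1 = 0 ∧ A 2 3 = 0 ∧ A 3 0 = 0 ∧ A 3 1 = 0 ∧ A 3 2 = 0 := by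
  have h2 : ∀ i j, (A * jordan .IX x) i j = (jordan .IX x * A) i j := fun i j => by rw [h]
  clear h
  simp [Fin.forall_fin_succ, Matrix.mul_apply, Fin.sum_univ_four, jordan, NoCoincidence]
    at h2 hn
  have k0 : ∀ i j, i ≠ j → x i ≠ x j := fun i j hij h => hij (hn h)
  have k1 := k0 0 1 (by decide)
  have k2 := k0 0 2 (by decide)
  have k3 := k0 0 3 (by decide)
  have k4 := k0 1 2 (by decide)
  have k5 := k0 1 3 (by decide)
  have k6 := k0 2 3 (by decide)
  clear k0 hn
  grind

theorem ne_zero_of_mul_sg_mul {a : ℝ} {e : ℤˣ} (h : a * sg e * a = sg e) : a ≠ 0 := by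
  rintro rfl
  have := sg_mul_self e
  rw [← h] at this
  simp at this

theorem eq_zero_of_mul_sg_mul {a b : ℝ} {e : ℤˣ} (h : a * sg e * a = sg e)
    (h' : a * sg e * b + b * sg e * a = 0) : b = 0 := by
  have h1 : sg e ≠ 0 := fun h0 => by simpa [h0] using sg_mul_self e
  have h2 : (2 * (a * sg e)) * b = 0 := by linear_combination h'
  exact (mul_eq_zero.1 h2).resolve_left
    (mul_ne_zero two_ne_zero (mul_ne_zero (ne_zero_of_mul_sg_mul h) h1))

/-- The hypotheses say that `(a + ib)² = 1`, and the square roots of one are real. -/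
theorem eq_zero_of_sq_sub_sq {a b : ℝ} (h : a * a + -(b * b) = 1) (h' : a * b + b * a = 0) :
    b = 0 := by
  have h2 : a * b = 0 := by linarith
  rcases mul_eq_zero.1 h2 with h3 | h3
  · rw [h3] at h
    nlinarith
  · exact h3

/-- On each block an element of the commutant is a truncated polynomial in the nilpotent part, with
real or complex coefficients, and is self-adjoint. Being an isometry, it squares to one; its
constant term is then a sign and its higher terms vanish in turn. -/
theorem commute_jordan_diag (τ : EType) (e : Fin τ.numSigns → ℤˣ) {x : Fin τ.numParams → ℝ}
    {A : Mat4} (hx : Admissible τ x) (hn : NoCoincidence τ x)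
    (h : A * jordan τ x = jordan τ x * A) (hA : Aᵀ * adaptedGram τ e * A = adaptedGram τ e) :
    (∀ i j, i ≠ j → A i j = 0) ∧ IsBlockConstant τ fun i => A i i := by
  have h3 : ∀ i j, (Aᵀ * adaptedGram τ e * A) i j = adaptedGram τ e i j := fun i j => by rw [hA]
  cases τ
  case I =>
    obtain ⟨a0, a1, a2, a3, a4, a5, a6, a7, a8, a9, a10, a11⟩ := commute_jordan_I h
    clear h hA
    simp [Fin.forall_fin_succ, Matrix.mul_apply, Fin.sum_univ_four, IsBlockConstant, adaptedGram, a0, a1, a2, a3, a4, a5, a6, a7, a8, a9, a10, a11] at h3 ⊢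
    obtain ⟨-, -, ⟨h1, h2, h4⟩, -, -, -, h5⟩ := h3
    have b1 := eq_zero_of_mul_sg_mul h1 h2
    rw [b1] at h4 h5
    have b2 : A 0 2 = 0 := eq_zero_of_mul_sg_mul h1 (by linarith)
    have b3 : A 0 3 = 0 := eq_zero_of_mul_sg_mul h1 (by rw [b2] at h5; linarith)
    simp [b1, b2, b3]
  case II =>
    obtain ⟨a0, a1, a2, a3, a4, a5, a6, a7, a8, a9, a10, a11⟩ := commute_jordan_II hx h
    clear h hA
    simp [Fin.forall_fin_succ, Matrix.mul_apply, Fin.sum_univ_four, IsBlockConstant, adaptedGram, a0, a1, a2, a3, a4, a5, a6, a7, a8, a9, a10, a11] at h3 ⊢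
    obtain ⟨-, -, ⟨h1, h2, h4, h5⟩, -⟩ := h3
    have b1 := eq_zero_of_sq_sub_sq h1 h2
    rw [b1] at h1 h4 h5
    have h6 : A 0 0 ≠ 0 := by
      rintro h6
      simp [h6] at h1
    have b2 : A 0 2 = 0 := mul_left_cancel₀ h6 (by linarith)
    have b3 : A 0 3 = 0 := mul_left_cancel₀ h6 (by linarith)
    simp [b1, b2, b3]
  case IIIa =>
    obtain ⟨a0, a1, a2, a3, a4, a5, a6, a7, a8, a9, a10, a11⟩ := commute_jordan_IIIa hn h
    clear h hA
    simp [Fin.forall_fin_succ, Matrix.mul_apply, Fin.sum_univ_four, IsBlockConstant, adaptedGram, a0, a1, a2, a3, a4, a5, a6, a7, a8, a9, a10, a11] at h3 ⊢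
    grind
  case IIIb =>
    obtain ⟨a0, a1, a2, a3, a4, a5, a6, a7, a8, a9, a10, a11⟩ := commute_jordan_IIIb hn h
    clear h hA
    simp [Fin.forall_fin_succ, Matrix.mul_apply, Fin.sum_univ_four, IsBlockConstant, adaptedGram, a0, a1, a2, a3, a4, a5, a6, a7, a8, a9, a10, a11] at h3 ⊢
    grind
  case IV =>
    obtain ⟨a0, a1, a2, a3, a4, a5, a6, a7, a8, a9, a10, a11⟩ := commute_jordan_IV hn h
    clear h hA
    simp [Fin.forall_fin_succ, Matrix.mul_apply, Fin.sum_univ_four, IsBlockConstant, adaptedGram, a0, a1, a2, a3, a4, a5, a6, a7, a8, a9, a10, a11] at h3 ⊢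
    exact eq_zero_of_mul_sg_mul h3.2.1 h3.2.2.1.2
  case V =>
    obtain ⟨a0, a1, a2, a3, a4, a5, a6, a7, a8, a9, a10, a11⟩ := commute_jordan_V hx hn h
    clear h hA
    simp [Fin.forall_fin_succ, Matrix.mul_apply, Fin.sum_univ_four, IsBlockConstant, adaptedGram, a0, a1, a2, a3, a4, a5, a6, a7, a8, a9, a10, a11] at h3 ⊢
    exact eq_zero_of_sq_sub_sq h3.2.1.1 h3.2.1.2
  case VI =>
    obtain ⟨a0, a1, a2, a3, a4, a5, a6, a7, a8, a9, a10, a11⟩ := commute_jordan_VI hx h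
    clear h hA
    simp [Fin.forall_fin_succ, Matrix.mul_apply, Fin.sum_univ_four, IsBlockConstant, adaptedGram, a0, a1, a2, a3, a4, a5, a6, a7, a8, a9, a10, a11] at h3 ⊢
    exact ⟨eq_zero_of_mul_sg_mul h3.1 h3.2.1.2, eq_zero_of_sq_sub_sq h3.2.2.1.1 h3.2.2.1.2⟩
  case VII =>
    obtain ⟨a0, a1, a2, a3, a4, a5, a6, a7, a8, a9, a10, a11⟩ := commute_jordan_VII hn h
    clear h hA
    simp [Fin.forall_fin_succ, Matrix.mul_apply, Fin.sum_univ_four, IsBlockConstant, adaptedGram, a0, a1, a2, a3, a4, a5, a6, a7, a8, a9, a10, a11] at h3 ⊢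
    exact ⟨eq_zero_of_mul_sg_mul h3.1 h3.2.1.2, eq_zero_of_mul_sg_mul h3.2.2.1 h3.2.2.2⟩
  case VIII =>
    obtain ⟨a0, a1, a2, a3, a4, a5, a6, a7, a8, a9, a10, a11⟩ := commute_jordan_VIII hx hn h
    clear h hA
    simp [Fin.forall_fin_succ, Matrix.mul_apply, Fin.sum_univ_four, IsBlockConstant, adaptedGram, a0, a1, a2, a3, a4, a5, a6, a7, a8, a9, a10, a11] at h3 ⊢
    exact ⟨eq_zero_of_sq_sub_sq h3.1.1 h3.1.2, eq_zero_of_sq_sub_sq h3.2.2.1.1 h3.2.2.1.2⟩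
  case IX =>
    obtain ⟨a0, a1, a2, a3, a4, a5, a6, a7, a8, a9, a10, a11⟩ := commute_jordan_IX hn h
    clear h hA
    simp [Fin.forall_fin_succ, Matrix.mul_apply, Fin.sum_univ_four, IsBlockConstant, adaptedGram, a0, a1, a2, a3, a4, a5, a6, a7, a8, a9, a10, a11] at h3 ⊢

theorem diagonal_commute_jordan (τ : EType) (x : Fin τ.numParams → ℝ) {d : Fin 4 → ℝ}
    (hd : IsBlockConstant τ d) : diagonal d * jordan τ x = jordan τ x * diagonal d := by
  ext i j
  rw [Matrix.diagonal_mul, Matrix.mul_diagonal]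
  cases τ <;> simp only [IsBlockConstant] at hd <;> fin_cases i <;> fin_cases j <;>
    simp [jordan, hd, mul_comm]

/-- The order in which the vectors of an adapted basis enter the pseudo-orthonormal basis. -/
def blockOrder : EType → Fin 4 → Fin 4
  | .VI => ![0, 2, 3, 0]
  | .VII => ![0, 2, 0, 2]
  | .VIII => ![0, 2, 1, 3]
  | .IIIb => ![0, 1, 2, 3]
  | _ => id

theorem diagonal_mul_adaptedToPsi (τ : EType) (e : Fin τ.numSigns → ℤˣ) {d : Fin 4 → ℝ}
    (hd : IsBlockConstant τ d) :
    diagonal d * adaptedToPsi τ e = adaptedToPsi τ e * diagonal (d ∘ blockOrder τ) := by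
  ext i j
  rw [Matrix.diagonal_mul, Matrix.mul_diagonal]
  cases τ <;> simp only [IsBlockConstant] at hd <;> fin_cases i <;> fin_cases j <;>
    simp [adaptedToPsi, hd, mul_comm, blockOrder]

theorem diagonal_commute_normalForm (τ : EType) (e : Fin τ.numSigns → ℤˣ)
    (x : Fin τ.numParams → ℝ) {d : Fin 4 → ℝ} (hd : IsBlockConstant τ d) :
    diagonal (d ∘ blockOrder τ) * normalForm τ e x =
      normalForm τ e x * diagonal (d ∘ blockOrder τ) := by
  have hu := (Matrix.isUnit_iff_isUnit_det _).2 (isUnit_det_adaptedToPsi τ e)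
  refine hu.mul_left_cancel ?_
  rw [← mul_assoc, ← diagonal_mul_adaptedToPsi τ e hd, mul_assoc, ← jordan_mul_adaptedToPsi,
    ← mul_assoc, diagonal_commute_jordan τ x hd, ← mul_assoc, ← jordan_mul_adaptedToPsi,
    mul_assoc, mul_assoc, diagonal_mul_adaptedToPsi τ e hd]

/-- Conjugation to the adapted basis makes the element diagonal and constant on blocks. In the
pseudo-orthonormal basis it remains diagonal, because each of those vectors lies in a single block.
-/
theorem exists_diagonal_of_mem_commutant {τ : EType} {p : Param τ} (hn : NoCoincidence τ p.val)
    {L : O22} (hL : L ∈ commutant p.T) :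
    ∃ d, IsBlockConstant τ d ∧ O22.mat L = diagonal (d ∘ blockOrder τ) := by
  set Q := adaptedToPsi τ p.sign with hQ
  have hu : IsUnit Q.det := isUnit_det_adaptedToPsi τ p.sign
  have h1 : Q * Q⁻¹ = 1 := Matrix.mul_nonsing_inv _ hu
  have h2 : Q⁻¹ * Q = 1 := Matrix.nonsing_inv_mul _ hu
  set A := Q * O22.mat L * Q⁻¹ with hA
  have hAQ : A * Q = Q * O22.mat L := by rw [hA, mul_assoc, h2, mul_one]
  have hJ : jordan τ p.val * Q = Q * normalForm τ p.sign p.val := jordan_mul_adaptedToPsi ..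
  have hL' : O22.mat L * normalForm τ p.sign p.val = normalForm τ p.sign p.val * O22.mat L := hL
  have hQu := (Matrix.isUnit_iff_isUnit_det _).2 hu
  have hcomm : A * jordan τ p.val = jordan τ p.val * A := by
    refine hQu.mul_right_cancel ?_
    rw [mul_assoc, hJ, ← mul_assoc, hAQ, mul_assoc, hL', ← mul_assoc, ← hJ, mul_assoc, ← hAQ,
      ← mul_assoc]
  have hgram : Aᵀ * adaptedGram τ p.sign * A = adaptedGram τ p.sign := by
    have h3 : Qᵀ * (Aᵀ * adaptedGram τ p.sign * A) * Q = Qᵀ * adaptedGram τ p.sign * Q := by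
      have h4 : Qᵀ * Aᵀ = (O22.mat L)ᵀ * Qᵀ := by
        rw [← Matrix.transpose_mul, hAQ, Matrix.transpose_mul]
      calc Qᵀ * (Aᵀ * adaptedGram τ p.sign * A) * Q
          = (Qᵀ * Aᵀ) * adaptedGram τ p.sign * (A * Q) := by simp only [mul_assoc]
        _ = (O22.mat L)ᵀ * (Qᵀ * adaptedGram τ p.sign * Q) * O22.mat L := by
          rw [h4, hAQ]
          simp only [mul_assoc]
        _ = Qᵀ * adaptedGram τ p.sign * Q := by
          rw [hQ, adaptedToPsi_gram, show (O22.mat L)ᵀ * psiGram * O22.mat L = psiGram from (mem_O22_iff_transpose _).1 L.2]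
    have hQt : IsUnit Qᵀ := (Matrix.isUnit_iff_isUnit_det _).2 (by rwa [Matrix.det_transpose])
    exact hQt.mul_left_cancel (hQu.mul_right_cancel h3)
  obtain ⟨h3, h4⟩ := commute_jordan_diag τ p.sign p.adm hn hcomm hgram
  have h5 : A = diagonal fun i => A i i := by
    ext i j
    by_cases hij : i = j
    · rw [hij, diagonal_apply_eq]
    · rw [h3 i j hij, diagonal_apply_ne _ hij]
  refine ⟨_, h4, hQu.mul_left_cancel ?_⟩
  rw [← hAQ, ← diagonal_mul_adaptedToPsi τ p.sign h4, ← h5]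

/-- Only `p` has to be generic: block-constant diagonals commute with every normal form of the type,
so a generic commutant is contained in all others. -/
theorem commutant_le_of_noCoincidence {τ : EType} (p q : Param τ) (hn : NoCoincidence τ p.val) :
    commutant p.T ≤ commutant q.T := by
  intro L hL
  obtain ⟨d, hd, h⟩ := exists_diagonal_of_mem_commutant hn hL
  change O22.mat L * normalForm τ q.sign q.val = normalForm τ q.sign q.val * O22.mat L
  rw [h]
  exact diagonal_commute_normalForm τ q.sign q.val hd

theorem commutant_eq_of_noCoincidence {τ : EType} (p q : Param τ) (hp : NoCoincidence τ p.val)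
    (hq : NoCoincidence τ q.val) : commutant p.T = commutant q.T :=
  le_antisymm (commutant_le_of_noCoincidence p q hp) (commutant_le_of_noCoincidence q p hq)

/-! ### Generic parameter values -/

/-- The kernel of a nonzero functional is a proper subspace, hence has empty interior. -/
theorem isOpen_and_dense_ne_zero {n : ℕ} (f : (Fin n → ℝ) →ₗ[ℝ] ℝ) (hf : f ≠ 0) :
    IsOpen {x | f x ≠ 0} ∧ Dense {x | f x ≠ 0} := by
  refine ⟨isOpen_ne_fun f.continuous_of_finiteDimensional continuous_const, ?_⟩
  have h : {x | f x ≠ 0} = ((LinearMap.ker f : Set (Fin n → ℝ)))ᶜ := by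
    ext x
    simp
  rw [h, ← interior_eq_empty_iff_dense_compl, ← Set.not_nonempty_iff_eq_empty]
  intro h1
  exact hf (LinearMap.ker_eq_top.1 (Submodule.eq_top_of_nonempty_interior' _ h1))

theorem isOpen_and_dense_and {X : Type*} [TopologicalSpace X] {P Q : X → Prop}
    (hP : IsOpen {x | P x} ∧ Dense {x | P x}) (hQ : IsOpen {x | Q x} ∧ Dense {x | Q x}) :
    IsOpen {x | P x ∧ Q x} ∧ Dense {x | P x ∧ Q x} :=
  ⟨hP.1.inter hQ.1, hP.2.inter_of_isOpen_left hQ.2 hP.1⟩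

theorem isOpen_and_dense_true {X : Type*} [TopologicalSpace X] :
    IsOpen {_x : X | True} ∧ Dense {_x : X | True} := by
  simp

theorem isOpen_and_dense_coord_ne_zero {n : ℕ} (i : Fin n) :
    IsOpen {x : Fin n → ℝ | x i ≠ 0} ∧ Dense {x : Fin n → ℝ | x i ≠ 0} :=
  isOpen_and_dense_ne_zero (LinearMap.proj i) fun h => by
    simpa using LinearMap.congr_fun h (Pi.single i 1)

theorem isOpen_and_dense_coord_ne {n : ℕ} {i j : Fin n} (hij : i ≠ j) :
    IsOpen {x : Fin n → ℝ | x i ≠ x j} ∧ Dense {x : Fin n → ℝ | x i ≠ x j} := by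
  have h := isOpen_and_dense_ne_zero (LinearMap.proj i - LinearMap.proj j : (Fin n → ℝ) →ₗ[ℝ] ℝ)
    fun h => by simpa [Pi.single_apply, hij.symm] using (LinearMap.sub_apply (LinearMap.proj i : (Fin n → ℝ) →ₗ[ℝ] ℝ)
      (LinearMap.proj j) (Pi.single i 1)).symm.trans (LinearMap.congr_fun h (Pi.single i 1))
  simpa [sub_eq_zero] using h

theorem isOpen_and_dense_generic (τ : EType) :
    IsOpen {x : Fin τ.numParams → ℝ | Admissible τ x ∧ NoCoincidence τ x} ∧
      Dense {x : Fin τ.numParams → ℝ | Admissible τ x ∧ NoCoincidence τ x} := by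
  cases τ
  case I =>
    exact isOpen_and_dense_and isOpen_and_dense_true isOpen_and_dense_true
  case II =>
    exact isOpen_and_dense_and (isOpen_and_dense_coord_ne_zero (n := 2) 1)
      isOpen_and_dense_true
  case IIIa =>
    exact isOpen_and_dense_and isOpen_and_dense_true
      (isOpen_and_dense_coord_ne (n := 2) (i := 0) (j := 1) (by decide))
  case IIIb =>
    exact isOpen_and_dense_and isOpen_and_dense_true
      (isOpen_and_dense_coord_ne (n := 2) (i := 0) (j := 1) (by decide))
  case IV =>
    exact isOpen_and_dense_and isOpen_and_dense_true <| isOpen_and_dense_and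
      (isOpen_and_dense_coord_ne (n := 3) (i := 0) (j := 1) (by decide)) <| isOpen_and_dense_and
      (isOpen_and_dense_coord_ne (n := 3) (i := 1) (j := 2) (by decide))
      (isOpen_and_dense_coord_ne (n := 3) (i := 0) (j := 2) (by decide))
  case V =>
    exact isOpen_and_dense_and (isOpen_and_dense_coord_ne_zero (n := 4) 2)
      (isOpen_and_dense_coord_ne (n := 4) (i := 0) (j := 3) (by decide))
  case VI =>
    exact isOpen_and_dense_and (isOpen_and_dense_coord_ne_zero (n := 3) 2)
      isOpen_and_dense_true
  case VII =>
    exact isOpen_and_dense_and isOpen_and_dense_true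
      (isOpen_and_dense_coord_ne (n := 2) (i := 0) (j := 1) (by decide))
  case VIII =>
    have h1 := isOpen_and_dense_and (isOpen_and_dense_coord_ne_zero (n := 4) 1)
      (isOpen_and_dense_coord_ne_zero (n := 4) 3)
    have h2 := isOpen_and_dense_and h1
      (isOpen_and_dense_coord_ne (n := 4) (i := 0) (j := 2) (by decide))
    refine ⟨h1.1.inter (isClosed_eq (f := fun x : Fin 4 → ℝ => x 0) (g := fun x => x 2)
      (by fun_prop) (by fun_prop) |>.inter (isClosed_eq (f := fun x : Fin 4 → ℝ => |x 1|)
      (g := fun x => |x 3|) (by fun_prop) (by fun_prop))).isOpen_compl, ?_⟩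
    -- Coincidence of complex pairs is not linear, but it is excluded already by the dense linear
    -- condition that the real parts differ.
    exact h2.2.mono fun x hx => ⟨hx.1, fun h => hx.2 h.1⟩
  case IX =>
    have h : ∀ x : Fin 4 → ℝ, (Admissible .IX x ∧ NoCoincidence .IX x) ↔ x 0 ≠ x 1 ∧ x 0 ≠ x 2 ∧
        x 0 ≠ x 3 ∧ x 1 ≠ x 2 ∧ x 1 ≠ x 3 ∧ x 2 ≠ x 3 := by
      intro x
      constructor
      · rintro ⟨-, hx : Function.Injective x⟩
        simp [hx.eq_iff]
      · rintro ⟨h1, h2, h3, h4, h5, h6⟩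
        refine ⟨trivial, fun i j hij => ?_⟩
        revert hij
        fin_cases i <;> fin_cases j <;> simp [h1, h2, h3, h4, h5, h6, h1.symm, h2.symm, h3.symm,
          h4.symm, h5.symm, h6.symm]
    have hd : ∀ i j : Fin 4, i ≠ j → _ := fun i j hij => isOpen_and_dense_coord_ne hij
    have h' := isOpen_and_dense_and (hd 0 1 (by decide)) <| isOpen_and_dense_and
      (hd 0 2 (by decide)) <| isOpen_and_dense_and (hd 0 3 (by decide)) <| isOpen_and_dense_and
      (hd 1 2 (by decide)) <| isOpen_and_dense_and (hd 1 3 (by decide)) (hd 2 3 (by decide))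
    convert h' using 3
    all_goals
      ext x
      exact h x

/-! ### Embedded submanifolds from slices -/

section Slices

open Topology

variable {N E D F : Type} [TopologicalSpace N] [NormedAddCommGroup E] [NormedSpace ℝ E]
  [NormedAddCommGroup D] [NormedSpace ℝ D] [NormedAddCommGroup F] [NormedSpace ℝ F]

/-- A smooth chart of `E` by `D × F` that identifies the image of `ι` with `D × {0}`, and the chart
of `N` by `D` that it induces. -/
structure IsSlice (ι : N → E) (φ : OpenPartialHomeomorph N D)
    (Ψ : OpenPartialHomeomorph (D × F) E) : Prop where
  contDiffOn : ContDiffOn ℝ ∞ Ψ Ψ.source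
  contDiffOn_symm : ContDiffOn ℝ ∞ Ψ.symm Ψ.target
  source_eq : φ.source = ι ⁻¹' Ψ.target
  symm_apply : ∀ x ∈ φ.source, Ψ.symm (ι x) = (φ x, 0)

variable {ι : N → E} {φ φ' : OpenPartialHomeomorph N D} {Ψ Ψ' : OpenPartialHomeomorph (D × F) E}

theorem IsSlice.mem_source (h : IsSlice ι φ Ψ) {y : D} (hy : y ∈ φ.target) :
    (y, 0) ∈ Ψ.source := by
  have h1 := φ.map_target hy
  have h2 := h.symm_apply _ h1
  rw [φ.right_inv hy] at h2
  rw [← h2]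
  rw [h.source_eq] at h1
  exact Ψ.map_target h1

theorem IsSlice.apply_symm (h : IsSlice ι φ Ψ) {y : D} (hy : y ∈ φ.target) :
    ι (φ.symm y) = Ψ (y, 0) := by
  have h1 := φ.map_target hy
  have h2 := h.symm_apply _ h1
  rw [φ.right_inv hy] at h2
  rw [← h2, Ψ.right_inv]
  rwa [h.source_eq] at h1

/-- A transition map of induced charts is the restriction to `D × {0}` of a transition map of
ambient charts. -/
theorem IsSlice.contDiffOn_trans (h : IsSlice ι φ Ψ) (h' : IsSlice ι φ' Ψ') :
    ContDiffOn ℝ ∞ (φ.symm ≫ₕ φ') (φ.symm ≫ₕ φ').source := by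
  have hs : ∀ y ∈ (φ.symm ≫ₕ φ').source, y ∈ φ.target ∧ φ.symm y ∈ φ'.source := fun y hy => by
    simpa using hy
  have h1 : ∀ y ∈ (φ.symm ≫ₕ φ').source, (φ.symm ≫ₕ φ') y = (Ψ'.symm (Ψ (y, 0))).1 := by
    intro y hy
    obtain ⟨hy1, hy2⟩ := hs y hy
    rw [← h.apply_symm hy1, h'.symm_apply _ hy2]
    rfl
  refine ContDiffOn.congr ?_ h1
  have h2 : ContDiffOn ℝ ∞ (fun y : D => Ψ (y, 0)) (φ.symm ≫ₕ φ').source :=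
    h.contDiffOn.comp (by fun_prop) fun y hy => h.mem_source (hs y hy).1
  refine contDiff_fst.comp_contDiffOn (h'.contDiffOn_symm.comp h2 fun y hy => ?_)
  obtain ⟨hy1, hy2⟩ := hs y hy
  rw [← h.apply_symm hy1]
  rwa [h'.source_eq] at hy2

theorem mem_contDiffGroupoid_iff (e : OpenPartialHomeomorph D D) :
    e ∈ contDiffGroupoid ∞ 𝓘(ℝ, D) ↔
      ContDiffOn ℝ ∞ e e.source ∧ ContDiffOn ℝ ∞ e.symm e.target := by
  rw [contDiffGroupoid, mem_groupoid_of_pregroupoid]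
  simp [contDiffPregroupoid]

theorem IsSlice.trans_mem_contDiffGroupoid (h : IsSlice ι φ Ψ) (h' : IsSlice ι φ' Ψ') :
    φ.symm ≫ₕ φ' ∈ contDiffGroupoid ∞ 𝓘(ℝ, D) := by
  rw [mem_contDiffGroupoid_iff]
  exact ⟨h.contDiffOn_trans h', h'.contDiffOn_trans h⟩

/-- Near the image, the first component of the ambient chart recovers the point of `N` continuously
from its image, which gives a continuous local inverse of `ι`. -/
theorem IsSlice.isInducing_aux (h : IsSlice ι φ Ψ) (hι : Continuous ι) {x : N}
    (hx : x ∈ φ.source) : 𝓝 x = Filter.comap ι (𝓝 (ι x)) := by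
  refine le_antisymm hι.continuousAt.le_comap ?_
  have hx' : ι x ∈ Ψ.target := by rwa [h.source_eq] at hx
  have h1 : Filter.Tendsto (fun x' => φ.symm (Ψ.symm (ι x')).1) (Filter.comap ι (𝓝 (ι x)))
      (𝓝 x) := by
    have h2 : Filter.Tendsto (fun x' => (Ψ.symm (ι x')).1) (Filter.comap ι (𝓝 (ι x)))
        (𝓝 (φ x)) := by
      have h3 := (continuous_fst.tendsto _).comp ((Ψ.continuousAt_symm hx').tendsto.comp
        (Filter.tendsto_comap (f := ι)))
      rwa [h.symm_apply x hx] at h3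
    have h4 := (φ.continuousAt_symm (φ.map_source hx)).tendsto
    rw [φ.left_inv hx] at h4
    exact h4.comp h2
  refine (Filter.tendsto_id'.1 (h1.congr' ?_))
  have h5 : ∀ᶠ x' in Filter.comap ι (𝓝 (ι x)), x' ∈ φ.source := by
    rw [h.source_eq]
    exact Filter.preimage_mem_comap (Ψ.open_target.mem_nhds hx')
  filter_upwards [h5] with x' hx'
  rw [h.symm_apply x' hx', φ.left_inv hx']
  rfl

/-- A continuous injection that is covered by slices is an embedding. -/
theorem isEmbedding_of_slices (hinj : Function.Injective ι) (hι : Continuous ι)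
    (h : ∀ x, ∃ (φ : OpenPartialHomeomorph N D) (Ψ : OpenPartialHomeomorph (D × F) E),
      x ∈ φ.source ∧ IsSlice ι φ Ψ) : IsEmbedding ι := by
  refine ⟨isInducing_iff_nhds.2 fun x => ?_, hinj⟩
  obtain ⟨φ, Ψ, hx, hs⟩ := h x
  exact hs.isInducing_aux hι hx

/-- A space that is covered by slices is a manifold, smoothly embedded, and all slices are smooth
charts of it. -/
theorem exists_manifold_of_slices (hinj : Function.Injective ι) (hι : Continuous ι)
    (e : (D × F) ≃L[ℝ] E)
    (h : ∀ x, ∃ (φ : OpenPartialHomeomorph N D) (Ψ : OpenPartialHomeomorph (D × F) E),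
      x ∈ φ.source ∧ IsSlice ι φ Ψ) :
    ∃ _ : ChartedSpace D N, IsManifold 𝓘(ℝ, D) ∞ N ∧ IsSmoothEmbedding 𝓘(ℝ, D) 𝓘(ℝ, E) ∞ ι ∧
      ∀ (φ : OpenPartialHomeomorph N D) (Ψ : OpenPartialHomeomorph (D × F) E), IsSlice ι φ Ψ →
        φ ∈ IsManifold.maximalAtlas 𝓘(ℝ, D) ∞ N := by
  choose Φ Θ hx hs using h
  let c : ChartedSpace D N :=
    { atlas := range Φ
      chartAt := Φ
      mem_chart_source := hx
      chart_mem_atlas := mem_range_self }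
  have hm : ∀ (φ : OpenPartialHomeomorph N D) (Ψ : OpenPartialHomeomorph (D × F) E),
      IsSlice ι φ Ψ → φ ∈ IsManifold.maximalAtlas 𝓘(ℝ, D) ∞ N := by
    intro φ Ψ hφ
    rw [IsManifold.mem_maximalAtlas_iff, _root_.mem_maximalAtlas_iff]
    rintro _ ⟨x, rfl⟩
    exact ⟨hφ.trans_mem_contDiffGroupoid (hs x), (hs x).trans_mem_contDiffGroupoid hφ⟩
  have hman : IsManifold 𝓘(ℝ, D) ∞ N :=
    { compatible := by
        rintro _ _ ⟨x, rfl⟩ ⟨y, rfl⟩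
        exact (hs x).trans_mem_contDiffGroupoid (hs y) }
  refine ⟨c, hman, ⟨?_, ?_⟩, hm⟩
  -- In the ambient chart given by the slice, the map is literally `y ↦ (y, 0)`, carried to `E` by
  -- the fixed equivalence `e`.
  · refine IsImmersionOfComplement.isImmersion (F := F) fun x => ?_
    refine IsImmersionAtOfComplement.mk_of_charts e (Φ x)
      ((Θ x).symm ≫ₕ e.toHomeomorph.toOpenPartialHomeomorph) (hx x) ?_ (hm _ _ (hs x)) ?_ ?_ ?_
    · have := hx x
      rw [(hs x).source_eq] at this
      simpa using this
    · rw [IsManifold.mem_maximalAtlas_iff]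
      refine StructureGroupoid.mem_maximalAtlas_of_mem_groupoid _ ?_
      rw [mem_contDiffGroupoid_iff]
      constructor
      · have := e.contDiff.comp_contDiffOn (n := ∞) (hs x).contDiffOn_symm
        simpa using this
      · have := (hs x).contDiffOn.comp (e.symm.contDiff (n := ∞)).contDiffOn
          (s := e.symm ⁻¹' (Θ x).source) fun y hy => hy
        simpa using this
    · rw [(hs x).source_eq]
      intro y hy
      simpa using hy
    · intro y hy
      have hy' : y ∈ (Φ x).target := by simpa using hy
      have h1 := (hs x).symm_apply _ ((Φ x).map_target hy')
      rw [(Φ x).right_inv hy'] at h1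
      simp [h1]
  · exact isEmbedding_of_slices hinj hι fun x => ⟨Φ x, Θ x, hx x, hs x⟩

end Slices

/-! ### Slices from the inverse function theorem -/

section Slices

open Topology Filter

variable {N E D F : Type} [TopologicalSpace N] [NormedAddCommGroup E] [NormedSpace ℝ E]
  [NormedAddCommGroup D] [NormedSpace ℝ D] [NormedAddCommGroup F] [NormedSpace ℝ F]

/-- The inverse function theorem, on a neighbourhood on which the inverse function is smooth. -/
theorem exists_smooth_chart [CompleteSpace E] {f : E → F} {f' : E ≃L[ℝ] F} {a : E}
    (hf' : HasFDerivAt f (f' : E →L[ℝ] F) a) (hf : ∀ᶠ p in 𝓝 a, ContDiffAt ℝ ∞ f p)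
    {W : Set E} (hW : W ∈ 𝓝 a) :
    ∃ Ψ : OpenPartialHomeomorph E F, (Ψ : E → F) = f ∧ a ∈ Ψ.source ∧ Ψ.source ⊆ W ∧
      ContDiffOn ℝ ∞ Ψ Ψ.source ∧ ContDiffOn ℝ ∞ Ψ.symm Ψ.target := by
  have hfa : ContDiffAt ℝ ∞ f a := hf.self_of_nhds
  have hn : (∞ : WithTop ℕ∞) ≠ 0 := by simp
  -- Invertible operators form an open set, so the derivative stays invertible near `a`. Shrinking
  -- to such points makes the inverse smooth on its whole domain and not just at the image of `a`.
  have h1 : ∀ᶠ p in 𝓝 a, fderiv ℝ f p ∈ range ((↑) : (E ≃L[ℝ] F) → E →L[ℝ] F) := by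
    have hc : ContinuousAt (fderiv ℝ f) a :=
      (hfa.fderiv_right (m := 0) (by simp)).continuousAt
    refine hc ?_
    rw [hf'.fderiv]
    exact ContinuousLinearEquiv.nhds f'
  have hG := (hf.and (h1.and hW))
  set G : Set E := {p | ContDiffAt ℝ ∞ f p ∧ fderiv ℝ f p ∈
    range ((↑) : (E ≃L[ℝ] F) → E →L[ℝ] F) ∧ p ∈ W} with hGdef
  let Ψ := (hfa.toOpenPartialHomeomorph f hf' hn).restrOpen (interior G) isOpen_interior
  have hΨ : ∀ p ∈ Ψ.source, p ∈ G := fun p hp => interior_subset hp.2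
  refine ⟨Ψ, rfl, ?_, fun p hp => (hΨ p hp).2.2, fun p hp => (hΨ p hp).1.contDiffWithinAt,
    fun q hq => ?_⟩
  · exact ⟨hfa.mem_toOpenPartialHomeomorph_source hf' hn, mem_interior_iff_mem_nhds.2 hG⟩
  · obtain ⟨h2, ⟨e, he⟩, -⟩ := hΨ _ (Ψ.map_target hq)
    refine (Ψ.contDiffAt_symm (f₀' := e) hq ?_ h2).contDiffWithinAt
    rw [he]
    exact (h2.differentiableAt hn).hasFDerivAt

variable {ι : N → E}

/-- All later charts come from here. The map `f` is a local diffeomorphism, `g` parametrizes `N`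
compatibly with `f` on `D × {0}`, and `hr` says that no other nearby point of the product lands in
the image of `ι`. That last condition makes the image embedded and not merely immersed. -/
theorem exists_slice [CompleteSpace D] [CompleteSpace F] (hinj : Function.Injective ι)
    (hι : Continuous ι) {f : D × F → E} {f' : (D × F) ≃L[ℝ] E}
    (hf' : HasFDerivAt f (f' : D × F →L[ℝ] E) 0) (hf : ∀ᶠ p in 𝓝 0, ContDiffAt ℝ ∞ f p)
    {g : D → N} (hg : ∀ᶠ x in 𝓝 0, ContinuousAt g x)
    (hgf : ∀ᶠ x in 𝓝 0, ι (g x) = f (x, 0)) (hr : ∀ᶠ p in 𝓝 0, f p ∈ range ι → p.2 = 0)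
    {W : Set (D × F)} (hW : W ∈ 𝓝 0) :
    ∃ (φ : OpenPartialHomeomorph N D) (Ψ : OpenPartialHomeomorph (D × F) E), IsSlice ι φ Ψ ∧
      g 0 ∈ φ.source ∧ φ (g 0) = 0 ∧ ∀ y ∈ φ.target, (y, 0) ∈ W ∧ φ.symm y = g y := by
  have h0 : Tendsto Prod.fst (𝓝 (0 : D × F)) (𝓝 (0 : D)) := continuous_fst.tendsto' _ _ rfl
  obtain ⟨Ψ, rfl, hs0, hs, hd, hd'⟩ := exists_smooth_chart hf' hf
    ((h0.eventually hg).and ((h0.eventually hgf).and (hr.and hW)))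
  -- The first use of `hr`: the ambient chart sends points of `N` into `D × {0}`.
  have hs1 : ∀ x, ι x ∈ Ψ.target → Ψ.symm (ι x) = ((Ψ.symm (ι x)).1, 0) := fun x hx =>
    Prod.ext rfl ((hs (Ψ.map_target hx)).2.2.1 ⟨x, (Ψ.right_inv hx).symm⟩)
  have hs2 : ∀ x, ι x ∈ Ψ.target → g (Ψ.symm (ι x)).1 = x := fun x hx => by
    refine hinj ?_
    rw [(hs (Ψ.map_target hx)).2.1, ← hs1 x hx, Ψ.right_inv hx]
  have hs3 : ∀ y, (y, (0 : F)) ∈ Ψ.source → ι (g y) = Ψ (y, 0) := fun y hy => (hs hy).2.1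
  let φ : OpenPartialHomeomorph N D :=
    { toFun := fun x => (Ψ.symm (ι x)).1
      invFun := g
      source := ι ⁻¹' Ψ.target
      target := {y | (y, 0) ∈ Ψ.source}
      map_source' := fun x hx => by
        change (_, _) ∈ Ψ.source
        rw [← hs1 x hx]
        exact Ψ.map_target hx
      map_target' := fun y hy => by
        change ι (g y) ∈ Ψ.target
        rw [hs3 y hy]
        exact Ψ.map_source hy
      left_inv' := fun x hx => hs2 x hx
      right_inv' := fun y hy => by
        rw [hs3 y hy, Ψ.left_inv hy]
      open_source := Ψ.open_target.preimage hι
      open_target := Ψ.open_source.preimage (by fun_prop)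
      continuousOn_toFun := continuous_fst.comp_continuousOn
        (Ψ.continuousOn_symm.comp hι.continuousOn fun x hx => hx)
      continuousOn_invFun := fun y hy => (hs hy).1.continuousWithinAt }
  have hg0 : g 0 ∈ φ.source := φ.map_target hs0
  exact ⟨φ, Ψ, ⟨hd, hd', rfl, hs1⟩, hg0, φ.right_inv hs0, fun y hy => ⟨(hs hy).2.2.2, rfl⟩⟩

end Slices

/-! ### The Cayley transform -/

section Calculus

open Topology Filter

/-- The topology of the norm. -/
abbrev normTopology : TopologicalSpace Mat4 :=
  PseudoMetricSpace.toUniformSpace.toTopologicalSpace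

attribute [local instance] normTopology

/-- The multiplication of matrices as a continuous bilinear map. -/
def mulB : Mat4 →L[ℝ] Mat4 →L[ℝ] Mat4 := (LinearMap.mul ℝ Mat4).toContinuousBilinearMap

/-- The adjoint of matrices as a continuous linear map. -/
def adjL : Mat4 →L[ℝ] Mat4 :=
  LinearMap.toContinuousLinearMap (⟨⟨adj, adj_add⟩, adj_smul⟩ : Mat4 →ₗ[ℝ] Mat4)

variable {V : Type} [NormedAddCommGroup V] [NormedSpace ℝ V]

theorem ContDiffAt.mat_mul {f g : V → Mat4} {x : V} (hf : ContDiffAt ℝ ∞ f x)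
    (hg : ContDiffAt ℝ ∞ g x) : ContDiffAt ℝ ∞ (fun y => f y * g y) x :=
  (mulB.contDiff.contDiffAt.comp x hf).clm_apply hg

theorem ContDiffAt.adj {f : V → Mat4} {x : V} (hf : ContDiffAt ℝ ∞ f x) :
    ContDiffAt ℝ ∞ (fun y => Neutral.adj (f y)) x :=
  adjL.contDiff.contDiffAt.comp x hf

theorem HasFDerivAt.mat_mul {f g : V → Mat4} {f' g' : V →L[ℝ] Mat4} {x : V}
    (hf : HasFDerivAt f f' x) (hg : HasFDerivAt g g' x) :
    HasFDerivAt (fun y => f y * g y) ((mulB (f x)).comp g' + (mulB.flip (g x)).comp f') x := by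
  have := (mulB.hasFDerivAt.comp x hf).clm_apply hg
  exact this

theorem contDiff_det : ContDiff ℝ ∞ (Matrix.det : Mat4 → ℝ) := by
  have : (Matrix.det : Mat4 → ℝ) = fun A => ∑ σ : Equiv.Perm (Fin 4),
      ((Equiv.Perm.sign σ : ℤ) : ℝ) * ∏ i, A (σ i) i := funext fun A => Matrix.det_apply' A
  rw [this]
  refine ContDiff.sum fun σ _ => ?_
  have : ContDiff ℝ ∞ fun A : Mat4 => ∏ i, A (σ i) i :=
    contDiff_prod fun i _ => contDiff_pi.1 (contDiff_pi.1 contDiff_id (σ i)) i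
  exact contDiff_const.mul this

theorem contDiff_adjugate : ContDiff ℝ ∞ (Matrix.adjugate : Mat4 → Mat4) := by
  refine contDiff_pi.2 fun i => contDiff_pi.2 fun j => ?_
  have : (fun A : Mat4 => A.adjugate i j) = fun A => (A.updateRow j (Pi.single i 1)).det :=
    funext fun A => Matrix.adjugate_apply A i j
  rw [this]
  refine contDiff_det.comp (contDiff_pi.2 fun k => contDiff_pi.2 fun l => ?_)
  by_cases hk : k = j
  · subst hk
    simpa using contDiff_const
  · simp only [Matrix.updateRow_ne hk]
    exact contDiff_pi.1 (contDiff_pi.1 contDiff_id k) l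

theorem contDiffAt_inv {A : Mat4} (hA : A.det ≠ 0) : ContDiffAt ℝ ∞ (fun A : Mat4 => A⁻¹) A := by
  have : (fun A : Mat4 => A⁻¹) = fun A => (A.det)⁻¹ • A.adjugate := by
    funext A
    rw [Matrix.inv_def, Ring.inverse_eq_inv']
  rw [this]
  exact (contDiff_det.contDiffAt.inv hA).smul contDiff_adjugate.contDiffAt

end Calculus

/-! ### The Cayley transform as a local parametrization of the group -/

section Cayley

open Topology Filter

attribute [local instance] normTopology

/-- The Lie algebra of `O(2,2)`: the skew-adjoint endomorphisms. -/
def skew : Submodule ℝ Mat4 where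
  carrier := {X | adj X = -X}
  add_mem' := by
    intro X Y hX hY
    simp only [Set.mem_ofPred_eq] at *
    rw [adj_add, hX, hY, neg_add]
  zero_mem' := by simp [adj]
  smul_mem' := by
    intro c X hX
    simp only [Set.mem_ofPred_eq] at *
    rw [adj_smul, hX, smul_neg]

theorem mem_skew_iff (X : Mat4) : X ∈ skew ↔ adj X = -X := Iff.rfl

/-- The Cayley transform. -/
def cay (X : Mat4) : Mat4 := (1 + (1 / 2 : ℝ) • X) * (1 - (1 / 2 : ℝ) • X)⁻¹

theorem cay_zero : cay 0 = 1 := by simp [cay]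

theorem eventually_det_ne_zero : ∀ᶠ X in 𝓝 (0 : Mat4), (1 - (1 / 2 : ℝ) • X).det ≠ 0 := by
  have h : ContinuousAt (fun X : Mat4 => (1 - (1 / 2 : ℝ) • X).det) 0 :=
    (contDiff_det.continuous.comp (by fun_prop)).continuousAt
  refine h.eventually_ne ?_
  simp

theorem cay_mul {X : Mat4} (hX : (1 - (1 / 2 : ℝ) • X).det ≠ 0) :
    cay X * (1 - (1 / 2 : ℝ) • X) = 1 + (1 / 2 : ℝ) • X := by
  rw [cay, mul_assoc, Matrix.nonsing_inv_mul _ (isUnit_iff_ne_zero.2 hX), mul_one]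

theorem contDiffAt_cay {X : Mat4} (hX : (1 - (1 / 2 : ℝ) • X).det ≠ 0) :
    ContDiffAt ℝ ∞ cay X := by
  refine ContDiffAt.mat_mul (by fun_prop) ?_
  exact (contDiffAt_inv hX).comp X (by fun_prop)

/-- Differentiating `cay X * (1 - X / 2) = 1 + X / 2` at zero gives the derivative without
differentiating the inverse. -/
theorem hasFDerivAt_cay : HasFDerivAt cay (ContinuousLinearMap.id ℝ Mat4) 0 := by
  have h0 : (1 - (1 / 2 : ℝ) • (0 : Mat4)).det ≠ 0 := by simp
  have h1 := ((contDiffAt_cay h0).differentiableAt (by simp)).hasFDerivAt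
  have h2 : HasFDerivAt (fun X : Mat4 => 1 - (1 / 2 : ℝ) • X)
      (-((1 / 2 : ℝ) • ContinuousLinearMap.id ℝ Mat4)) 0 :=
    ((hasFDerivAt_id (0 : Mat4)).const_smul (1 / 2 : ℝ)).const_sub 1
  have h3 : HasFDerivAt (fun X : Mat4 => 1 + (1 / 2 : ℝ) • X)
      ((1 / 2 : ℝ) • ContinuousLinearMap.id ℝ Mat4) 0 :=
    ((hasFDerivAt_id (0 : Mat4)).const_smul (1 / 2 : ℝ)).const_add 1
  have h4 := (HasFDerivAt.mat_mul h1 h2).congr_of_eventuallyEq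
    (eventually_det_ne_zero.mono fun X hX => (cay_mul hX).symm)
  have h5 := h4.unique h3
  have h7 : fderiv ℝ cay 0 = ContinuousLinearMap.id ℝ Mat4 := by
    refine ContinuousLinearMap.ext fun X => ?_
    have h6 : cay 0 * (-((1 / 2 : ℝ) • X)) + fderiv ℝ cay 0 X * (1 - (1 / 2 : ℝ) • (0 : Mat4))
        = (1 / 2 : ℝ) • X := congrArg (fun l : Mat4 →L[ℝ] Mat4 => l X) h5
    rw [cay_zero, one_mul, smul_zero, sub_zero, mul_one, neg_add_eq_iff_eq_add, ← add_smul] at h6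
    rw [h6]
    norm_num
  rwa [h7] at h1

theorem adj_cay_mul_cay {X : Mat4} (hX : (1 - (1 / 2 : ℝ) • X).det ≠ 0) (hs : X ∈ skew) :
    adj (cay X) * cay X = 1 := by
  have h1 : (1 - (1 / 2 : ℝ) • X) * (1 - (1 / 2 : ℝ) • X)⁻¹ = 1 :=
    Matrix.mul_nonsing_inv _ (isUnit_iff_ne_zero.2 hX)
  have h2 : adj (1 - (1 / 2 : ℝ) • X) = 1 + (1 / 2 : ℝ) • X := by
    rw [adj_sub, adj_one, adj_smul, (mem_skew_iff X).1 hs, smul_neg, sub_neg_eq_add]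
  have h3 : adj (1 + (1 / 2 : ℝ) • X) = 1 - (1 / 2 : ℝ) • X := by
    rw [adj_add, adj_one, adj_smul, (mem_skew_iff X).1 hs, smul_neg, sub_eq_add_neg]
  have h4 := congrArg adj h1
  rw [adj_mul, h2, adj_one] at h4
  have h5 : (1 - (1 / 2 : ℝ) • X) * (1 + (1 / 2 : ℝ) • X)
      = (1 + (1 / 2 : ℝ) • X) * (1 - (1 / 2 : ℝ) • X) := by
    simp only [sub_mul, mul_sub, add_mul, mul_add, one_mul, mul_one]
    abel
  calc adj (cay X) * cay X
      = adj (1 - (1 / 2 : ℝ) • X)⁻¹ * ((1 - (1 / 2 : ℝ) • X) * (1 + (1 / 2 : ℝ) • X)) *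
          (1 - (1 / 2 : ℝ) • X)⁻¹ := by
        rw [cay, adj_mul, h3]
        simp only [mul_assoc]
    _ = (adj (1 - (1 / 2 : ℝ) • X)⁻¹ * (1 + (1 / 2 : ℝ) • X)) *
          ((1 - (1 / 2 : ℝ) • X) * (1 - (1 / 2 : ℝ) • X)⁻¹) := by
        rw [h5]
        simp only [mul_assoc]
    _ = 1 := by rw [h4, h1, one_mul]

theorem commute_inv {A C : Mat4} (h : Commute C A) : Commute C A⁻¹ := by
  -- The inverse of a singular matrix is zero by convention, so the claim holds there as well.
  by_cases hA : A.det = 0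
  · rw [Matrix.nonsing_inv_apply_not_isUnit _ (by simpa using hA)]
    exact Commute.zero_right C
  have h1 : A * A⁻¹ = 1 := Matrix.mul_nonsing_inv _ (isUnit_iff_ne_zero.2 hA)
  have h2 : A⁻¹ * A = 1 := Matrix.nonsing_inv_mul _ (isUnit_iff_ne_zero.2 hA)
  calc C * A⁻¹ = A⁻¹ * (A * C) * A⁻¹ := by rw [← mul_assoc, h2, one_mul]
    _ = A⁻¹ * C := by rw [← h.eq, mul_assoc, mul_assoc, h1, mul_one]

theorem commute_cay {X C : Mat4} (h : Commute C X) : Commute C (cay X) :=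
  ((Commute.one_right C).add_right (h.smul_right _)).mul_right
    (commute_inv ((Commute.one_right C).sub_right (h.smul_right _)))

/-- The Cayley transform is invertible by rational functions: `(1 - X / 2)⁻¹` is `(cay X + 1) / 2`.
So `X` commutes with everything that commutes with its transform, and the commutant is linear in
Cayley coordinates. -/
theorem commute_of_commute_cay {X C : Mat4} (hX : (1 - (1 / 2 : ℝ) • X).det ≠ 0)
    (h : Commute C (cay X)) : Commute C X := by
  have hu : IsUnit (1 - (1 / 2 : ℝ) • X).det := isUnit_iff_ne_zero.2 hX
  have h1 : (1 - (1 / 2 : ℝ) • X)⁻¹ = (1 / 2 : ℝ) • (cay X + 1) := by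
    have : cay X + 1 = (2 : ℝ) • (1 - (1 / 2 : ℝ) • X)⁻¹ := by
      have h3 : cay X + 1 = (1 + (1 / 2 : ℝ) • X) * (1 - (1 / 2 : ℝ) • X)⁻¹ +
          (1 - (1 / 2 : ℝ) • X) * (1 - (1 / 2 : ℝ) • X)⁻¹ := by
        rw [Matrix.mul_nonsing_inv _ hu, cay]
      rw [h3, ← add_mul, add_add_sub_cancel, add_mul, one_mul, two_smul]
    rw [this, smul_smul]
    norm_num
  have h2 : Commute C (1 - (1 / 2 : ℝ) • X)⁻¹ := by
    rw [h1]
    exact (h.add_right (Commute.one_right C)).smul_right _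
  have h3 : Commute C (1 - (1 / 2 : ℝ) • X) := by
    have := commute_inv h2
    rwa [Matrix.nonsing_inv_nonsing_inv _ hu] at this
  have h4 : X = (2 : ℝ) • (1 - (1 - (1 / 2 : ℝ) • X)) := by
    rw [sub_sub_cancel, smul_smul]
    norm_num
  rw [h4]
  exact ((Commute.one_right C).sub_right h3).smul_right _

open Classical in
/-- The Cayley transform of the Lie algebra into the group, near `0`. -/
def cayO (X : skew) : O22 :=
  if h : adj (cay X) * cay X = 1 then O22.ofMat (cay X) h else 1

theorem cayO_zero : cayO 0 = 1 := by
  refine O22.mat_injective ?_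
  rw [cayO]
  split_ifs
  · simp [cay_zero]
  · rfl

theorem eventually_skew_det_ne_zero :
    ∀ᶠ X : skew in 𝓝 0, (1 - (1 / 2 : ℝ) • (X : Mat4)).det ≠ 0 :=
  (skew.subtypeL.continuous.tendsto 0).eventually eventually_det_ne_zero

theorem mat_cayO {X : skew} (hX : (1 - (1 / 2 : ℝ) • (X : Mat4)).det ≠ 0) :
    O22.mat (cayO X) = cay X := by
  rw [cayO, dif_pos (adj_cay_mul_cay hX X.2), O22.mat_ofMat]

theorem eventually_contDiffAt_cayO :
    ∀ᶠ X : skew in 𝓝 0, ContDiffAt ℝ ∞ (fun X => O22.mat (cayO X)) X := by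
  filter_upwards [eventually_skew_det_ne_zero.eventually_nhds] with X hX
  refine ContDiffAt.congr_of_eventuallyEq (f := fun X : skew => cay X) ?_
    (hX.mono fun Y hY => mat_cayO hY)
  exact (contDiffAt_cay hX.self_of_nhds).comp X skew.subtypeL.contDiff.contDiffAt

theorem hasFDerivAt_cayO : HasFDerivAt (fun X => O22.mat (cayO X)) skew.subtypeL 0 := by
  have h : HasFDerivAt (fun X : skew => cay X)
      ((ContinuousLinearMap.id ℝ Mat4).comp skew.subtypeL) 0 :=
    HasFDerivAt.comp (g := cay) (0 : skew) hasFDerivAt_cay skew.subtypeL.hasFDerivAt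
  exact h.congr_of_eventuallyEq (eventually_skew_det_ne_zero.mono fun Y hY => mat_cayO hY)

theorem mem_commutant_iff (L : O22) (T : EndPlus) :
    L ∈ commutant T ↔ Commute (T : Mat4) (O22.mat L) :=
  ⟨fun h => h.symm, fun h => h.symm⟩

/-- No smallness of `X` is needed, since the default value `1` of `cayO` also lies in the commutant.
-/
theorem cayO_mem_commutant {T : EndPlus} {X : skew} (h : Commute (T : Mat4) X) :
    cayO X ∈ commutant T := by
  rw [mem_commutant_iff, cayO]
  split_ifs
  · exact commute_cay h
  · exact Commute.one_right _

theorem eventually_cayO_mem_commutant_iff (T : EndPlus) :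
    ∀ᶠ X : skew in 𝓝 0, cayO X ∈ commutant T ↔ Commute (T : Mat4) X := by
  filter_upwards [eventually_skew_det_ne_zero] with X hX
  rw [mem_commutant_iff, mat_cayO hX]
  exact ⟨commute_of_commute_cay hX, commute_cay⟩

end Cayley

/-! ### Slices for the group and for the commutants -/

section

open Topology

theorem continuous_adj : Continuous adj := by
  unfold adj
  fun_prop

theorem O22.continuous_mat : Continuous O22.mat :=
  Units.continuous_val.comp continuous_subtype_val

/-- The topology of the units also records the inverse, but on this group the inverse is the adjoint
and hence depends continuously on the matrix. -/
theorem O22.isInducing_mat : IsInducing O22.mat := by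
  have h : Continuous fun A : Mat4 => (A, MulOpposite.op (adj A)) :=
    continuous_id.prodMk (MulOpposite.continuous_op.comp continuous_adj)
  refine IsInducing.of_comp O22.continuous_mat h ?_
  have h2 : (fun A : Mat4 => (A, MulOpposite.op (adj A))) ∘ O22.mat
      = Units.embedProduct Mat4 ∘ ((↑) : O22 → GL (Fin 4) ℝ) := by
    funext L
    change (_, _) = (_, _)
    rw [← O22.mat_inv]
    rfl
  rw [h2]
  exact Units.isInducing_embedProduct.comp IsInducing.subtypeVal

/-- The topology of the group. -/
abbrev O22.topology : TopologicalSpace O22 := inferInstance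

end

section Group

open Topology Filter

attribute [local instance] normTopology O22.topology

variable {V : Type} [NormedAddCommGroup V] [NormedSpace ℝ V]

/-- `L₀` times Cayley transforms times a matrix in the direction of the self-adjoint ones. -/
def groupChart (L₀ : O22) (α β : V →L[ℝ] skew) (γ : V →L[ℝ] EndPlus) (v : V) : Mat4 :=
  O22.mat L₀ * O22.mat (cayO (α v)) * O22.mat (cayO (β v)) * (1 + γ v)

theorem eventually_comp {P : skew → Prop} (hP : ∀ᶠ X : skew in 𝓝 0, P X) (α : V →L[ℝ] skew) :
    ∀ᶠ v in 𝓝 (0 : V), P (α v) :=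
  (α.continuous.tendsto' 0 0 (map_zero α)).eventually hP

theorem eventually_contDiffAt_cayO_comp (α : V →L[ℝ] skew) :
    ∀ᶠ v in 𝓝 (0 : V), ContDiffAt ℝ ∞ (fun v => O22.mat (cayO (α v))) v :=
  (eventually_comp eventually_contDiffAt_cayO α).mono fun v hv =>
    ContDiffAt.comp (g := fun X => O22.mat (cayO X)) v hv α.contDiff.contDiffAt

theorem hasFDerivAt_cayO_comp (α : V →L[ℝ] skew) :
    HasFDerivAt (fun v => O22.mat (cayO (α v))) (skew.subtypeL.comp α) 0 := by
  have h : HasFDerivAt (fun X => O22.mat (cayO X)) skew.subtypeL (α 0) := by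
    rw [map_zero]
    exact hasFDerivAt_cayO
  exact HasFDerivAt.comp (0 : V) h α.hasFDerivAt

theorem eventually_contDiffAt_groupChart (L₀ : O22) (α β : V →L[ℝ] skew) (γ : V →L[ℝ] EndPlus) :
    ∀ᶠ v in 𝓝 (0 : V), ContDiffAt ℝ ∞ (groupChart L₀ α β γ) v := by
  filter_upwards [eventually_contDiffAt_cayO_comp α, eventually_contDiffAt_cayO_comp β]
    with v hα hβ
  exact ContDiffAt.mat_mul (ContDiffAt.mat_mul (ContDiffAt.mat_mul contDiffAt_const hα) hβ)
    (contDiffAt_const.add (EndPlus.subtypeL.contDiff.comp γ.contDiff).contDiffAt)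

/-- Left multiplication by an element of the group. -/
def mulLeftEquiv (L : O22) : Mat4 ≃L[ℝ] Mat4 :=
  LinearEquiv.toContinuousLinearEquiv
    { toFun := fun A => O22.mat L * A
      invFun := fun A => O22.mat L⁻¹ * A
      map_add' := fun A C => mul_add _ A C
      map_smul' := fun c A => mul_smul_comm c _ A
      left_inv := fun A => by
        beta_reduce
        rw [← mul_assoc, O22.mat_inv_mul, one_mul]
      right_inv := fun A => by
        beta_reduce
        rw [← mul_assoc, O22.mat_mul_inv, one_mul] }

theorem hasFDerivAt_groupChart (L₀ : O22) (α β : V →L[ℝ] skew) (γ : V →L[ℝ] EndPlus)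
    (e : V ≃L[ℝ] Mat4) (he : ∀ v, e v = α v + β v + γ v) :
    HasFDerivAt (groupChart L₀ α β γ) ((e.trans (mulLeftEquiv L₀) : V ≃L[ℝ] Mat4) : V →L[ℝ] Mat4)
      0 := by
  have h1 := HasFDerivAt.mat_mul (hasFDerivAt_const (O22.mat L₀) (0 : V)) (hasFDerivAt_cayO_comp α)
  have h2 := HasFDerivAt.mat_mul h1 (hasFDerivAt_cayO_comp β)
  have h3 := HasFDerivAt.mat_mul h2
    (((EndPlus.subtypeL.comp γ).hasFDerivAt (x := (0 : V))).const_add (1 : Mat4))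
  refine HasFDerivAt.congr_fderiv h3 (ContinuousLinearMap.ext fun v => ?_)
  change O22.mat L₀ * O22.mat (cayO (α 0)) * O22.mat (cayO (β 0)) * (γ v : Mat4) +
    (O22.mat L₀ * O22.mat (cayO (α 0)) * (β v : Mat4) +
      (O22.mat L₀ * (α v : Mat4) + (0 : Mat4) * O22.mat (cayO (α 0))) * O22.mat (cayO (β 0))) *
      (1 + (γ 0 : Mat4)) = O22.mat L₀ * e v
  rw [he]
  simp only [map_zero, cayO_zero, O22.mat_one, Submodule.coe_zero, mul_one, add_zero, mul_add]
  abel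

/-- A self-adjoint isometry is an involution, so `Y * (2 + Y) = 0`; near zero the factor `2 + Y` is
invertible. -/
theorem one_add_eq_one_of_adj {Y : EndPlus} (hdet : (2 + (Y : Mat4)).det ≠ 0)
    (h : adj (1 + (Y : Mat4)) * (1 + (Y : Mat4)) = 1) : Y = 0 := by
  rw [adj_add, adj_one, EndPlus.adj_eq] at h
  have h1 : (Y : Mat4) * (2 + Y) = 0 := by
    have : (1 + (Y : Mat4)) * (1 + Y) = 1 + Y * (2 + Y) := by noncomm_ring
    rw [this] at h
    exact add_eq_left.1 h
  have h2 := congrArg (fun A => A * (2 + (Y : Mat4))⁻¹) h1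
  simp only [mul_assoc, Matrix.mul_nonsing_inv _ (isUnit_iff_ne_zero.2 hdet), mul_one,
    zero_mul] at h2
  exact Subtype.ext h2

theorem eventually_det_two_add_ne_zero :
    ∀ᶠ Y : EndPlus in 𝓝 0, (2 + (Y : Mat4)).det ≠ 0 := by
  have h : ContinuousAt (fun Y : EndPlus => (2 + (Y : Mat4)).det) 0 :=
    (contDiff_det.continuous.comp
      (continuous_const.add EndPlus.subtypeL.continuous)).continuousAt
  refine h.eventually_ne ?_
  have : (2 : Mat4) = (2 : ℝ) • (1 : Mat4) := by
    rw [two_smul, one_add_one_eq_two]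
  simp [this]

/-- The self-adjoint matrices are transversal to the group: stripping the group factors from a point
of the group leaves `1 + γ v` as an isometry, which forces `γ v = 0` nearby. -/
theorem eventually_groupChart_mem_range (L₀ : O22) (α β : V →L[ℝ] skew) (γ : V →L[ℝ] EndPlus) :
    ∀ᶠ v in 𝓝 (0 : V), ∀ L : O22, O22.mat L = groupChart L₀ α β γ v →
      γ v = 0 ∧ L = L₀ * cayO (α v) * cayO (β v) := by
  have h := (γ.continuous.tendsto' 0 0 (map_zero γ)).eventually eventually_det_two_add_ne_zero
  filter_upwards [h] with v hv L hL
  have h1 : O22.mat ((L₀ * cayO (α v) * cayO (β v))⁻¹ * L) = 1 + γ v := by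
    rw [O22.mat_mul, hL, groupChart, ← O22.mat_mul, ← O22.mat_mul, ← mul_assoc, O22.mat_inv_mul,
      one_mul]
  have h2 : γ v = 0 := by
    refine one_add_eq_one_of_adj hv ?_
    rw [← h1]
    exact O22.adj_mul_mat _
  refine ⟨h2, O22.mat_injective ?_⟩
  rw [hL, groupChart, h2, Submodule.coe_zero, add_zero, mul_one, O22.mat_mul, O22.mat_mul]

theorem isCompl_skew_EndPlus : IsCompl skew EndPlus := by
  constructor
  · rw [Submodule.disjoint_def]
    intro X h1 h2
    rw [mem_skew_iff, (mem_EndPlus_iff X).1 h2, eq_neg_iff_add_eq_zero, ← two_smul ℝ X] at h1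
    exact (smul_eq_zero.1 h1).resolve_left two_ne_zero
  · rw [codisjoint_iff, eq_top_iff]
    intro X _
    rw [Submodule.mem_sup]
    refine ⟨(1 / 2 : ℝ) • (X - adj X), ?_, (1 / 2 : ℝ) • (X + adj X), ?_, ?_⟩
    · rw [mem_skew_iff, adj_smul, adj_sub, adj_adj, ← smul_neg, neg_sub]
    · rw [mem_EndPlus_iff, adj_smul, adj_add, adj_adj, add_comm]
    · rw [← smul_add, sub_add_add_cancel, ← two_smul ℝ X, smul_smul]
      norm_num

/-- Every matrix is the sum of a skew-adjoint and a self-adjoint one. -/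
def sumEquiv : (skew × EndPlus) ≃L[ℝ] Mat4 :=
  (Submodule.prodEquivOfIsCompl skew EndPlus isCompl_skew_EndPlus).toContinuousLinearEquiv

end Group

section Group

open Topology Filter

attribute [local instance] normTopology O22.topology

variable {D : Type} [NormedAddCommGroup D] [NormedSpace ℝ D] [CompleteSpace D]

theorem eventually_continuousAt_mul_cayO {V : Type} [NormedAddCommGroup V] [NormedSpace ℝ V]
    (L₀ : O22) (α β : V →L[ℝ] skew) :
    ∀ᶠ v in 𝓝 (0 : V), ContinuousAt (fun v => L₀ * cayO (α v) * cayO (β v)) v := by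
  filter_upwards [eventually_contDiffAt_groupChart L₀ α β 0] with v hv
  refine O22.isInducing_mat.continuousAt_iff.2 ?_
  refine hv.continuousAt.congr (Eventually.of_forall fun w => ?_)
  simp [groupChart, O22.mat_mul]

/-- Two Cayley factors are allowed so that the charts can be adapted to a splitting of the Lie
algebra, which later turns the orbit map into a projection. The set `W` keeps the chart small. -/
theorem exists_O22_slice (e : D ≃L[ℝ] skew) (a b : D →L[ℝ] skew) (hab : ∀ x, a x + b x = e x)
    (L₀ : O22) {W : Set (D × EndPlus)} (hW : W ∈ 𝓝 0) :
    ∃ (φ : OpenPartialHomeomorph O22 D) (Ψ : OpenPartialHomeomorph (D × EndPlus) Mat4),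
      IsSlice O22.mat φ Ψ ∧ L₀ ∈ φ.source ∧ φ L₀ = 0 ∧
        ∀ y ∈ φ.target, (y, 0) ∈ W ∧ φ.symm y = L₀ * cayO (a y) * cayO (b y) := by
  let α := a.comp (ContinuousLinearMap.fst ℝ D EndPlus)
  let β := b.comp (ContinuousLinearMap.fst ℝ D EndPlus)
  let γ := ContinuousLinearMap.snd ℝ D EndPlus
  let E : (D × EndPlus) ≃L[ℝ] Mat4 :=
    (e.prodCongr (ContinuousLinearEquiv.refl ℝ EndPlus)).trans sumEquiv
  have hE : ∀ v, E v = α v + β v + γ v := fun v => by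
    change ((e v.1 : skew) : Mat4) + (v.2 : Mat4) = (a v.1 : Mat4) + (b v.1 : Mat4) + (v.2 : Mat4)
    rw [← hab, Submodule.coe_add]
  have h := exists_slice O22.mat_injective O22.continuous_mat
    (hasFDerivAt_groupChart L₀ α β γ E hE) (eventually_contDiffAt_groupChart L₀ α β γ)
    (eventually_continuousAt_mul_cayO L₀ a b) (Eventually.of_forall fun x => ?_)
    ((eventually_groupChart_mem_range L₀ α β γ).mono fun v hv => ?_) hW
  · simpa only [map_zero, cayO_zero, mul_one] using h
  · simp [groupChart, O22.mat_mul, α, β, γ]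
  · rintro ⟨L, hL⟩
    exact (hv L hL).1

/-- The infinitesimal action on a self-adjoint endomorphism. -/
def ad (T : EndPlus) : skew →ₗ[ℝ] EndPlus where
  toFun X := ⟨(X : Mat4) * T - T * X, by
    rw [mem_EndPlus_iff, adj_sub, adj_mul, adj_mul, EndPlus.adj_eq, (mem_skew_iff _).1 X.2]
    simp only [mul_neg, neg_mul]
    abel⟩
  map_add' X Y := by
    apply Subtype.ext
    simp only [Submodule.coe_add, add_mul, mul_add]
    abel
  map_smul' c X := by
    apply Subtype.ext
    simp [smul_sub]

theorem ad_apply (T : EndPlus) (X : skew) : (ad T X : Mat4) = (X : Mat4) * T - T * X := rfl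

theorem mem_ker_ad_iff (T : EndPlus) (X : skew) :
    X ∈ LinearMap.ker (ad T) ↔ Commute (T : Mat4) X := by
  rw [LinearMap.mem_ker, Subtype.ext_iff, ad_apply, Submodule.coe_zero, sub_eq_zero]
  exact eq_comm

theorem commutant_mat_isInducing (T : EndPlus) :
    IsInducing (fun k : commutant T => O22.mat k) :=
  O22.isInducing_mat.comp IsInducing.subtypeVal

/-- Linear equivalences of finite-dimensional normed spaces are continuous. -/
def toCLE {A C : Type} [NormedAddCommGroup A] [NormedSpace ℝ A] [FiniteDimensional ℝ A]
    [NormedAddCommGroup C] [NormedSpace ℝ C] (e : A ≃ₗ[ℝ] C) : A ≃L[ℝ] C :=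
  e.toContinuousLinearEquiv

variable {F : Type} [NormedAddCommGroup F] [NormedSpace ℝ F] [CompleteSpace F]

/-- The Cayley factor of the commuting part stays in the commutant. If the whole product lies there,
so does the factor from the complement; near zero this forces its argument to commute with `T`,
hence to vanish. -/
theorem exists_commutant_slice {T : EndPlus} (ε : D →L[ℝ] skew) (β : F →L[ℝ] skew)
    (γ : F →L[ℝ] EndPlus) (e : (D × F) ≃L[ℝ] Mat4) (he : ∀ v, e v = ε v.1 + β v.2 + γ v.2)
    (hε : ∀ x, Commute (T : Mat4) (ε x)) (hβ : ∀ y, Commute (T : Mat4) (β y) → β y = 0)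
    (k₀ : commutant T) :
    ∃ (φ : OpenPartialHomeomorph (commutant T) D) (Ψ : OpenPartialHomeomorph (D × F) Mat4),
      k₀ ∈ φ.source ∧ IsSlice (fun k : commutant T => O22.mat k) φ Ψ := by
  let α' := ε.comp (ContinuousLinearMap.fst ℝ D F)
  let β' := β.comp (ContinuousLinearMap.snd ℝ D F)
  let γ' := γ.comp (ContinuousLinearMap.snd ℝ D F)
  have hE : ∀ v, e v = α' v + β' v + γ' v := he
  let g : D → commutant T := fun z =>
    ⟨(k₀ : O22) * cayO (ε z) * cayO ((0 : D →L[ℝ] skew) z),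
      mul_mem (mul_mem k₀.2 (cayO_mem_commutant (hε z)))
        (cayO_mem_commutant (Commute.zero_right _))⟩
  have hg0 : g 0 = k₀ := Subtype.ext (by simp [g, cayO_zero])
  have hinj : Function.Injective (fun k : commutant T => O22.mat k) :=
    O22.mat_injective.comp Subtype.val_injective
  have hgf : ∀ x, O22.mat (g x : O22) = groupChart k₀ α' β' γ' (x, 0) := fun x => by
    simp [groupChart, O22.mat_mul, α', β', γ', g]
  have hr : ∀ᶠ v in 𝓝 0, groupChart k₀ α' β' γ' v ∈ range (fun k : commutant T => O22.mat k) →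
      v.2 = 0 := by
    filter_upwards [eventually_groupChart_mem_range k₀ α' β' γ',
      eventually_comp (eventually_cayO_mem_commutant_iff T) β']
    rintro v hv hv' ⟨k, hk⟩
    obtain ⟨h1, h2⟩ := hv k hk
    have h3 : cayO (β' v) ∈ commutant T := by
      have : cayO (β' v) = ((k₀ : O22) * cayO (α' v))⁻¹ * k := by rw [h2, inv_mul_cancel_left]
      rw [this]
      exact mul_mem (inv_mem (mul_mem k₀.2 (cayO_mem_commutant (hε v.1)))) k.2
    have h5 : β v.2 = 0 := hβ _ (hv'.1 h3)
    have h6 : e (0, v.2) = e 0 := by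
      rw [he, map_zero, map_zero, h5, show γ v.2 = 0 from h1]
      simp
    exact congrArg Prod.snd (e.injective h6)
  obtain ⟨φ, Ψ, h1, h2, -⟩ := exists_slice hinj (commutant_mat_isInducing T).continuous
    (hasFDerivAt_groupChart k₀ α' β' γ' e hE) (eventually_contDiffAt_groupChart k₀ α' β' γ')
    (g := g) ((eventually_continuousAt_mul_cayO k₀ ε 0).mono fun v hv =>
      IsInducing.subtypeVal.continuousAt_iff.2 hv) (Eventually.of_forall hgf) hr univ_mem
  exact ⟨φ, Ψ, hg0 ▸ h2, h1⟩

end Group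

/-! ### Slices for the orbits -/

section Orbit

open Topology Filter

attribute [local instance] normTopology O22.topology

/-- The linear map whose kernel consists of the matrices that intertwine `T` and `S`. -/
def intertwiner (S T : Mat4) : Mat4 →ₗ[ℝ] Mat4 :=
  LinearMap.mulRight ℝ T - LinearMap.mulLeft ℝ S

theorem intertwiner_apply (S T A : Mat4) : intertwiner S T A = A * T - S * A := rfl

/-- Left multiplication by a group element that carries `T` to `S` conjugates one intertwining
operator into the other, so the rank is constant along the orbit. -/
theorem finrank_range_intertwiner {S T : EndPlus} (h : S ∈ MulAction.orbit O22 T) :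
    Module.finrank ℝ (LinearMap.range (intertwiner S T))
      = Module.finrank ℝ (LinearMap.range (intertwiner T T)) := by
  obtain ⟨L, rfl⟩ := h
  let G : Mat4 ≃ₗ[ℝ] Mat4 := (mulLeftEquiv L).toLinearEquiv
  have h1 : intertwiner ((L • T : EndPlus) : Mat4) T
      = G.toLinearMap ∘ₗ intertwiner T T ∘ₗ G.symm.toLinearMap := by
    refine LinearMap.ext fun A => ?_
    change A * T - O22.mat L * T * O22.mat L⁻¹ * A
      = O22.mat L * (O22.mat L⁻¹ * A * T - T * (O22.mat L⁻¹ * A))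
    rw [mul_sub]
    simp only [← mul_assoc, O22.mat_mul_inv, one_mul]
  have h2 : LinearMap.range (intertwiner ((L • T : EndPlus) : Mat4) T)
      = (LinearMap.range (intertwiner T T)).map G.toLinearMap := by
    rw [h1, LinearMap.range_comp, LinearMap.range_comp_of_range_eq_top _ (LinearEquiv.range _)]
  change Module.finrank ℝ (LinearMap.range (intertwiner ((L • T : EndPlus) : Mat4) T)) = _
  rw [h2]
  exact LinearEquiv.finrank_map_eq G _

/-- If a commutator of `A` with `T` is self-adjoint, then taking adjoints shows that the
self-adjoint part of `A` commutes with `T`. The commutator therefore comes from the skew part, that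
is, from the Lie algebra. -/
theorem disjoint_map_range_intertwiner {T : EndPlus} {B : Submodule ℝ EndPlus}
    (hB : Disjoint B (LinearMap.range (ad T))) :
    Disjoint (B.map EndPlus.subtype) (LinearMap.range (intertwiner T T)) := by
  rw [Submodule.disjoint_def]
  rintro _ ⟨Y, hY, rfl⟩ ⟨A, hA⟩
  have h1 : (A + adj A) * T - T * (A + adj A) = 0 := by
    have h2 := congrArg adj hA
    rw [intertwiner_apply, adj_sub, adj_mul, adj_mul, EndPlus.adj_eq, Submodule.subtype_apply,
      EndPlus.adj_eq] at h2
    rw [intertwiner_apply, Submodule.subtype_apply] at hA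
    have h3 : (A + adj A) * T - T * (A + adj A) =
        (A * T - T * A) - (T * adj A - adj A * T) := by
      rw [add_mul, mul_add]
      abel
    rw [h3, hA, h2, sub_self]
  have h4 : (1 / 2 : ℝ) • (A - adj A) ∈ skew := by
    rw [mem_skew_iff, adj_smul, adj_sub, adj_adj, ← smul_neg, neg_sub]
  have h5 : Y ∈ LinearMap.range (ad T) := by
    refine ⟨⟨_, h4⟩, Subtype.ext ?_⟩
    rw [ad_apply]
    rw [intertwiner_apply, Submodule.subtype_apply] at hA
    have h6 : (1 / 2 : ℝ) • (A - adj A) * T - T * ((1 / 2 : ℝ) • (A - adj A))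
        = (A * T - T * A) - (1 / 2 : ℝ) • ((A + adj A) * T - T * (A + adj A)) := by
      simp only [smul_mul_assoc, mul_smul_comm, sub_mul, mul_sub, add_mul, mul_add]
      module
    change (1 / 2 : ℝ) • (A - adj A) * T - T * ((1 / 2 : ℝ) • (A - adj A)) = _
    rw [h6, h1, smul_zero, sub_zero, hA]
  rw [Submodule.disjoint_def.1 hB Y hY h5, map_zero]

/-- Near `T`, a transversal to the tangent space of the orbit meets the orbit in `T` only. -/
theorem eventually_eq_zero_of_add_mem_orbit {T : EndPlus} {B : Submodule ℝ EndPlus}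
    (hB : Disjoint B (LinearMap.range (ad T))) :
    ∀ᶠ Y : EndPlus in 𝓝 0, Y ∈ B → T + Y ∈ MulAction.orbit O22 T → Y = 0 := by
  -- `V` is a complement, containing the transversal `B`, of the range of `A ↦ A T - T A`; `π` below
  -- is the projection to that range along `V`.
  obtain ⟨V, hBV, hV⟩ := (disjoint_map_range_intertwiner hB).exists_isCompl
  set U := LinearMap.range (intertwiner T T) with hU
  let π : Mat4 →ₗ[ℝ] U := U.projectionOnto V hV.symm
  obtain ⟨R, hR⟩ := (intertwiner T T).rangeRestrict.exists_rightInverse_of_surjective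
    (LinearMap.range_rangeRestrict _)
  let M : Mat4 → U →ₗ[ℝ] U := fun S => π ∘ₗ intertwiner S T ∘ₗ R
  have hM : M T = LinearMap.id := by
    refine LinearMap.ext fun u => ?_
    have h1 : intertwiner T T (R u) = (u : Mat4) :=
      congrArg (fun l : U →ₗ[ℝ] U => ((l u : U) : Mat4)) hR
    change π (intertwiner T T (R u)) = u
    rw [h1]
    exact Submodule.projectionOnto_apply_left hV.symm u
  have hdet : Continuous fun S => LinearMap.det (M S) := by
    let b := Module.finBasis ℝ U
    have h1 : (fun S => LinearMap.det (M S)) = fun S => (LinearMap.toMatrix b b (M S)).det :=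
      funext fun S => (LinearMap.det_toMatrix b (M S)).symm
    rw [h1]
    refine Continuous.matrix_det (continuous_pi fun i => continuous_pi fun j => ?_)
    have h2 : (fun S => LinearMap.toMatrix b b (M S) i j) = fun S : Mat4 =>
        (b.coord i ∘ₗ π) (R (b j) * T - S * R (b j)) := funext fun S =>
      LinearMap.toMatrix_apply b b (M S) i j
    have h3 : Continuous (b.coord i ∘ₗ π) := LinearMap.continuous_of_finiteDimensional _
    have h4 : (fun S => LinearMap.toMatrix b b (M S) i j) = fun S : Mat4 =>
        (b.coord i ∘ₗ π) (R (b j) * T - mulB.flip (R (b j)) S) := h2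
    rw [h4]
    exact h3.comp (continuous_const.sub (mulB.flip (R (b j))).continuous)
  -- Near `T` the projection `π` still maps the range of `A ↦ A T - S A` onto `U`. For `S` on the
  -- orbit the two ranges have equal dimension, so `π` is injective there.
  have h0 : ∀ᶠ S in 𝓝 (T : Mat4), LinearMap.det (M S) ≠ 0 := by
    refine hdet.continuousAt.eventually_ne ?_
    rw [hM, LinearMap.det_id]
    exact one_ne_zero
  have h1 : Tendsto (fun Y : EndPlus => (T : Mat4) + Y) (𝓝 0) (𝓝 T) :=
    (continuous_const.add EndPlus.subtypeL.continuous).tendsto' _ _ (by simp)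
  filter_upwards [h1.eventually h0] with Y hY hYB hYT
  have h2 : Function.Surjective (π ∘ₗ (LinearMap.range (intertwiner (T + Y) T)).subtype) := by
    have h3 := ((Module.End.isUnit_iff _).1
      ((LinearMap.isUnit_iff_isUnit_det _).2 (isUnit_iff_ne_zero.2 hY))).2
    intro u
    obtain ⟨w, hw⟩ := h3 u
    exact ⟨⟨intertwiner (T + Y) T (R w), LinearMap.mem_range_self _ _⟩, hw⟩
  have h3 := (LinearMap.injective_iff_surjective_of_finrank_eq_finrank
    (finrank_range_intertwiner hYT)).2 h2
  -- Evaluated at the identity, the intertwining operator of `S = T + Y` gives `-Y`. This lies in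
  -- its range and, as `Y ∈ B`, also in the kernel of `π`.
  have h4 : intertwiner (T + Y) T 1 = -(Y : Mat4) := by
    rw [intertwiner_apply, one_mul, mul_one]
    abel
  have h5 : (⟨-(Y : Mat4), ⟨1, h4⟩⟩ : LinearMap.range (intertwiner (T + Y) T)) = 0 := by
    refine h3 ?_
    rw [map_zero]
    change π (-(Y : Mat4)) = 0
    rw [map_neg, neg_eq_zero]
    exact (Submodule.projectionOnto_apply_eq_zero_iff hV.symm).2 (hBV ⟨Y, hYB, rfl⟩)
  exact Subtype.ext (neg_eq_zero.1 (congrArg Subtype.val h5))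

end Orbit

section Orbit

open Topology Filter

attribute [local instance] normTopology O22.topology

/-- The projection to the self-adjoint matrices. -/
def symmetrize : Mat4 →L[ℝ] EndPlus :=
  LinearMap.toContinuousLinearMap
    { toFun := fun A => ⟨(1 / 2 : ℝ) • (A + adj A), by
        rw [mem_EndPlus_iff, adj_smul, adj_add, adj_adj, add_comm]⟩
      map_add' := fun A C => by
        apply Subtype.ext
        simp only [adj_add, Submodule.coe_add]
        module
      map_smul' := fun c A => by
        apply Subtype.ext
        simp only [adj_smul, Submodule.coe_smul, RingHom.id_apply]
        module }

theorem symmetrize_coe (S : EndPlus) : symmetrize (S : Mat4) = S := by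
  apply Subtype.ext
  change (1 / 2 : ℝ) • ((S : Mat4) + adj S) = S
  rw [EndPlus.adj_eq]
  module

variable {V : Type} [NormedAddCommGroup V] [NormedSpace ℝ V]

theorem contDiffAt_of_coe {f : V → EndPlus} {v : V}
    (h : ContDiffAt ℝ ∞ (fun v => (f v : Mat4)) v) : ContDiffAt ℝ ∞ f v := by
  have h1 : ContDiffAt ℝ ∞ (fun v => symmetrize (f v : Mat4)) v :=
    symmetrize.contDiff.contDiffAt.comp v h
  simpa only [symmetrize_coe] using h1

theorem hasFDerivAt_of_coe {f : V → EndPlus} {v : V} {f' : V →L[ℝ] EndPlus}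
    (h : HasFDerivAt (fun v => (f v : Mat4)) (EndPlus.subtypeL.comp f') v) :
    HasFDerivAt f f' v := by
  have h1 : HasFDerivAt (fun v => symmetrize (f v : Mat4))
      (symmetrize.comp (EndPlus.subtypeL.comp f')) v := symmetrize.hasFDerivAt.comp v h
  simp only [symmetrize_coe] at h1
  refine h1.congr_fderiv (ContinuousLinearMap.ext fun w => symmetrize_coe _)

/-- A transversal through `T`, moved by `L₀` times Cayley transforms. -/
def orbitChart (T : EndPlus) (L₀ : O22) (α : V →L[ℝ] skew) (γ : V →L[ℝ] EndPlus) (v : V) :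
    EndPlus := (L₀ * cayO (α v)) • (T + γ v)

theorem coe_orbitChart (T : EndPlus) (L₀ : O22) (α : V →L[ℝ] skew) (γ : V →L[ℝ] EndPlus) (v : V) :
    (orbitChart T L₀ α γ v : Mat4) = O22.mat L₀ * O22.mat (cayO (α v)) * (T + γ v) *
      adj (O22.mat (cayO (α v))) * O22.mat L₀⁻¹ := by
  rw [orbitChart, coe_smul_EndPlus, ← O22.mat_inv, O22.mat_mul, _root_.mul_inv_rev, O22.mat_mul,
    ← mul_assoc]
  rfl

theorem eventually_contDiffAt_orbitChart (T : EndPlus) (L₀ : O22) (α : V →L[ℝ] skew)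
    (γ : V →L[ℝ] EndPlus) : ∀ᶠ v in 𝓝 (0 : V), ContDiffAt ℝ ∞ (orbitChart T L₀ α γ) v := by
  filter_upwards [eventually_contDiffAt_cayO_comp α] with v hα
  refine contDiffAt_of_coe ?_
  simp only [coe_orbitChart]
  exact ContDiffAt.mat_mul (ContDiffAt.mat_mul (ContDiffAt.mat_mul
    (ContDiffAt.mat_mul contDiffAt_const hα)
    (contDiffAt_const.add (EndPlus.subtypeL.contDiff.comp γ.contDiff).contDiffAt))
    (ContDiffAt.adj hα)) contDiffAt_const

/-- The action of an element of the group. -/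
def conjEquiv (L : O22) : EndPlus ≃L[ℝ] EndPlus :=
  LinearEquiv.toContinuousLinearEquiv
    { toFun := fun S => L • S
      invFun := fun S => L⁻¹ • S
      map_add' := fun S S' => by
        apply Subtype.ext
        simp [coe_smul_EndPlus, mul_add, add_mul]
      map_smul' := fun c S => by
        apply Subtype.ext
        simp [coe_smul_EndPlus]
      left_inv := inv_smul_smul L
      right_inv := smul_inv_smul L }

/-- The adjoint factor contributes minus the skew direction on the right, which completes `α v * T`
to the commutator `ad T (α v)`. -/
theorem hasFDerivAt_orbitChart (T : EndPlus) (L₀ : O22) (α : V →L[ℝ] skew) (γ : V →L[ℝ] EndPlus)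
    (e : V ≃L[ℝ] EndPlus) (he : ∀ v, e v = ad T (α v) + γ v) :
    HasFDerivAt (orbitChart T L₀ α γ)
      ((e.trans (conjEquiv L₀) : V ≃L[ℝ] EndPlus) : V →L[ℝ] EndPlus) 0 := by
  have h0 := hasFDerivAt_cayO_comp α
  have h1 := HasFDerivAt.mat_mul (hasFDerivAt_const (O22.mat L₀) (0 : V)) h0
  have h2 := HasFDerivAt.mat_mul h1
    (((EndPlus.subtypeL.comp γ).hasFDerivAt (x := (0 : V))).const_add (T : Mat4))
  have h3 := HasFDerivAt.mat_mul h2 (adjL.hasFDerivAt.comp (0 : V) h0)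
  have h4 := HasFDerivAt.mat_mul h3 (hasFDerivAt_const (O22.mat L₀⁻¹) (0 : V))
  refine hasFDerivAt_of_coe (HasFDerivAt.congr_of_eventuallyEq (HasFDerivAt.congr_fderiv h4 ?_)
    (Eventually.of_forall fun v => coe_orbitChart T L₀ α γ v))
  refine ContinuousLinearMap.ext fun v => ?_
  change (O22.mat L₀ * O22.mat (cayO (α 0)) * ((T : Mat4) + (γ 0 : Mat4)) *
      adj (O22.mat (cayO (α 0)))) * (0 : Mat4) +
    (O22.mat L₀ * O22.mat (cayO (α 0)) * ((T : Mat4) + (γ 0 : Mat4)) * adj (α v : Mat4) +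
      (O22.mat L₀ * O22.mat (cayO (α 0)) * (γ v : Mat4) +
        (O22.mat L₀ * (α v : Mat4) + (0 : Mat4) * O22.mat (cayO (α 0))) *
          ((T : Mat4) + (γ 0 : Mat4))) * adj (O22.mat (cayO (α 0)))) * O22.mat L₀⁻¹
    = O22.mat L₀ * (e v : Mat4) * O22.mat L₀⁻¹
  rw [he, Submodule.coe_add, ad_apply, (mem_skew_iff _).1 (α v).2]
  simp only [map_zero, cayO_zero, O22.mat_one, adj_one, Submodule.coe_zero, mul_one, add_zero,
    mul_zero, zero_add]
  congr 1
  noncomm_ring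

variable {D F : Type} [NormedAddCommGroup D] [NormedSpace ℝ D] [CompleteSpace D]
  [NormedAddCommGroup F] [NormedSpace ℝ F] [CompleteSpace F]

/-- Stated for an arbitrary space `N` injected into the orbit, so that it serves both for the
quotient by the commutant and for the orbit with its subspace topology. -/
theorem exists_orbit_slice {N : Type} [TopologicalSpace N] {ι : N → EndPlus} {T : EndPlus}
    (hinj : Function.Injective ι) (hι : Continuous ι) (hr : range ι ⊆ MulAction.orbit O22 T)
    {ρ : O22 → N} (hρ : Continuous ρ) (hρι : ∀ L, ι (ρ L) = L • T) (α : D →L[ℝ] skew)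
    (γ : F →L[ℝ] EndPlus) (e : (D × F) ≃L[ℝ] EndPlus) (he : ∀ v, e v = ad T (α v.1) + γ v.2)
    (hγ : ∀ᶠ y in 𝓝 (0 : F), T + γ y ∈ MulAction.orbit O22 T → y = 0) (L₀ : O22) :
    ∃ (φ : OpenPartialHomeomorph N D) (Ψ : OpenPartialHomeomorph (D × F) EndPlus),
      IsSlice ι φ Ψ ∧ ρ L₀ ∈ φ.source ∧ φ (ρ L₀) = 0 ∧
        ∀ y ∈ φ.target, φ.symm y = ρ (L₀ * cayO (α y)) := by
  let α' := α.comp (ContinuousLinearMap.fst ℝ D F)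
  let γ' := γ.comp (ContinuousLinearMap.snd ℝ D F)
  have hE : ∀ v, e v = ad T (α' v) + γ' v := he
  have hc : ∀ᶠ x in 𝓝 (0 : D), ContinuousAt (fun x => ρ (L₀ * cayO (α x))) x := by
    filter_upwards [eventually_continuousAt_mul_cayO L₀ α 0] with x hx
    refine hρ.continuousAt.comp ?_
    simpa [cayO_zero] using hx
  have hgf : ∀ x : D, ι (ρ (L₀ * cayO (α x))) = orbitChart T L₀ α' γ' (x, 0) := fun x => by
    simp [orbitChart, hρι, α', γ']
  have hr' : ∀ᶠ v in 𝓝 (0 : D × F), orbitChart T L₀ α' γ' v ∈ range ι → v.2 = 0 := by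
    filter_upwards [(continuous_snd.tendsto' (0 : D × F) (0 : F) rfl).eventually hγ] with v hv h
    have h5 := MulAction.mem_orbit_of_mem_orbit (L₀ * cayO (α' v))⁻¹ (hr h)
    rw [orbitChart, inv_smul_smul] at h5
    exact hv h5
  obtain ⟨φ, Ψ, h1, h2, h3, h4⟩ := exists_slice hinj hι (hasFDerivAt_orbitChart T L₀ α' γ' e hE)
    (eventually_contDiffAt_orbitChart T L₀ α' γ') hc (Eventually.of_forall hgf) hr' univ_mem
  simp only [map_zero, cayO_zero, mul_one] at h2 h3
  exact ⟨φ, Ψ, h1, h2, h3, fun y hy => (h4 y hy).2⟩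

end Orbit

/-! ### Dimension of the Lie algebra and linear parametrizations -/

section Data

open Topology Filter

attribute [local instance] normTopology O22.topology

theorem adj_apply (A : Mat4) (i j : Fin 4) :
    adj A i j = ![1, 1, -1, -1] i * A j i * ![1, 1, -1, -1] j := by
  have h : psiGram = Matrix.diagonal ![1, 1, -1, -1] := by
    ext i j
    fin_cases i <;> fin_cases j <;> rfl
  rw [adj, h, Matrix.mul_diagonal, Matrix.diagonal_mul, Matrix.transpose_apply]

theorem finrank_skew : Module.finrank ℝ skew = 6 := by
  let e : (Fin 6 → ℝ) ≃ₗ[ℝ] skew :=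
    { toFun := fun c => ⟨!![0, c 0, c 1, c 2; -c 0, 0, c 3, c 4; c 1, c 3, 0, c 5;
          c 2, c 4, -c 5, 0], by
        rw [mem_skew_iff]
        ext i j
        fin_cases i <;> fin_cases j <;>
          simp [adj_apply]⟩
      invFun := fun X => ![(X : Mat4) 0 1, (X : Mat4) 0 2, (X : Mat4) 0 3, (X : Mat4) 1 2,
        (X : Mat4) 1 3, (X : Mat4) 2 3]
      map_add' := fun c c' => by
        apply Subtype.ext
        ext i j
        fin_cases i <;> fin_cases j <;> simp <;> ring
      map_smul' := fun r c => by
        apply Subtype.ext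
        ext i j
        fin_cases i <;> fin_cases j <;> simp
      left_inv := fun c => by
        ext i
        fin_cases i <;> simp
      right_inv := fun X => by
        have h := (mem_skew_iff _).1 X.2
        have h' : ∀ i j, adj (X : Mat4) i j = -(X : Mat4) i j := fun i j => by rw [h]; rfl
        apply Subtype.ext
        ext i j
        have h1 := h' i j
        have h2 := h' j i
        fin_cases i <;> fin_cases j <;>
          simp [adj_apply] at h1 h2 ⊢ <;> linarith }
  rw [← e.finrank_eq]
  simp

/-- A linear parametrization of a subspace. -/
theorem exists_parametrization {E : Type} [NormedAddCommGroup E] [NormedSpace ℝ E]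
    [FiniteDimensional ℝ E] (S : Submodule ℝ E) {n : ℕ} (hn : Module.finrank ℝ S = n) :
    ∃ f : Euc n →L[ℝ] E, Function.Injective f ∧ LinearMap.range (f : Euc n →ₗ[ℝ] E) = S := by
  have h : Module.finrank ℝ (Euc n) = Module.finrank ℝ S := by simp [hn]
  let e : Euc n ≃ₗ[ℝ] S := LinearEquiv.ofFinrankEq _ _ h
  refine ⟨LinearMap.toContinuousLinearMap (S.subtype ∘ₗ e.toLinearMap),
    Subtype.val_injective.comp e.injective, ?_⟩
  change LinearMap.range (S.subtype ∘ₗ e.toLinearMap) = S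
  rw [LinearMap.range_comp_of_range_eq_top _ e.range, Submodule.range_subtype]

/-- Parametrizations of complementary subspaces. -/
theorem exists_prod_equiv {A C E : Type} [NormedAddCommGroup A] [NormedSpace ℝ A]
    [NormedAddCommGroup C] [NormedSpace ℝ C] [FiniteDimensional ℝ A] [FiniteDimensional ℝ C]
    [NormedAddCommGroup E] [NormedSpace ℝ E] (f : A →L[ℝ] E) (g : C →L[ℝ] E)
    (hf : Function.Injective f) (hg : Function.Injective g)
    (h : IsCompl (LinearMap.range (f : A →ₗ[ℝ] E)) (LinearMap.range (g : C →ₗ[ℝ] E))) :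
    ∃ e : (A × C) ≃L[ℝ] E, ∀ v, e v = f v.1 + g v.2 := by
  let l : (A × C) →ₗ[ℝ] E := LinearMap.coprod (f : A →ₗ[ℝ] E) (g : C →ₗ[ℝ] E)
  have hl : Function.Bijective l := by
    refine ⟨(injective_iff_map_eq_zero l).2 fun v hv => ?_, LinearMap.range_eq_top.1 ?_⟩
    · have h1 : f v.1 = g (-v.2) := by
        rw [map_neg]
        exact eq_neg_of_add_eq_zero_left hv
      have h2 : f v.1 = 0 := Submodule.disjoint_def.1 h.disjoint _ ⟨v.1, rfl⟩ ⟨-v.2, h1.symm⟩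
      have h3 : g v.2 = 0 := by
        rw [h2, map_neg] at h1
        exact neg_eq_zero.1 h1.symm
      exact Prod.ext (hf (h2.trans (map_zero f).symm)) (hg (h3.trans (map_zero g).symm))
    · rw [LinearMap.range_coprod]
      exact h.sup_eq_top
  exact ⟨toCLE (LinearEquiv.ofBijective l hl), fun v => rfl⟩

/-- Linear parametrizations of the Lie algebra of a commutant, of a complement of it, and of a
transversal to the orbit. -/
theorem exists_linear_data (T : EndPlus) {d : ℕ}
    (hd : Module.finrank ℝ (LinearMap.ker (ad T)) = d) :
    ∃ (ε : Euc d →L[ℝ] skew) (μ : Euc (6 - d) →L[ℝ] skew) (j : ℕ) (β : Euc j →L[ℝ] EndPlus)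
      (e : (Euc (6 - d) × Euc d) ≃L[ℝ] skew) (e' : (Euc (6 - d) × Euc j) ≃L[ℝ] EndPlus),
      (∀ v, e v = μ v.1 + ε v.2) ∧ (∀ v, e' v = ad T (μ v.1) + β v.2) ∧
      (∀ x, Commute (T : Mat4) (ε x)) ∧ (∀ x, Commute (T : Mat4) (μ x) → μ x = 0) ∧
      ∀ᶠ y in 𝓝 (0 : Euc j), T + β y ∈ MulAction.orbit O22 T → y = 0 := by
  obtain ⟨m, hm⟩ := (LinearMap.ker (ad T)).exists_isCompl
  obtain ⟨B, hB⟩ := (LinearMap.range (ad T)).exists_isCompl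
  have hdm : Module.finrank ℝ m = 6 - d := by
    have := Submodule.finrank_add_eq_of_isCompl hm
    rw [finrank_skew, hd] at this
    omega
  obtain ⟨ε, hεi, hε⟩ := exists_parametrization _ hd
  obtain ⟨μ, hμi, hμ⟩ := exists_parametrization _ hdm
  obtain ⟨β, hβi, hβ⟩ := exists_parametrization B rfl
  have hε' : ∀ x, ε x ∈ LinearMap.ker (ad T) := fun x => hε.le ⟨x, rfl⟩
  have hμ' : ∀ x, μ x ∈ m := fun x => hμ.le ⟨x, rfl⟩
  have hβ' : ∀ x, β x ∈ B := fun x => hβ.le ⟨x, rfl⟩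
  obtain ⟨e, he⟩ := exists_prod_equiv μ ε hμi hεi (by rw [hμ, hε]; exact hm.symm)
  let δ : Euc (6 - d) →L[ℝ] EndPlus :=
    LinearMap.toContinuousLinearMap (ad T ∘ₗ (μ : Euc (6 - d) →ₗ[ℝ] skew))
  have hδ : ∀ x, δ x = ad T (μ x) := fun x => rfl
  have hδi : Function.Injective δ := (injective_iff_map_eq_zero δ).2 fun x hx => by
    refine hμi ?_
    rw [map_zero]
    exact Submodule.disjoint_def.1 hm.disjoint _ hx (hμ' x)
  have hδr : LinearMap.range (δ : Euc (6 - d) →ₗ[ℝ] EndPlus) = LinearMap.range (ad T) := by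
    refine le_antisymm ?_ ?_
    · rintro _ ⟨x, rfl⟩
      exact ⟨μ x, rfl⟩
    · rintro _ ⟨X, rfl⟩
      obtain ⟨v, rfl⟩ := e.surjective X
      refine ⟨v.1, ?_⟩
      rw [he, map_add, LinearMap.mem_ker.1 (hε' v.2), add_zero]
      rfl
  obtain ⟨e', he'⟩ := exists_prod_equiv δ β hδi hβi (by rw [hδr, hβ]; exact hB)
  refine ⟨ε, μ, _, β, e, e', he, he', fun x => (mem_ker_ad_iff T _).1 (hε' x), fun x hx => ?_, ?_⟩
  · exact Submodule.disjoint_def.1 hm.disjoint _ ((mem_ker_ad_iff T _).2 hx) (hμ' x)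
  · filter_upwards [(β.continuous.tendsto' 0 0 (map_zero β)).eventually
      (eventually_eq_zero_of_add_mem_orbit hB.symm.disjoint)] with y hy hyT
    exact hβi ((hy (hβ' y) hyT).trans (map_zero β).symm)

end Data

/-! ### The smooth structures -/

section Manifolds

open Topology Filter

attribute [local instance] normTopology O22.topology

theorem exists_manifold_O22 :
    ∃ _ : ChartedSpace (Euc 6) O22, IsManifold (𝓡 6) ∞ O22 ∧
      IsSmoothEmbedding (𝓡 6) 𝓘(ℝ, Mat4) ∞ O22.mat ∧
      ∀ (φ : OpenPartialHomeomorph O22 (Euc 6))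
        (Ψ : OpenPartialHomeomorph (Euc 6 × EndPlus) Mat4), IsSlice O22.mat φ Ψ →
          φ ∈ IsManifold.maximalAtlas (𝓡 6) ∞ O22 := by
  have h : Module.finrank ℝ (Euc 6) = Module.finrank ℝ skew := by simp [finrank_skew]
  let e : Euc 6 ≃L[ℝ] skew := toCLE (LinearEquiv.ofFinrankEq _ _ h)
  refine exists_manifold_of_slices O22.mat_injective O22.continuous_mat
    ((e.prodCongr (ContinuousLinearEquiv.refl ℝ EndPlus)).trans sumEquiv) fun L₀ => ?_
  obtain ⟨φ, Ψ, h1, h2, -⟩ := exists_O22_slice e (e : Euc 6 →L[ℝ] skew) 0 (fun x => by simp) L₀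
    univ_mem
  exact ⟨φ, Ψ, h2, h1⟩

theorem exists_manifold_commutant (T : EndPlus) {d : ℕ}
    (hd : Module.finrank ℝ (LinearMap.ker (ad T)) = d) :
    ∃ _ : ChartedSpace (Euc d) (commutant T),
      IsSubmanifold d (fun k : commutant T => O22.mat k) := by
  obtain ⟨ε, μ, j, β, e, e', he, he', hε, hμ, hβ⟩ := exists_linear_data T hd
  let E : (Euc d × (Euc (6 - d) × EndPlus)) ≃L[ℝ] Mat4 :=
    (ContinuousLinearEquiv.prodAssoc ℝ (Euc d) (Euc (6 - d)) EndPlus).symm.trans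
      ((((ContinuousLinearEquiv.prodComm ℝ (Euc d) (Euc (6 - d))).trans e).prodCongr
        (ContinuousLinearEquiv.refl ℝ EndPlus)).trans sumEquiv)
  have hE : ∀ v, E v = ε v.1 + μ v.2.1 + v.2.2 := fun v => by
    change ((e (v.2.1, v.1) : skew) : Mat4) + (v.2.2 : Mat4)
      = (ε v.1 : Mat4) + (μ v.2.1 : Mat4) + (v.2.2 : Mat4)
    rw [he, Submodule.coe_add, add_comm (ε v.1 : Mat4)]
  have hinj : Function.Injective (fun k : commutant T => O22.mat k) :=
    O22.mat_injective.comp Subtype.val_injective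
  obtain ⟨c, h1, h2, -⟩ := exists_manifold_of_slices hinj (commutant_mat_isInducing T).continuous
    E fun k₀ => exists_commutant_slice ε
      (μ.comp (ContinuousLinearMap.fst ℝ (Euc (6 - d)) EndPlus))
      (ContinuousLinearMap.snd ℝ (Euc (6 - d)) EndPlus) E hE hε (fun y hy => hμ _ hy) k₀
  exact ⟨c, h1, h2⟩

/-- The orbit slice uses coordinates in a complement of the Lie algebra of the commutant. Charts of
the group with one Cayley factor from this complement and one from the commutant make the orbit map
a coordinate projection, because the second factor fixes `T`. -/
theorem exists_manifold_orbit [c6 : ChartedSpace (Euc 6) O22] [IsManifold (𝓡 6) ∞ O22]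
    (hat : ∀ (φ : OpenPartialHomeomorph O22 (Euc 6))
      (Ψ : OpenPartialHomeomorph (Euc 6 × EndPlus) Mat4), IsSlice O22.mat φ Ψ →
        φ ∈ IsManifold.maximalAtlas (𝓡 6) ∞ O22)
    (T : EndPlus) {d : ℕ} (hd : Module.finrank ℝ (LinearMap.ker (ad T)) = d) (hd6 : d ≤ 6)
    {N : Type} [TopologicalSpace N] {ι : N → EndPlus}
    (hinj : Function.Injective ι) (hι : Continuous ι)
    {ρ : O22 → N} (hρ : Continuous ρ) (hρs : Function.Surjective ρ) (hρι : ∀ L, ι (ρ L) = L • T) :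
    ∃ _ : ChartedSpace (Euc (6 - d)) N, IsManifold (𝓡 (6 - d)) ∞ N ∧
      IsSmoothEmbedding (𝓡 (6 - d)) 𝓘(ℝ, EndPlus) ∞ ι ∧
      IsSubmersion (𝓡 6) (𝓡 (6 - d)) ∞ ρ := by
  obtain ⟨ε, μ, j, β, e, e', he, he', hε, hμ, hβ⟩ := exists_linear_data T hd
  have hr : range ι ⊆ MulAction.orbit O22 T := by
    rintro _ ⟨n, rfl⟩
    obtain ⟨L, rfl⟩ := hρs n
    rw [hρι]
    exact MulAction.mem_orbit T L
  have hsl := exists_orbit_slice hinj hι hr hρ hρι μ β e' he' hβ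
  obtain ⟨c, h1, h2, h3⟩ := exists_manifold_of_slices hinj hι e' fun n => by
    obtain ⟨L, rfl⟩ := hρs n
    obtain ⟨φ, Ψ, h1, h2, -⟩ := hsl L
    exact ⟨φ, Ψ, h2, h1⟩
  refine ⟨c, h1, h2, IsSubmersionOfComplement.isSubmersion (F := Euc d) fun L₀ => ?_⟩
  have hdim : Module.finrank ℝ (Euc 6) = Module.finrank ℝ (Euc (6 - d) × Euc d) := by
    simp [hd6]
  let s : Euc 6 ≃L[ℝ] (Euc (6 - d) × Euc d) := toCLE (LinearEquiv.ofFinrankEq _ _ hdim)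
  obtain ⟨φ, Ψ, hs, hm, h0, ht⟩ := hsl L₀
  -- The group chart must be small enough that the complement coordinate of each of its points lies
  -- in the range of the orbit chart.
  have hW : {p : Euc 6 × EndPlus | (s p.1).1 ∈ φ.target} ∈ 𝓝 0 := by
    have hc : Continuous fun p : Euc 6 × EndPlus => (s p.1).1 := by fun_prop
    refine hc.continuousAt.preimage_mem_nhds (φ.open_target.mem_nhds ?_)
    have := φ.map_source hm
    rw [h0] at this
    simpa using this
  obtain ⟨φ', Ψ', hs', hm', -, ht'⟩ := exists_O22_slice (s.trans e)
    (μ.comp ((ContinuousLinearMap.fst ℝ (Euc (6 - d)) (Euc d)).comp (s : Euc 6 →L[ℝ] _)))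
    (ε.comp ((ContinuousLinearMap.snd ℝ (Euc (6 - d)) (Euc d)).comp (s : Euc 6 →L[ℝ] _)))
    (fun x => (he (s x)).symm) L₀ hW
  refine IsSubmersionAtOfComplement.mk_of_continuousAt hρ.continuousAt s φ' φ hm' hm
    (hat φ' Ψ' hs') (h3 φ Ψ hs) fun y hy => ?_
  have hy' : y ∈ φ'.target := by simpa using hy
  obtain ⟨h4, h5⟩ := ht' y hy'
  have h6 : ρ (φ'.symm y) = φ.symm (s y).1 := by
    rw [h5, ht _ h4]
    refine hinj ?_
    rw [hρι, hρι, mul_smul]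
    congr 1
    have h7 : cayO (ε (s y).2) ∈ commutant T := cayO_mem_commutant (hε _)
    refine Subtype.ext ?_
    change O22.mat (cayO (ε (s y).2)) * (T : Mat4) * O22.mat (cayO (ε (s y).2))⁻¹ = T
    rw [((mem_commutant_iff _ _).1 h7).symm.eq, mul_assoc, O22.mat_mul_inv, mul_one]
  change φ (ρ (φ'.symm y)) = (s y).1
  rw [h6, φ.right_inv h4]

end Manifolds

/-! ### Quotient and orbit as diffeomorphic submanifolds -/

section Diffeo

open Topology

/-- A bijection of embedded submanifolds that is compatible with the embeddings is a
diffeomorphism. -/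
theorem exists_diffeomorph {n : ℕ} {N N' E : Type} [TopologicalSpace N] [TopologicalSpace N']
    [NormedAddCommGroup E] [NormedSpace ℝ E] [ChartedSpace (Euc n) N] [ChartedSpace (Euc n) N']
    [IsManifold (𝓡 n) ∞ N] [IsManifold (𝓡 n) ∞ N'] {ι : N → E} {ι' : N' → E}
    (h : IsSmoothEmbedding (𝓡 n) 𝓘(ℝ, E) ∞ ι) (h' : IsSmoothEmbedding (𝓡 n) 𝓘(ℝ, E) ∞ ι')
    (Φ : N ≃ N') (hΦ : ∀ x, ι' (Φ x) = ι x) :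
    ∃ Θ : Diffeomorph (𝓡 n) (𝓡 n) N N' ∞, ∀ x, Θ x = Φ x := by
  have h1 : ι' ∘ Φ = ι := funext hΦ
  have h2 : ι ∘ Φ.symm = ι' := funext fun y => by
    rw [Function.comp_apply, ← hΦ, Φ.apply_symm_apply]
  refine ⟨⟨Φ, ?_, ?_⟩, fun x => rfl⟩
  · rw [ContMDiff.iff_comp_isImmersion h'.isImmersion, h1]
    refine ⟨h'.isEmbedding.isInducing.continuous_iff.2 ?_, h.isImmersion.contMDiff⟩
    rw [h1]
    exact h.isEmbedding.continuous
  · rw [ContMDiff.iff_comp_isImmersion h.isImmersion, h2]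
    refine ⟨h.isEmbedding.isInducing.continuous_iff.2 ?_, h'.isImmersion.contMDiff⟩
    rw [h2]
    exact h'.isEmbedding.continuous

theorem continuous_smul_EndPlus (T : EndPlus) : Continuous fun L : O22 => L • T := by
  refine continuous_induced_rng.2 ?_
  have h : (Subtype.val ∘ fun L : O22 => L • T) = fun L : O22 =>
      O22.mat L * (T : Mat4) * adj (O22.mat L) := funext fun L => by
    rw [← O22.mat_inv]
    rfl
  rw [h]
  exact (O22.continuous_mat.mul continuous_const).mul (continuous_adj.comp O22.continuous_mat)

theorem smul_eq_self_iff (T : EndPlus) (L : O22) : L • T = T ↔ L ∈ commutant T := by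
  rw [Subtype.ext_iff, coe_smul_EndPlus, mem_commutant_iff]
  constructor
  · intro h
    change (T : Mat4) * O22.mat L = O22.mat L * T
    nth_rewrite 1 [← h]
    rw [mul_assoc, O22.mat_inv_mul, mul_one]
  · intro h
    rw [← h.eq, mul_assoc, O22.mat_mul_inv, mul_one]

theorem smul_eq_smul_iff (T : EndPlus) (L L' : O22) :
    L • T = L' • T ↔ L⁻¹ * L' ∈ commutant T := by
  rw [← smul_eq_self_iff, mul_smul, inv_smul_eq_iff]
  exact eq_comm

/-- The map `L K ↦ L T L⁻¹` to the space of endomorphisms. -/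
def quotientMap (T : EndPlus) : O22 ⧸ commutant T → EndPlus :=
  Quotient.lift (fun L : O22 => L • T) fun L L' h =>
    (smul_eq_smul_iff T L L').2 (QuotientGroup.leftRel_apply.1 h)

theorem quotientMap_mk (T : EndPlus) (L : O22) :
    quotientMap T (QuotientGroup.mk L) = L • T := rfl

theorem quotientMap_injective (T : EndPlus) : Function.Injective (quotientMap T) := by
  intro x y
  induction x using QuotientGroup.induction_on with | H L => ?_
  induction y using QuotientGroup.induction_on with | H L' => ?_
  intro h
  exact QuotientGroup.eq.2 ((smul_eq_smul_iff T L L').1 h)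

/-- Quotient and orbit get their structures from the same construction applied to two injections
with the same image. The bijection between them is then smooth both ways, and the quotient topology
needs no separate comparison with the subspace topology. -/
theorem exists_smooth_structures :
    ∃ _ : ChartedSpace (Euc 6) O22, IsSubmanifold 6 O22.mat ∧
      ∀ T : EndPlus, Module.finrank ℝ (LinearMap.ker (ad T)) ≤ 6 ∧
        (∃ _ : ChartedSpace (Euc (Module.finrank ℝ (LinearMap.ker (ad T)))) (commutant T),
          IsSubmanifold (Module.finrank ℝ (LinearMap.ker (ad T)))
            (fun k : commutant T => O22.mat k)) ∧
        (∃ (_ : ChartedSpace (Euc (6 - Module.finrank ℝ (LinearMap.ker (ad T))))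
            (O22 ⧸ commutant T))
          (_ : ChartedSpace (Euc (6 - Module.finrank ℝ (LinearMap.ker (ad T))))
            (MulAction.orbit O22 T)),
          IsManifold (𝓡 (6 - Module.finrank ℝ (LinearMap.ker (ad T)))) ∞ (O22 ⧸ commutant T) ∧
          IsSubmersion (𝓡 6) (𝓡 (6 - Module.finrank ℝ (LinearMap.ker (ad T)))) ∞
            (fun L : O22 => (QuotientGroup.mk L : O22 ⧸ commutant T)) ∧
          IsSubmanifold (6 - Module.finrank ℝ (LinearMap.ker (ad T)))
            (Subtype.val : MulAction.orbit O22 T → EndPlus) ∧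
          ∃ Φ : Diffeomorph (𝓡 (6 - Module.finrank ℝ (LinearMap.ker (ad T))))
              (𝓡 (6 - Module.finrank ℝ (LinearMap.ker (ad T)))) (O22 ⧸ commutant T)
              (MulAction.orbit O22 T) ∞,
            ∀ L : O22, (Φ (QuotientGroup.mk L) : EndPlus) = L • T) := by
  obtain ⟨c, h1, h2, h3⟩ := exists_manifold_O22
  refine ⟨c, ⟨h1, h2⟩, fun T => ?_⟩
  obtain ⟨d, hd⟩ : ∃ d, Module.finrank ℝ (LinearMap.ker (ad T)) = d := ⟨_, rfl⟩
  rw [hd]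
  have hd6 : d ≤ 6 := by
    rw [← hd, ← finrank_skew]
    exact Submodule.finrank_le _
  refine ⟨hd6, exists_manifold_commutant T hd, ?_⟩
  let ρ : O22 → MulAction.orbit O22 T := fun L => ⟨L • T, MulAction.mem_orbit T L⟩
  have hρ : Continuous ρ := (continuous_smul_EndPlus T).subtype_mk _
  have hρs : Function.Surjective ρ := by
    rintro ⟨_, L, rfl⟩
    exact ⟨L, rfl⟩
  have hq : Continuous (quotientMap T) := continuous_quot_lift _ (continuous_smul_EndPlus T)
  obtain ⟨cq, q1, q2, q3⟩ := exists_manifold_orbit h3 T hd hd6 (quotientMap_injective T) hq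
    QuotientGroup.continuous_mk QuotientGroup.mk_surjective (quotientMap_mk T)
  obtain ⟨co, o1, o2, -⟩ := exists_manifold_orbit h3 T hd hd6 Subtype.val_injective
    continuous_subtype_val hρ hρs (fun L => rfl)
  have hb : Function.Bijective
      (fun x : O22 ⧸ commutant T => (⟨quotientMap T x, by
        obtain ⟨L, rfl⟩ := QuotientGroup.mk_surjective x
        exact MulAction.mem_orbit T L⟩ : MulAction.orbit O22 T)) := by
    refine ⟨fun x y h => quotientMap_injective T (congrArg Subtype.val h), fun y => ?_⟩
    obtain ⟨L, rfl⟩ := hρs y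
    exact ⟨QuotientGroup.mk L, rfl⟩
  obtain ⟨Θ, hΘ⟩ := exists_diffeomorph q2 o2 (Equiv.ofBijective _ hb) (fun x => rfl)
  refine ⟨cq, co, q1, q3, ⟨o1, o2⟩, Θ, fun L => ?_⟩
  exact congrArg Subtype.val (hΘ (QuotientGroup.mk L))

end Diffeo

/-! ### The degrees of freedom -/

section Parameters

/-- The part of the normal form that depends on its real parameters. -/
def paramForm : (τ : EType) → (Fin τ.numParams → ℝ) → Mat4
  | .I, (x : Fin 1 → ℝ) => !![x 0, 0, 0, 0; 0, x 0, 0, 0; 0, 0, x 0, 0; 0, 0, 0, x 0]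
  | .II, (x : Fin 2 → ℝ) => !![x 0, 0, 0, x 1; 0, x 0, -x 1, 0; 0, x 1, x 0, 0; -x 1, 0, 0, x 0]
  | .IIIa, (x : Fin 2 → ℝ) => !![x 0, 0, 0, 0; 0, x 1, 0, 0; 0, 0, x 1, 0; 0, 0, 0, x 1]
  | .IIIb, (x : Fin 2 → ℝ) => !![x 0, 0, 0, 0; 0, x 0, 0, 0; 0, 0, x 0, 0; 0, 0, 0, x 1]
  | .IV, (x : Fin 3 → ℝ) => !![x 0, 0, 0, 0; 0, x 1, 0, 0; 0, 0, x 1, 0; 0, 0, 0, x 2]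
  | .V, (x : Fin 4 → ℝ) => !![x 0, 0, 0, 0; 0, x 1, x 2, 0; 0, -x 2, x 1, 0; 0, 0, 0, x 3]
  | .VI, (x : Fin 3 → ℝ) => !![x 0, 0, 0, 0; 0, x 1, x 2, 0; 0, -x 2, x 1, 0; 0, 0, 0, x 0]
  | .VII, (x : Fin 2 → ℝ) => !![x 0, 0, 0, 0; 0, x 1, 0, 0; 0, 0, x 0, 0; 0, 0, 0, x 1]
  | .VIII, (x : Fin 4 → ℝ) =>
      !![x 0, 0, x 1, 0; 0, x 2, 0, x 3; -x 1, 0, x 0, 0; 0, -x 3, 0, x 2]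
  | .IX, (x : Fin 4 → ℝ) => !![x 0, 0, 0, 0; 0, x 1, 0, 0; 0, 0, x 2, 0; 0, 0, 0, x 3]

theorem paramForm_add (τ : EType) (x y : Fin τ.numParams → ℝ) :
    paramForm τ (x + y) = paramForm τ x + paramForm τ y := by
  cases τ <;>
    simp only [paramForm, Pi.add_apply, Matrix.of_add_of, Matrix.add_cons, Matrix.head_cons,
      Matrix.tail_cons, Matrix.empty_add_empty, add_zero, neg_add]

theorem paramForm_smul (τ : EType) (c : ℝ) (x : Fin τ.numParams → ℝ) :
    paramForm τ (c • x) = c • paramForm τ x := by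
  cases τ <;>
    simp only [paramForm, Pi.smul_apply, Matrix.smul_of, Matrix.smul_cons, smul_eq_mul, mul_zero,
      mul_neg, Matrix.smul_empty]

/-- `paramForm` as a linear map. -/
def paramMap (τ : EType) : (Fin τ.numParams → ℝ) →ₗ[ℝ] Mat4 where
  toFun := paramForm τ
  map_add' := paramForm_add τ
  map_smul' := paramForm_smul τ

theorem paramMap_apply (τ : EType) (x : Fin τ.numParams → ℝ) : paramMap τ x = paramForm τ x := rfl

theorem normalForm_add (τ : EType) (e : Fin τ.numSigns → ℤˣ) (x y : Fin τ.numParams → ℝ) :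
    normalForm τ e (x + y) = normalForm τ e x + paramForm τ y := by
  cases τ <;> ext i j <;> fin_cases i <;> fin_cases j <;>
    simp [normalForm, paramForm] <;> ring

/-- The parameter directions are built from the identity and the complex structure of each summand,
which commute with the nilpotent and complex parts of the normal form. -/
theorem commute_normalForm (τ : EType) (e : Fin τ.numSigns → ℤˣ) (x y : Fin τ.numParams → ℝ) :
    Commute (normalForm τ e x) (paramForm τ y) := by
  rw [commute_iff_eq]
  cases τ <;> ext i j <;> fin_cases i <;> fin_cases j <;>
    simp [normalForm, paramForm, Matrix.mul_apply, Fin.sum_univ_four] <;> ring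

/-- Complex conjugation of the eigenvalues, on the real parameters. -/
def conjParam : (τ : EType) → (Fin τ.numParams → ℝ) → (Fin τ.numParams → ℝ)
  | .II, (x : Fin 2 → ℝ) => ![x 0, -x 1]
  | .V, (x : Fin 4 → ℝ) => ![x 0, x 1, -x 2, x 3]
  | .VI, (x : Fin 3 → ℝ) => ![x 0, x 1, -x 2]
  | .VIII, (x : Fin 4 → ℝ) => ![x 0, -x 1, x 2, -x 3]
  | _, x => x

/-- Pairing with the conjugate replaces squares of complex numbers by squared absolute values, so
the trace form becomes positive definite in the parameters. -/
theorem eq_zero_of_trace_eq_zero (τ : EType) (x : Fin τ.numParams → ℝ)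
    (h : (paramForm τ x * paramForm τ (conjParam τ x)).trace = 0) : x = 0 := by
  have h1 : ∑ i, x i ^ 2 ≤ 0 := by
    cases τ <;> simp [paramForm, conjParam, Matrix.trace, Fin.sum_univ_four] at h
    case I => exact (Fin.sum_univ_one (fun i => x i ^ 2)).trans_le (by nlinarith)
    case II => exact (Fin.sum_univ_two (fun i => x i ^ 2)).trans_le (by nlinarith)
    case IIIa => exact (Fin.sum_univ_two (fun i => x i ^ 2)).trans_le (by nlinarith)
    case IIIb => exact (Fin.sum_univ_two (fun i => x i ^ 2)).trans_le (by nlinarith)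
    case IV => exact (Fin.sum_univ_three (fun i => x i ^ 2)).trans_le (by nlinarith)
    case V => exact (Fin.sum_univ_four (fun i => x i ^ 2)).trans_le (by nlinarith)
    case VI => exact (Fin.sum_univ_three (fun i => x i ^ 2)).trans_le (by nlinarith)
    case VII => exact (Fin.sum_univ_two (fun i => x i ^ 2)).trans_le (by nlinarith)
    case VIII => exact (Fin.sum_univ_four (fun i => x i ^ 2)).trans_le (by nlinarith)
    case IX => exact (Fin.sum_univ_four (fun i => x i ^ 2)).trans_le (by nlinarith)
  have h2 : ∀ i ∈ Finset.univ, 0 ≤ x i ^ 2 := fun i _ => sq_nonneg _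
  have h3 := (Finset.sum_eq_zero_iff_of_nonneg h2).1 (le_antisymm h1 (Finset.sum_nonneg h2))
  funext i
  exact pow_eq_zero_iff two_ne_zero |>.1 (h3 i (Finset.mem_univ i))

end Parameters

/-! ### The rank of the parametrization -/

section Variations

open Topology Filter

attribute [local instance] normTopology O22.topology

/-- The tangent directions at `T(p)`: the infinitesimal action of the group and the directions of
the real parameters. -/
def tangent {τ : EType} (p : Param τ) : Submodule ℝ Mat4 :=
  (LinearMap.range (ad p.T)).map EndPlus.subtype ⊔ LinearMap.range (paramMap τ)

theorem HasDerivAt.mat_mul {f g : ℝ → Mat4} {f' g' : Mat4} {t : ℝ}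
    (hf : HasDerivAt f f' t) (hg : HasDerivAt g g' t) :
    HasDerivAt (fun t => f t * g t) (f t * g' + f' * g t) t :=
  mulB.hasDerivAt_of_bilinear (fun _ => hf) (fun _ => hg)

theorem HasDerivAt.adj {f : ℝ → Mat4} {f' : Mat4} {t : ℝ} (hf : HasDerivAt f f' t) :
    HasDerivAt (fun t => Neutral.adj (f t)) (Neutral.adj f') t :=
  adjL.hasFDerivAt.comp_hasDerivAt t hf

theorem mem_skew_of_hasDerivAt {L : ℝ → O22} {X : Mat4} (h0 : L 0 = 1)
    (h : HasDerivAt (fun t => O22.mat (L t)) X 0) : X ∈ skew := by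
  have h1 := HasDerivAt.mat_mul (HasDerivAt.adj h) h
  simp only [O22.adj_mul_mat, h0, O22.mat_one, adj_one, one_mul, mul_one] at h1
  have h2 := h1.unique (hasDerivAt_const (0 : ℝ) (1 : Mat4))
  exact eq_neg_of_add_eq_zero_right h2

theorem hasDerivAt_conj_normalForm {τ : EType} (p : Param τ) {L : ℝ → O22} {X : Mat4}
    {y : ℝ → Fin τ.numParams → ℝ} {y' : Fin τ.numParams → ℝ} (hL0 : L 0 = 1) (hy0 : y 0 = p.val)
    (hL : HasDerivAt (fun t => O22.mat (L t)) X 0) (hy : HasDerivAt y y' 0) :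
    HasDerivAt (fun t => O22.mat (L t) * normalForm τ p.sign (y t) * O22.mat (L t)⁻¹)
      (X * p.T - p.T * X + paramForm τ y') 0 := by
  have h1 : HasDerivAt (fun t => normalForm τ p.sign (y t)) (paramForm τ y') 0 := by
    have h2 : (fun t => normalForm τ p.sign (y t)) = fun t =>
        normalForm τ p.sign 0 + LinearMap.toContinuousLinearMap (paramMap τ) (y t) :=
      funext fun t => by
        have := normalForm_add τ p.sign 0 (y t)
        rw [zero_add] at this
        exact this
    rw [h2]
    exact ((LinearMap.toContinuousLinearMap (paramMap τ)).hasFDerivAt.comp_hasDerivAt (0 : ℝ)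
      hy).const_add _
  have h2 := HasDerivAt.mat_mul (HasDerivAt.mat_mul hL h1) (HasDerivAt.adj hL)
  simp only [← O22.mat_inv, (mem_skew_iff X).1 (mem_skew_of_hasDerivAt hL0 hL), hL0, hy0,
    O22.mat_one, adj_one, one_mul, mul_one, mul_neg] at h2
  convert h2 using 1
  change X * normalForm τ p.sign p.val - normalForm τ p.sign p.val * X + _ = _
  abel

/-- One inclusion is the product rule together with the fact that velocities at the identity are
skew-adjoint; for the other, Cayley curves and straight lines of parameters realize every direction.
-/
theorem variations_eq {τ : EType} (p : Param τ) : variations p = tangent p := by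
  ext Z
  rw [SetLike.mem_coe, tangent, Submodule.mem_sup]
  constructor
  · rintro ⟨L, y, hL0, hy0, hL, hy, hZ⟩
    have h1 := hasDerivAt_conj_normalForm p hL0 hy0 hL.hasDerivAt hy.hasDerivAt
    rw [hZ.unique h1]
    exact ⟨_, ⟨_, ⟨⟨_, mem_skew_of_hasDerivAt hL0 hL.hasDerivAt⟩, rfl⟩, rfl⟩, _, ⟨_, rfl⟩, rfl⟩
  · rintro ⟨_, ⟨_, ⟨X, rfl⟩, rfl⟩, _, ⟨y', rfl⟩, rfl⟩
    have hL0 : cayO ((0 : ℝ) • X) = 1 := by rw [zero_smul, cayO_zero]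
    have hy0 : p.val + (0 : ℝ) • y' = p.val := by rw [zero_smul, add_zero]
    have hX : HasDerivAt (fun t : ℝ => t • X) X 0 := by
      simpa using (hasDerivAt_id (0 : ℝ)).smul_const X
    have hL : HasDerivAt (fun t : ℝ => O22.mat (cayO (t • X))) X 0 := by
      have h1 : HasFDerivAt (fun X => O22.mat (cayO X)) skew.subtypeL ((0 : ℝ) • X) := by
        rw [zero_smul]
        exact hasFDerivAt_cayO
      exact h1.comp_hasDerivAt (0 : ℝ) hX
    have hy : HasDerivAt (fun t : ℝ => p.val + t • y') y' 0 := by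
      simpa using ((hasDerivAt_id (0 : ℝ)).smul_const y').const_add p.val
    exact ⟨fun t => cayO (t • X), fun t => p.val + t • y', hL0, hy0, hL.differentiableAt,
      hy.differentiableAt, hasDerivAt_conj_normalForm p hL0 hy0 hL hy⟩

/-- A commutator with `T` is trace-orthogonal to everything that commutes with `T`. The conjugate of
a parameter direction commutes with `T`, and its pairing with the direction itself is a definite
form. -/
theorem disjoint_tangent {τ : EType} (p : Param τ) :
    Disjoint ((LinearMap.range (ad p.T)).map EndPlus.subtype) (LinearMap.range (paramMap τ)) := by
  rw [Submodule.disjoint_def]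
  rintro _ ⟨_, ⟨X, rfl⟩, rfl⟩ ⟨y, hy⟩
  have h1 : paramForm τ y = (X : Mat4) * p.T - p.T * X := hy
  have h2 : (p.T : Mat4) * paramForm τ (conjParam τ y) = paramForm τ (conjParam τ y) * p.T :=
    (commute_normalForm τ p.sign p.val _).eq
  have h3 : y = 0 := by
    refine eq_zero_of_trace_eq_zero τ y ?_
    rw [h1, sub_mul, Matrix.trace_sub, mul_assoc, h2, ← mul_assoc, mul_assoc (p.T : Mat4),
      Matrix.trace_mul_comm (p.T : Mat4), sub_self]
  rw [← hy, h3, map_zero]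

/-- The sum of tangent directions is direct, the parameters enter injectively, and rank-nullity for
`ad` on the six-dimensional Lie algebra gives the first summand. No genericity is involved, since
the dimension of the kernel is taken at `p` itself. -/
theorem degreesOfFreedom_eq {τ : EType} (p : Param τ) :
    degreesOfFreedom p = (6 - Module.finrank ℝ (LinearMap.ker (ad p.T))) + τ.numParams := by
  have h1 : Submodule.span ℝ (variations p) = tangent p := by
    rw [variations_eq, Submodule.span_eq]
  have h2 := Submodule.finrank_sup_add_finrank_inf_eq
    ((LinearMap.range (ad p.T)).map EndPlus.subtype) (LinearMap.range (paramMap τ))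
  rw [(disjoint_tangent p).eq_bot, finrank_bot, add_zero] at h2
  have h3 : Function.Injective (paramMap τ) := (injective_iff_map_eq_zero _).2 fun y hy => by
    refine eq_zero_of_trace_eq_zero τ y ?_
    rw [← paramMap_apply, hy, zero_mul, Matrix.trace_zero]
  have h4 := LinearMap.finrank_range_add_finrank_ker (ad p.T)
  rw [finrank_skew] at h4
  rw [degreesOfFreedom, h1, tangent, h2, LinearMap.finrank_range_of_inj h3, Module.finrank_fin_fun,
    (Submodule.equivMapOfInjective EndPlus.subtype EndPlus.subtype_injective _).finrank_eq.symm]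
  omega

end Variations

end Neutral

end

open Neutral in
theorem mainTheorem4 :
    -- the action is not transitive
    ¬ MulAction.IsPretransitive O22 EndPlus ∧
    -- each orbit lies in exactly one type
    (∀ S : EndPlus, ∃! τ : EType, MulAction.orbit O22 S ⊆ ofType τ) ∧
    -- each type is the disjoint union of the orbits of its normal forms
    (∀ τ : EType, ofType τ = ⋃ p : Param τ, MulAction.orbit O22 p.T) ∧
    (∀ (τ : EType) (p q : Param τ),
      (SameData τ p q → MulAction.orbit O22 p.T = MulAction.orbit O22 q.T) ∧
      (¬ SameData τ p q → Disjoint (MulAction.orbit O22 p.T) (MulAction.orbit O22 q.T))) ∧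
    -- the orbits in terms of matrices with respect to pseudo-orthonormal and Witt bases
    (∀ (τ : EType) (p : Param τ) (S : EndPlus),
      (S ∈ MulAction.orbit O22 p.T ↔
        HasMatrixInBasis S psiGram (normalForm τ p.sign p.val)) ∧
      (S ∈ MulAction.orbit O22 p.T ↔
        HasMatrixInBasis S wittGram (wittForm τ p.sign p.val))) ∧
    -- the smooth structure of the orbits and the degrees of freedom
    (∃ _ : ChartedSpace (Euc 6) O22, IsSubmanifold 6 O22.mat ∧
      ∀ (τ : EType) (p : Param τ), ∃ d : ℕ, d ≤ 6 ∧
        (∃ _ : ChartedSpace (Euc d) (commutant p.T),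
          IsSubmanifold d (fun k : commutant p.T => O22.mat k)) ∧
        (∃ (_ : ChartedSpace (Euc (6 - d)) (O22 ⧸ commutant p.T))
          (_ : ChartedSpace (Euc (6 - d)) (MulAction.orbit O22 p.T)),
          IsManifold (𝓡 (6 - d)) ∞ (O22 ⧸ commutant p.T) ∧
          IsSubmersion (𝓡 6) (𝓡 (6 - d)) ∞
            (fun L : O22 => (QuotientGroup.mk L : O22 ⧸ commutant p.T)) ∧
          IsSubmanifold (6 - d) (Subtype.val : MulAction.orbit O22 p.T → EndPlus) ∧
          ∃ Φ : Diffeomorph (𝓡 (6 - d)) (𝓡 (6 - d)) (O22 ⧸ commutant p.T)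
              (MulAction.orbit O22 p.T) ∞,
            ∀ L : O22, (Φ (QuotientGroup.mk L) : EndPlus) = L • p.T) ∧
        degreesOfFreedom p = (6 - d) + τ.numParams) ∧
    -- for generic parameter values the commutant does not depend on them
    (∀ (τ : EType) (p q : Param τ), NoCoincidence τ p.val → NoCoincidence τ q.val →
      commutant p.T = commutant q.T) ∧
    (∀ τ : EType, IsOpen {x : Fin τ.numParams → ℝ | Admissible τ x ∧ NoCoincidence τ x} ∧
      Dense {x : Fin τ.numParams → ℝ | Admissible τ x ∧ NoCoincidence τ x}) := by
  refine ⟨not_isPretransitive, existsUnique_type, ofType_eq_iUnion_orbit,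
    fun τ p q => ⟨orbit_eq_of_sameData τ p q, disjoint_orbit_of_not_sameData⟩,
    fun τ p S => mem_orbit_T_iff_bases p S, ?_,
    fun τ p q => commutant_eq_of_noCoincidence p q, isOpen_and_dense_generic⟩
  obtain ⟨c, h1, h2⟩ := exists_smooth_structures
  refine ⟨c, h1, fun τ p => ⟨_, (h2 p.T).1, (h2 p.T).2.1, (h2 p.T).2.2, ?_⟩⟩
  exact degreesOfFreedom_eq p
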